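/- **Setting.** Let $\mathcal M\subset\mathbb R^n$ be a compact embedded smooth submanifold of diameter $\mathcal D$, $T_x\mathcal M$ its tangent space at $x$, $\mathcal P_{T_x\mathcal M}$ the orthogonal projection onto it. Let $\mathcal R:T\mathcal M\to\mathcal M$ be a retraction (smooth, $\mathcal R_x(0)=x$, $d\mathcal R_x(0)=\mathrm{id}$), and let $\mathcal T$ be an isometric vector transport: $\mathcal T_\omega u\in T_{\mathcal R_x(\omega)}\mathcal M$ for $\omega,u\in T_x\mathcal M$, smooth on $T\mathcal M\oplus T\mathcal M$, linear and inner-product preserving in $u$, with $\mathcal T_{0}u=u$. For $y=\mathcal R_x(\omega)$ write $\mathcal T_x^y=\mathcal T_\omega$ and $\mathcal T_y^x=(\mathcal T_\omega)^{-1}$. Let $\xi$ be a random variable, $f(\cdot,\xi):\mathbb R^n\to\mathbb R$ continuously differentiable with $f(x,\cdot)$ integrable, $F(x)=\mathbb E_\xi f(x,\xi)$, $g:\mathbb R^m\to\mathbb R$, $A\in\mathbb R^{m\times n}$. For differentiable $h$ put $\operatorname{grad}h(x)=\mathcal P_{T_x\mathcal M}(\nabla h(x))$, and $\mathcal L_\rho(x,y,\lambda)=F(x)+g(y)-\langle\lambda,Ax-y\rangle+\frac\rho2\|Ax-y\|^2$.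 **Assumptions.** (1) $F$ is differentiable, $\nabla F$ is $L_{\nabla F}$-Lipschitz on the convex hull of $\mathcal M$, and $g$ is convex, $L_g$-Lipschitz and bounded below; put $F^*=\inf_{\mathcal M}F$, $g^*=\inf g$. (2) For all $x\in\mathcal M$, $\operatorname{grad}f(x,\xi)$ is square integrable, $\mathbb E_\xi\operatorname{grad}f(x,\xi)=\operatorname{grad}F(x)$ and $\mathbb E_\xi\|\operatorname{grad}f(x,\xi)-\operatorname{grad}F(x)\|^2\le\sigma^2$. (3) For all $x\in\mathcal M$, $\omega\in T_x\mathcal M$ and $y=\mathcal R_x(\omega)$: $\mathbb E_\xi\|\operatorname{grad}f(x,\xi)-\mathcal T_y^x\operatorname{grad}f(y,\xi)\|^2\le\tilde L^2\|\omega\|^2$. **Algorithm (MARS-ADMM).** Given $x_1\in\mathcal M$, $y_1,\lambda_1\in\mathbb R^m$, $\beta_1>0$ and positive $c_\rho,c_\eta,c_\beta,c_\alpha$, put $\rho_k=c_\rho k^{1/3}$, $\eta_k=c_\eta k^{-1/3}$, $\alpha_{k+1}=c_\alpha k^{-2/3}$. Let $\mathcal S_1,\mathcal S_2,\dots$ be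 non-empty batches of deterministic sizes, all samples being i.i.d. copies of $\xi$, and $\operatorname{grad}f_{\mathcal S}=\frac1{|\mathcal S|}\sum_{\xi\in\mathcal S}\operatorname{grad}f(\cdot,\xi)$. Start with $v_1=\operatorname{grad}f_{\mathcal S_1}(x_1)$ and for $k=1,2,\dots$ let $$y_{k+1}=\arg\min_y\mathcal L_{\rho_k}(x_k,y,\lambda_k),\quad \mathcal G_k=v_k+\mathcal P_{T_{x_k}\mathcal M}\big(\rho_kA^\top(Ax_k-y_{k+1}-\lambda_k/\rho_k)\big),\quad x_{k+1}=\mathcal R_{x_k}(-\eta_k\mathcal G_k),$$ $$\beta_{k+1}=\min\Big(\tfrac{\beta_1\|Ax_1-y_1\|}{\|Ax_{k+1}-y_{k+1}\|(k+2)^2\ln(k+3)},\tfrac{c_\beta}{k^{1/3}\ln^2(k+2)}\Big),\quad \lambda_{k+1}=\lambda_k-\beta_{k+1}(Ax_{k+1}-y_{k+1}),$$ $$v_{k+1}=\operatorname{grad}f_{\mathcal S_{k+1}}(x_{k+1})+(1-\alpha_{k+1})\mathcal T_{x_k}^{x_{k+1}}\big(v_k-\operatorname{grad}f_{\mathcal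 S_{k+1}}(x_k)\big)$$ (if $Ax_{k+1}=y_{k+1}$, the first term of the minimum is $+\infty$). Put $\bar\lambda_k=\lambda_{k-1}-\rho_{k-1}(Ax_k-y_k)$ and $\varepsilon_k=v_k-\operatorname{grad}F(x_k)$. **Constants.** There exist $p,q>0$ and $L_p,\zeta\ge0$ such that for all $x,z\in\mathcal M$, $u,\omega\in T_x\mathcal M$, $w\in\mathbb R^n$, $$\|\mathcal R_x(u)-x\|\le p\|u\|,\quad\|\mathcal R_x(u)-x-u\|\le q\|u\|^2,\quad\|\mathcal P_{T_x\mathcal M}w-\mathcal P_{T_z\mathcal M}w\|\le L_p\|w\|\|x-z\|,\quad\|\mathcal T_\omega u-u\|\le\zeta\|\omega\|\|u\|.$$ For any such constants put $\mathcal B=\max_{\mathcal M}\|\nabla F\|$, $\lambda_{\max}=\|\lambda_1\|+\frac{\pi^2}6\beta_1\|Ax_1-y_1\|$, $\Theta=\mathcal B+\|A\|^2\mathcal D+\|A\|(L_g+\lambda_{\max}+2\|A\|\mathcal D)+\|A\|\lambda_{\max}$, $M=(L_{\nabla F}+\|A\|^2)p^2+2q\Theta$, $N=(pL_p+\zeta)(\mathcal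 B+\|A\|L_g)+p(L_{\nabla F}+\|A\|^2)$, $\psi^*=F^*+g^*-\lambda_{\max}(L_g+\lambda_{\max}+\|A\|\mathcal D)$, $\mathcal C_1=\sum_{k\ge1}k^{-4/3}$, $\mathcal C_2=\sum_{k\ge1}\frac{1}{k\ln^2(k+2)}$. **Parameters.** Let $c_\rho\ge2\sqrt2$, $0.8\le c_\alpha\le1$, $0<c_\beta\le c_\rho/3$, and let $0<c_\nu\le c_\rho$, $0<c_\gamma\le c_\rho$ with $c_\nu c_\gamma\ge8$, and $$0<c_\eta\le\min\Big\{\tfrac1{8p^2\|A\|^2},\tfrac1{1+M},\tfrac1N,\tfrac1{8\tilde L^2}\Big\}\tfrac1{c_\rho}\qquad(\text{with }1/0=+\infty).$$ Let $\psi_k=\mathbb E[\mathcal L_{\rho_k}(x_k,y_k,\lambda_k)+\gamma_k\|\varepsilon_k\|^2]$ with $\gamma_k=c_\gamma(k-1)^{1/3}$ (so $\gamma_1=0$), and $$\mathcal C=\psi_1-\psi^*+2c_\gamma c_\alpha^2\sigma^2(1+\ln K)+\Big(\frac{\mathcal C_1}{3c_\rho}+\frac{2c_\beta\mathcal C_2}{c_\rho^2}\Big)(L_g+\lambda_{\max})^2,\qquad\mathcal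 Q=\frac{8\,\mathcal C}{\min\{4c_\alpha c_\gamma,c_\eta\}}.$$ **Theorem (Complexity of MARS-ADMM).** (a) For every integer $K>2$ there is an integer $\kappa\in[\lceil K/2\rceil,K]$ such that the following expectations exist and $$\mathbb E\big[\|\mathcal P_{T_{x_\kappa}\mathcal M}(-A^\top\bar\lambda_\kappa)+\operatorname{grad}F(x_\kappa)\|\big]\le4\sqrt{\mathcal Q}\,(K+1)^{-1/3},$$ $$\mathbb E\big[\operatorname{dist}(-\bar\lambda_\kappa,\partial g(y_\kappa))\big]\le2p\|A\|\sqrt{\mathcal Q}\,(K+1)^{-1/3},$$ $$\mathbb E\big[\|Ax_\kappa-y_\kappa\|\big]\le2\Big(2p\|A\|c_\eta\sqrt{\mathcal Q}+\frac{L_g+\lambda_{\max}}{c_\rho}\Big)(K-2)^{-1/3}.$$ (b) Consequently the iteration and oracle complexities are $\tilde{\mathcal O}(\epsilon^{-3})$: for every $b_{\max}\in\mathbb N$ there is a constant $C_0>0$, independent of $\epsilon$ and of the run of the algorithm, such that for every $\epsilon\in(0,1)$ there is an integer $K>2$ with $K\le C_0\,\epsilon^{-3}(1+\ln\frac1\epsilon)^{3/2}$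 for which every run with batch sizes $|\mathcal S_k|\le b_{\max}$ makes at most $C_0\,\epsilon^{-3}(1+\ln\frac1\epsilon)^{3/2}$ oracle calls in its first $K$ iterations (initialization included; each stochastic gradient, proximal map and retraction counts as one call) and satisfies, for some $\kappa\in[\lceil K/2\rceil,K]$, that $x_\kappa\in\mathcal M$ and the three expectations in (a) are at most $\epsilon$. -/

import Mathlib

open MeasureTheory ProbabilityTheory
open scoped NNReal

noncomputable section

namespace MarsAdmm

/-- `ℝⁿ` with its Euclidean inner product. -/
abbrev E (n : ℕ) : Type := EuclideanSpace ℝ (Fin n)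

/-! ### Embedded submanifolds, tangent spaces, retractions, vector transports -/

/-- `M ⊆ ℝⁿ` is an embedded smooth submanifold: for some codimension `c`, it is locally the zero
set of a smooth submersion into `ℝᶜ`. -/
def IsEmbeddedSubmanifold {n : ℕ} (M : Set (E n)) : Prop :=
  ∃ c : ℕ, ∀ x ∈ M, ∃ U : Set (E n), IsOpen U ∧ x ∈ U ∧ ∃ h : E n → E c,
    ContDiffOn ℝ (⊤ : ℕ∞) h U ∧ (∀ z ∈ U, Function.Surjective (fderiv ℝ h z)) ∧
    M ∩ U = {z ∈ U | h z = 0}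

/-- Velocities at `x` of differentiable curves in `M` through `x`. -/
def curveVelocities {n : ℕ} (M : Set (E n)) (x : E n) : Set (E n) :=
  {u | ∃ γ : ℝ → E n, ∃ δ > 0, γ 0 = x ∧ (∀ t ∈ Set.Icc (-δ) δ, γ t ∈ M) ∧
    DifferentiableOn ℝ γ (Set.Icc (-δ) δ) ∧ HasDerivAt γ u 0}

/-- The tangent space `T_x M`. On an embedded submanifold the set of velocities is already a
linear subspace; the span only serves to make this part of the type. -/
def tangentSpace {n : ℕ} (M : Set (E n)) (x : E n) : Submodule ℝ (E n) :=
  Submodule.span ℝ (curveVelocities M x)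

/-- The orthogonal projection of `ℝⁿ` onto `T_x M`. -/
def proj {n : ℕ} (M : Set (E n)) (x : E n) : E n →L[ℝ] E n :=
  (tangentSpace M x).starProjection

/-- The Riemannian gradient at `x` of (the restriction to `M` of) `F`. -/
def rgrad {n : ℕ} (M : Set (E n)) (F : E n → ℝ) (x : E n) : E n :=
  proj M x (gradient F x)

/-- The tangent bundle `TM`, inside `ℝⁿ × ℝⁿ`. -/
def tangentBundle {n : ℕ} (M : Set (E n)) : Set (E n × E n) :=
  {z | z.1 ∈ M ∧ z.2 ∈ tangentSpace M z.1}

/-- The Whitney sum `TM ⊕ TM`, inside `ℝⁿ × ℝⁿ × ℝⁿ`. -/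
def tangentSum {n : ℕ} (M : Set (E n)) : Set (E n × E n × E n) :=
  {z | z.1 ∈ M ∧ z.2.1 ∈ tangentSpace M z.1 ∧ z.2.2 ∈ tangentSpace M z.1}

/-- `R x u` (written `R_x(u)`) is a retraction; only its values on `TM` matter. -/
structure IsRetraction {n : ℕ} (M : Set (E n)) (R : E n → E n → E n) : Prop where
  mapsTo : ∀ x ∈ M, ∀ u ∈ tangentSpace M x, R x u ∈ M
  smooth : ContDiffOn ℝ (⊤ : ℕ∞) (fun z : E n × E n => R z.1 z.2) (tangentBundle M)
  map_zero : ∀ x ∈ M, R x 0 = x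
  deriv_zero : ∀ x ∈ M,
    HasFDerivWithinAt (R x) (ContinuousLinearMap.id ℝ (E n)) (tangentSpace M x : Set (E n)) 0

/-- `T x ω u` is an isometric vector transport associated with `R`: it moves `u ∈ T_x M` to the
tangent space at `R_x(ω)`. Only its values on `TM ⊕ TM` matter. -/
structure IsIsometricTransport {n : ℕ} (M : Set (E n)) (R : E n → E n → E n)
    (T : E n → E n → E n → E n) : Prop where
  mapsTo : ∀ x ∈ M, ∀ ω ∈ tangentSpace M x, ∀ u ∈ tangentSpace M x,
    T x ω u ∈ tangentSpace M (R x ω)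
  smooth : ContDiffOn ℝ (⊤ : ℕ∞) (fun z : E n × E n × E n => T z.1 z.2.1 z.2.2) (tangentSum M)
  zero_apply : ∀ x ∈ M, ∀ u ∈ tangentSpace M x, T x 0 u = u
  linear : ∀ x ∈ M, ∀ ω ∈ tangentSpace M x, ∀ u ∈ tangentSpace M x, ∀ w ∈ tangentSpace M x,
    ∀ a b : ℝ, T x ω (a • u + b • w) = a • T x ω u + b • T x ω w
  isometric : ∀ x ∈ M, ∀ ω ∈ tangentSpace M x, ∀ u ∈ tangentSpace M x, ∀ w ∈ tangentSpace M x,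
    inner ℝ (T x ω u) (T x ω w) = inner ℝ u w

/-! ### The problem `min_{x ∈ M} E f(x, ξ) + g(A x)` -/

/-- The data of the problem, together with a retraction `R` and a vector transport `T`. -/
structure Problem (n m : ℕ) (Ξ : Type*) [MeasurableSpace Ξ] where
  M : Set (E n)
  R : E n → E n → E n
  T : E n → E n → E n → E n
  /-- law of the sample `ξ` -/
  P : Measure Ξ
  f : E n → Ξ → ℝ
  g : E m → ℝ
  A : E n →L[ℝ] E m

/-- The subdifferential of a convex function `g : ℝᵐ → ℝ`. -/
def subdiff {m : ℕ} (g : E m → ℝ) (y : E m) : Set (E m) :=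
  {s | ∀ z, g y + inner ℝ s (z - y) ≤ g z}

namespace Problem

variable {n m : ℕ} {Ξ : Type*} [MeasurableSpace Ξ] (Pb : Problem n m Ξ)

/-- `F(x) = E f(x, ξ)`. -/
def F (x : E n) : ℝ := ∫ s, Pb.f x s ∂Pb.P

/-- `grad F(x)`. -/
def gradF (x : E n) : E n := rgrad Pb.M Pb.F x

/-- `grad f(x, ξ)`. -/
def gradf (x : E n) (s : Ξ) : E n := rgrad Pb.M (fun z => Pb.f z s) x

/-- `Aᵀ`. -/
def At : E m →L[ℝ] E n := ContinuousLinearMap.adjoint Pb.A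

/-- The augmented Lagrangian. -/
def augLag (ρ : ℝ) (x : E n) (y lam : E m) : ℝ :=
  Pb.F x + Pb.g y - inner ℝ lam (Pb.A x - y) + ρ / 2 * ‖Pb.A x - y‖ ^ 2

/-- The basic setting: sample space, integrand, manifold, retraction, transport. -/
structure Setting : Prop where
  isProb : IsProbabilityMeasure Pb.P
  submanifold : IsEmbeddedSubmanifold Pb.M
  retraction : IsRetraction Pb.M Pb.R
  transport : IsIsometricTransport Pb.M Pb.R Pb.T
  f_diff : ∀ s, ContDiff ℝ 1 (fun x => Pb.f x s)
  f_meas : ∀ x, Measurable (Pb.f x)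
  f_int : ∀ x, Integrable (Pb.f x) Pb.P

/-- Compactness of `M`, Lipschitz gradient of `F`, and `g` convex, Lipschitz, bounded below.
(`F` is then automatically bounded below on the compact set `M`.) -/
structure Regular (LF Lg : ℝ≥0) : Prop where
  compact : IsCompact Pb.M
  F_diff : Differentiable ℝ Pb.F
  F_lip : LipschitzOnWith LF (gradient Pb.F) (convexHull ℝ Pb.M)
  g_convex : ConvexOn ℝ Set.univ Pb.g
  g_lip : LipschitzWith Lg Pb.g
  g_bdd : BddBelow (Set.range Pb.g)

/-- Unbiased stochastic gradients with variance at most `σ²`. -/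
structure BoundedVariance (σ : ℝ) : Prop where
  memLp : ∀ x ∈ Pb.M, MemLp (Pb.gradf x) 2 Pb.P
  unbiased : ∀ x ∈ Pb.M, ∫ s, Pb.gradf x s ∂Pb.P = Pb.gradF x
  variance : ∀ x ∈ Pb.M, ∫ s, ‖Pb.gradf x s - Pb.gradF x‖ ^ 2 ∂Pb.P ≤ σ ^ 2

/-- Mean-squared retraction-Lipschitz stochastic gradients. With `y = R_x(ω)`, the transport
`T_y^x` back along `t ↦ R_x(tω)` is the inverse of the isometry `T x ω : T_x M → T_y M`, so
`‖grad f(x,ξ) - T_y^x grad f(y,ξ)‖ = ‖T x ω (grad f(x,ξ)) - grad f(y,ξ)‖`. -/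
def MeanSqLipschitz (Lt : ℝ) : Prop :=
  ∀ x ∈ Pb.M, ∀ ω ∈ tangentSpace Pb.M x,
    ∫ s, ‖Pb.T x ω (Pb.gradf x s) - Pb.gradf (Pb.R x ω) s‖ ^ 2 ∂Pb.P ≤ Lt ^ 2 * ‖ω‖ ^ 2

end Problem

/-! ### The algorithm -/

/-- Input of the algorithm: initial point and parameters. -/
structure Params (n m : ℕ) where
  x₁ : E n
  y₁ : E m
  lam₁ : E m
  cρ : ℝ
  cη : ℝ
  cβ : ℝ
  cα : ℝ
  β₁ : ℝ

namespace Params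

variable {n m : ℕ} (prm : Params n m)

/-- `ρ_k = c_ρ k^{1/3}`. -/
def ρ (k : ℕ) : ℝ := prm.cρ * (k : ℝ) ^ (1 / 3 : ℝ)

/-- `η_k = c_η k^{-1/3}`. -/
def η (k : ℕ) : ℝ := prm.cη * (k : ℝ) ^ (-(1 / 3) : ℝ)

/-- `α_{k+1} = c_α k^{-2/3}`, as a function of `k`. -/
def αSucc (k : ℕ) : ℝ := prm.cα * (k : ℝ) ^ (-(2 / 3) : ℝ)

end Params

/-- Batch sizes `b k`, samples `ξ k i` (`i < b k`) and iterates, as random variables on `Ω`.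
Iterations are numbered from `1`; the entries at index `0` play no role. -/
structure Trajectory (n m : ℕ) (Ω Ξ : Type*) where
  b : ℕ → ℕ
  ξ : (k : ℕ) → Fin (b k) → Ω → Ξ
  x : ℕ → Ω → E n
  y : ℕ → Ω → E m
  lam : ℕ → Ω → E m
  v : ℕ → Ω → E n
  β : ℕ → Ω → ℝ

namespace Trajectory

variable {n m : ℕ} {Ω Ξ : Type*} [MeasurableSpace Ξ]
  (S : Trajectory n m Ω Ξ) (Pb : Problem n m Ξ) (prm : Params n m)

/-- The mini-batch Riemannian gradient `grad f_{S_k}(z)`. -/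
def batchGrad (k : ℕ) (ω : Ω) (z : E n) : E n :=
  (S.b k : ℝ)⁻¹ • ∑ i : Fin (S.b k), Pb.gradf z (S.ξ k i ω)

/-- The direction `G_k = v_k + P_{T_{x_k} M}(ρ_k Aᵀ(A x_k - y_{k+1} - λ_k / ρ_k))`. -/
def G (k : ℕ) (ω : Ω) : E n :=
  S.v k ω + proj Pb.M (S.x k ω)
    (prm.ρ k • Pb.At (Pb.A (S.x k ω) - S.y (k + 1) ω - (prm.ρ k)⁻¹ • S.lam k ω))

/-- The tangent step `-η_k G_k`. -/
def step (k : ℕ) (ω : Ω) : E n := -(prm.η k • S.G Pb prm k ω)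

/-- The estimation error `ε_k = v_k - grad F(x_k)`. -/
def err (k : ℕ) (ω : Ω) : E n := S.v k ω - Pb.gradF (S.x k ω)

/-- `λ̄_k = λ_{k-1} - ρ_{k-1}(A x_k - y_k)`, for `k ≥ 2`. -/
def lamBar (k : ℕ) (ω : Ω) : E m :=
  S.lam (k - 1) ω - prm.ρ (k - 1) • (Pb.A (S.x k ω) - S.y k ω)

/-- The dual stepsize `β_{k+1}`; the first term of the minimum is `+∞` if
`A x_{k+1} = y_{k+1}`. -/
def betaSucc (k : ℕ) (ω : Ω) : ℝ :=
  let r : ℝ := ‖Pb.A (S.x (k + 1) ω) - S.y (k + 1) ω‖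
  let s : ℝ := prm.cβ / ((k : ℝ) ^ (1 / 3 : ℝ) * Real.log (k + 2) ^ 2)
  if r = 0 then s
  else min (prm.β₁ * ‖Pb.A prm.x₁ - prm.y₁‖ / (r * (k + 2) ^ 2 * Real.log (k + 3))) s

/-- `S` is produced by MARS-ADMM on `Pb` with input `prm`, the samples being i.i.d. with law
`Pb.P` under `μ` and the batches being non-empty. -/
structure IsMarsAdmm [MeasurableSpace Ω] (μ : Measure Ω) : Prop where
  batch_pos : ∀ k, 1 ≤ k → 1 ≤ S.b k
  sample_meas : ∀ k i, Measurable (S.ξ k i)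
  sample_law : ∀ k i, μ.map (S.ξ k i) = Pb.P
  sample_indep : iIndepFun (fun j : (Σ k : ℕ, Fin (S.b k)) => S.ξ j.1 j.2) μ
  x_one : ∀ ω, S.x 1 ω = prm.x₁
  y_one : ∀ ω, S.y 1 ω = prm.y₁
  lam_one : ∀ ω, S.lam 1 ω = prm.lam₁
  beta_one : ∀ ω, S.β 1 ω = prm.β₁
  v_one : ∀ ω, S.v 1 ω = S.batchGrad Pb 1 ω prm.x₁
  y_succ : ∀ k, 1 ≤ k → ∀ ω,
    IsMinOn (fun z => Pb.augLag (prm.ρ k) (S.x k ω) z (S.lam k ω)) Set.univ (S.y (k + 1) ω)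
  x_succ : ∀ k, 1 ≤ k → ∀ ω, S.x (k + 1) ω = Pb.R (S.x k ω) (S.step Pb prm k ω)
  beta_succ : ∀ k, 1 ≤ k → ∀ ω, S.β (k + 1) ω = S.betaSucc Pb prm k ω
  lam_succ : ∀ k, 1 ≤ k → ∀ ω,
    S.lam (k + 1) ω = S.lam k ω - S.β (k + 1) ω • (Pb.A (S.x (k + 1) ω) - S.y (k + 1) ω)
  v_succ : ∀ k, 1 ≤ k → ∀ ω,
    S.v (k + 1) ω = S.batchGrad Pb (k + 1) ω (S.x (k + 1) ω) + (1 - prm.αSucc k) •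
      Pb.T (S.x k ω) (S.step Pb prm k ω)
        (S.v k ω - S.batchGrad Pb (k + 1) ω (S.x k ω))

/-- Number of oracle calls in the initialization and the first `K` iterations: `|S_1|` stochastic
gradients, then per iteration one proximal map, one retraction, and stochastic gradients at
`x_{k+1}` and at `x_k` for every sample of `S_{k+1}`. -/
def oracleCalls (K : ℕ) : ℕ := S.b 1 + ∑ k ∈ Finset.Icc 1 K, (1 + 1 + 2 * S.b (k + 1))

end Trajectory

/-! ### Stationarity -/

/-- `E[Z] ≤ r` for a real random variable `Z`, integrability included. -/
def ExpLe {Ω : Type*} [MeasurableSpace Ω] (μ : Measure Ω) (Z : Ω → ℝ) (r : ℝ) : Prop :=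
  Integrable Z μ ∧ ∫ ω, Z ω ∂μ ≤ r

section Residuals

variable {n m : ℕ} {Ξ : Type*} [MeasurableSpace Ξ] (Pb : Problem n m Ξ)

/-- `‖P_{T_x M}(-Aᵀ λ) + grad F(x)‖`. -/
def statRes (x : E n) (lam : E m) : ℝ := ‖proj Pb.M x (-(Pb.At lam)) + Pb.gradF x‖

/-- `dist(-λ, ∂g(y))`. -/
def dualRes (y lam : E m) : ℝ := Metric.infDist (-lam) (subdiff Pb.g y)

/-- `‖A x - y‖`. -/
def feasRes (x : E n) (y : E m) : ℝ := ‖Pb.A x - y‖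

/-- The random point `X` is `ε`-stationary with certificates `Y`, `Λ`. -/
def IsEpsStationary {Ω : Type*} [MeasurableSpace Ω] (μ : Measure Ω) (ε : ℝ)
    (X : Ω → E n) (Y Λ : Ω → E m) : Prop :=
  (∀ ω, X ω ∈ Pb.M) ∧ ExpLe μ (fun ω => statRes Pb (X ω) (Λ ω)) ε ∧
    ExpLe μ (fun ω => dualRes Pb (Y ω) (Λ ω)) ε ∧ ExpLe μ (fun ω => feasRes Pb (X ω) (Y ω)) ε

end Residuals

/-! ### Constants -/

/-- `p`, `q` are Lipschitz-type constants of the retraction, `Lp` is a Lipschitz constant of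
`x ↦ P_{T_x M}`, and `ζ` bounds the deviation of the transport from the identity. -/
structure IsGeomConst {n : ℕ} (M : Set (E n)) (R : E n → E n → E n) (T : E n → E n → E n → E n)
    (p q Lp ζ : ℝ) : Prop where
  p_pos : 0 < p
  q_pos : 0 < q
  Lp_nonneg : 0 ≤ Lp
  ζ_nonneg : 0 ≤ ζ
  retr_fst : ∀ x ∈ M, ∀ u ∈ tangentSpace M x, ‖R x u - x‖ ≤ p * ‖u‖
  retr_snd : ∀ x ∈ M, ∀ u ∈ tangentSpace M x, ‖R x u - x - u‖ ≤ q * ‖u‖ ^ 2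
  proj_lip : ∀ x ∈ M, ∀ z ∈ M, ∀ w : E n, ‖proj M x w - proj M z w‖ ≤ Lp * ‖w‖ * ‖x - z‖
  transport_dev : ∀ x ∈ M, ∀ ω ∈ tangentSpace M x, ∀ u ∈ tangentSpace M x,
    ‖T x ω u - u‖ ≤ ζ * ‖ω‖ * ‖u‖

section Constants

variable {n m : ℕ} {Ξ : Type*} [MeasurableSpace Ξ] (Pb : Problem n m Ξ) (prm : Params n m)

/-- `λ_max = ‖λ_1‖ + (π²/6) β_1 ‖A x_1 - y_1‖`. -/
def lamMax : ℝ := ‖prm.lam₁‖ + Real.pi ^ 2 / 6 * prm.β₁ * ‖Pb.A prm.x₁ - prm.y₁‖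

/-- `B = max_{x ∈ M} ‖∇F(x)‖`. -/
def gradBound : ℝ := sSup ((fun x => ‖gradient Pb.F x‖) '' Pb.M)

/-- `Θ`. -/
def Theta (Lg : ℝ) : ℝ :=
  gradBound Pb + ‖Pb.A‖ ^ 2 * Metric.diam Pb.M
    + ‖Pb.A‖ * (Lg + lamMax Pb prm + 2 * ‖Pb.A‖ * Metric.diam Pb.M) + ‖Pb.A‖ * lamMax Pb prm

/-- The retraction-smoothness constant `(L_F + ‖A‖²) p² + 2 q Θ`. -/
def smoothConst (LF Lg p q : ℝ) : ℝ := (LF + ‖Pb.A‖ ^ 2) * p ^ 2 + 2 * q * Theta Pb prm Lg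

/-- The constant `N = (p L_p + ζ) G + p (L_F + ‖A‖²)`; here `G = B + ‖A‖ L_g` bounds
`‖∇_x L_{ρ_k}(x_k, y_{k+1}, λ_k)‖` along the iterates. -/
def lipConst (LF Lg p Lp ζ : ℝ) : ℝ :=
  (p * Lp + ζ) * (gradBound Pb + ‖Pb.A‖ * Lg) + p * (LF + ‖Pb.A‖ ^ 2)

/-- `ψ* = F* + g* - λ_max (L_g + λ_max + ‖A‖ D)`, with `F* = inf_M F`, `g* = inf g` and `D` the
diameter of `M`. -/
def psiStar (Lg : ℝ) : ℝ :=
  sInf (Pb.F '' Pb.M) + sInf (Set.range Pb.g)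
    - lamMax Pb prm * (Lg + lamMax Pb prm + ‖Pb.A‖ * Metric.diam Pb.M)

/-- The merit function `ψ_k = E[L_{ρ_k}(x_k, y_k, λ_k) + γ_k ‖ε_k‖²]`, `γ_k = c_γ (k-1)^{1/3}`. -/
def merit {Ω : Type*} [MeasurableSpace Ω] (μ : Measure Ω) (S : Trajectory n m Ω Ξ) (cγ : ℝ)
    (k : ℕ) : ℝ :=
  ∫ ω, (Pb.augLag (prm.ρ k) (S.x k ω) (S.y k ω) (S.lam k ω)
    + cγ * ((k : ℝ) - 1) ^ (1 / 3 : ℝ) * ‖S.err Pb k ω‖ ^ 2) ∂μ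

/-- `C_1 = ∑_{k ≥ 1} k^{-4/3}`. -/
def constC₁ : ℝ := ∑' k : ℕ, ((k : ℝ) + 1) ^ (-(4 / 3) : ℝ)

/-- `C_2 = ∑_{k ≥ 1} k^{-1} / ln²(k + 2)`. -/
def constC₂ : ℝ := ∑' k : ℕ, ((k : ℝ) + 1)⁻¹ / Real.log ((k : ℝ) + 3) ^ 2

/-- `C = ψ_1 - ψ* + 2 c_γ c_α² σ² (1 + ln K) + (C_1/(3 c_ρ) + 2 c_β C_2 / c_ρ²)(L_g + λ_max)²`,
with `ψ_1` given as the argument `ψ₁`. -/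
def constC (Lg σ cγ ψ₁ : ℝ) (K : ℕ) : ℝ :=
  ψ₁ - psiStar Pb prm Lg + 2 * cγ * prm.cα ^ 2 * σ ^ 2 * (1 + Real.log K)
    + (constC₁ / (3 * prm.cρ) + 2 * prm.cβ * constC₂ / prm.cρ ^ 2) * (Lg + lamMax Pb prm) ^ 2

/-- `Q = 8 C / min(4 c_α c_γ, c_η)`. -/
def constQ (Lg σ cγ ψ₁ : ℝ) (K : ℕ) : ℝ :=
  8 * constC Pb prm Lg σ cγ ψ₁ K / min (4 * prm.cα * cγ) prm.cη

/-- The requirements on the input that do not involve the geometric constants; `cν` and `cγ` are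
auxiliary. -/
structure Params.Admissible (cν cγ : ℝ) : Prop where
  x₁_mem : prm.x₁ ∈ Pb.M
  β₁_pos : 0 < prm.β₁
  cη_pos : 0 < prm.cη
  cρ_ge : 2 * √2 ≤ prm.cρ
  cα_ge : 0.8 ≤ prm.cα
  cα_le : prm.cα ≤ 1
  cβ_pos : 0 < prm.cβ
  cβ_le : prm.cβ ≤ prm.cρ / 3
  cν_pos : 0 < cν
  cν_le : cν ≤ prm.cρ
  cγ_pos : 0 < cγ
  cγ_le : cγ ≤ prm.cρ
  cν_mul : 8 ≤ cν * cγ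

/-- `c_η ≤ min{1/(8 p² ‖A‖²), 1/(1+M), 1/N, 1/(8 L̃²)} / c_ρ`, written without division so that
`1/0` counts as `+∞`. -/
structure Params.StepBound (LF Lg Lt p q Lp ζ : ℝ) : Prop where
  le_A : prm.cη * (8 * p ^ 2 * ‖Pb.A‖ ^ 2 * prm.cρ) ≤ 1
  le_M : prm.cη * ((1 + smoothConst Pb prm LF Lg p q) * prm.cρ) ≤ 1
  le_N : prm.cη * (lipConst Pb LF Lg p Lp ζ * prm.cρ) ≤ 1
  le_L : prm.cη * (8 * Lt ^ 2 * prm.cρ) ≤ 1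

end Constants

end MarsAdmm

end

/-! Two quantities drive everything: the direction `G_k` and the estimation error `ε_k`. The proof
shows that their second moments are small for some index in the second half of the run, and that all
three residuals at step `k + 1` are controlled pathwise by `‖G_k‖`, `‖ε_k‖` and `1 / ρ_k`.

Pathwise part. Optimality of the `y`-step says that `ρ_k (A x_k - y_{k+1}) - λ_k` is a subgradient
of `g` at `y_{k+1}`, hence bounded by `L_g`, however large `ρ_k` is. The dual stepsizes make the
increments of `λ_k` summable, so `λ_k` stays below `λ_max` and `‖A x_k - y_{k+1}‖ = O(1 / ρ_k)`. The
Euclidean gradient of the augmented Lagrangian along the run is therefore bounded uniformly in `k`,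
and its tangential part is exactly `G_k - ε_k`. Since `ρ_k η_k = c_ρ c_η` is a small constant, the
retraction step decreases the augmented Lagrangian by a multiple of `η_k ‖G_k‖²`, up to `η_k
‖ε_k‖²`. Changing `λ` and `ρ` costs a small part of that decrease and a summable term
(`augLag_succ_le`).

Stochastic part. By the recursive momentum, `ε_{k+1}` is a transported multiple of `ε_k` plus
centred noise independent of the past. The transport is an isometry, so cross terms vanish and
`E‖ε_{k+1}‖² ≤ (1 - α)² E‖ε_k‖² + 2 α² σ² + 2 (1 - α)² L̃² η_k² E‖G_k‖²`, with `α = α_{k+1}`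
(`integral_err_succ_le`). Weighting the error by `γ_k` makes the contraction pay for the `ε`-term of
the descent, while part of the `G`-term pays for the drift of the estimator (`merit_arith`).

Telescoping the merit function, which is at least `ψ*` from index 2 on, bounds `∑ k^{-1/3} (c_η
E‖G_k‖² + c_α c_γ E‖ε_k‖²)` by a constant times `1 + ln K`; the logarithm comes from `∑ γ_{k+1}
α_{k+1}² ∼ ∑ 1/k`. At least `(K + 1)/2` admissible indices remain in the second half, and the best
of them has second moments of order `K^{-2/3}` times the logarithm (`exists_index`). Jensen's
inequality turns this into `exists_residual_bounds`, and solving for `K` gives `complexity`.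

Two further ingredients are needed: the geometric constants exist, by local Taylor bounds made
uniform over the compact manifold (`exists_isGeomConst`), and all iterates are measurable functions
of the past samples (`measurable_iterates`). -/

namespace MarsAdmm

open Set Metric Filter Topology

/-! ### Taylor estimates along segments, for maps that are smooth only within a set -/

section Taylor

variable {V W : Type*} [NormedAddCommGroup V] [NormedSpace ℝ V] [NormedAddCommGroup W]
  [NormedSpace ℝ W]

/-- Points of a segment between two points of a ball lie in the ball. -/
theorem add_smul_mem_ball {c z w : V} {r t : ℝ} (hz : z ∈ ball c r) (hw : z + w ∈ ball c r)
    (ht : t ∈ Icc (0 : ℝ) 1) : z + t • w ∈ ball c r := by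
  have h := (convex_ball c r) hz hw (sub_nonneg.2 ht.2) ht.1 (by ring)
  convert h using 1
  module

theorem hasDerivWithinAt_comp_segment {f : V → W} {f' : V → V →L[ℝ] W} {s : Set V} {z w : V}
    (hseg : ∀ t ∈ Icc (0 : ℝ) 1, z + t • w ∈ s) {t : ℝ}
    (hf : HasFDerivWithinAt f (f' (z + t • w)) s (z + t • w)) :
    HasDerivWithinAt (fun t : ℝ => f (z + t • w)) (f' (z + t • w) w) (Icc 0 1) t := by
  have hl : HasDerivWithinAt (fun t : ℝ => z + t • w) w (Icc 0 1) t := by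
    simpa using ((hasDerivAt_id t).smul_const w).const_add z |>.hasDerivWithinAt
  exact hf.comp_hasDerivWithinAt t hl hseg

/-- A map that is `C¹` within a set is, near a point of it, Lipschitz along segments in the set. -/
theorem exists_norm_sub_le_of_segment {f : V → W} {s : Set V} {c : V}
    (hf : ContDiffWithinAt ℝ 1 f s c) (hc : c ∈ s) :
    ∃ r > 0, ∃ C ≥ 0, ∀ z w, z ∈ ball c r → z + w ∈ ball c r →
      (∀ t ∈ Icc (0 : ℝ) 1, z + t • w ∈ s) → ‖f (z + w) - f z‖ ≤ C * ‖w‖ := by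
  -- Derivatives within `s` need not be unique, so `fderivWithin` is avoided: being `C¹` supplies
  -- one choice `f'` near `c` that is continuous at `c` within `s`.
  have h1 : ContDiffWithinAt ℝ (0 + 1) f s c := by simpa using hf
  obtain ⟨u, hu, -, -, f', hf', hcf'⟩ :=
    (contDiffWithinAt_succ_iff_hasFDerivWithinAt' (by simp)).1 h1
  rw [insert_eq_of_mem hc] at hu
  have hb : ∀ᶠ z in 𝓝[s] c, ‖f' z‖ < ‖f' c‖ + 1 :=
    hcf'.continuousWithinAt.norm.eventually_lt continuousWithinAt_const (by simp)
  obtain ⟨r, hr, hball⟩ := Metric.mem_nhdsWithin_iff.1 (inter_mem hu hb)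
  refine ⟨r, hr, ‖f' c‖ + 1, by positivity, fun z w hz hzw hseg => ?_⟩
  have key := norm_image_sub_le_of_norm_deriv_le_segment_01' (C := (‖f' c‖ + 1) * ‖w‖)
    (f := fun t : ℝ => f (z + t • w)) (f' := fun t => f' (z + t • w) w)
    (fun t ht => hasDerivWithinAt_comp_segment hseg
      (hf' _ (hball ⟨add_smul_mem_ball hz hzw ht, hseg t ht⟩).1))
    (fun t ht => by
      have ht' := Ico_subset_Icc_self ht
      refine (ContinuousLinearMap.le_opNorm _ _).trans ?_
      gcongr
      exact (hball ⟨add_smul_mem_ball hz hzw ht', hseg t ht'⟩).2.le)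
  simpa using key

/-- A map that is `C²` within a set has, near a point of it, a first order Taylor expansion along
segments in the set, with uniform quadratic remainder. -/
theorem exists_norm_sub_sub_le_of_segment {f : V → W} {s : Set V} {c : V}
    (hf : ContDiffWithinAt ℝ 2 f s c) (hc : c ∈ s) :
    ∃ f' : V → V →L[ℝ] W, ∃ r > 0, ∃ C ≥ 0, (∀ z ∈ s ∩ ball c r, HasFDerivWithinAt f (f' z) s z) ∧
      ∀ z w, z ∈ ball c r → z + w ∈ ball c r →
      (∀ t ∈ Icc (0 : ℝ) 1, z + t • w ∈ s) → ‖f (z + w) - f z - f' z w‖ ≤ C * ‖w‖ ^ 2 := by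
  have h1 : ContDiffWithinAt ℝ (1 + 1) f s c := by
    rw [one_add_one_eq_two]; exact hf
  obtain ⟨u, hu, -, -, f', hf', hcf'⟩ :=
    (contDiffWithinAt_succ_iff_hasFDerivWithinAt' (by simp)).1 h1
  rw [insert_eq_of_mem hc] at hu
  obtain ⟨r₁, hr₁, C, hC, hlip⟩ := exists_norm_sub_le_of_segment hcf' hc
  obtain ⟨r₂, hr₂, hball⟩ := Metric.mem_nhdsWithin_iff.1 hu
  have hb1 : ball c (min r₁ r₂) ⊆ ball c r₁ := ball_subset_ball (min_le_left _ _)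
  have hb2 : ball c (min r₁ r₂) ⊆ ball c r₂ := ball_subset_ball (min_le_right _ _)
  refine ⟨f', min r₁ r₂, lt_min hr₁ hr₂, C, hC, fun z hz => hf' z (hball ⟨hb2 hz.2, hz.1⟩),
    fun z w hz hzw hseg => ?_⟩
  -- Subtracting the linear term leaves a curve with derivative `(f'(z + t w) - f'(z)) w`. The
  -- preceding lemma, applied to the `C¹` map `f'`, bounds it by `C ‖w‖²`.
  have key := norm_image_sub_le_of_norm_deriv_le_segment_01' (C := C * ‖w‖ ^ 2)
    (f := fun t : ℝ => f (z + t • w) - t • f' z w) (f' := fun t => f' (z + t • w) w - f' z w)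
    (fun t ht => by
      have hd := (hasDerivWithinAt_comp_segment hseg
        (hf' _ (hball ⟨add_smul_mem_ball (hb2 hz) (hb2 hzw) ht, hseg t ht⟩)))
      have hl : HasDerivWithinAt (fun t : ℝ => t • f' z w) (f' z w) (Icc 0 1) t := by
        simpa using ((hasDerivAt_id t).smul_const (f' z w)).hasDerivWithinAt
      exact hd.sub hl)
    (fun t ht => by
      have ht' := Ico_subset_Icc_self ht
      have hb := hlip z (t • w) (hb1 hz) (add_smul_mem_ball (hb1 hz) (hb1 hzw) ht') fun a ha => by
        rw [smul_smul]
        exact hseg _ ⟨mul_nonneg ha.1 ht'.1, mul_le_one₀ ha.2 ht'.1 ht'.2⟩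
      rw [← sub_apply]
      refine (ContinuousLinearMap.le_opNorm _ _).trans ?_
      have : ‖t • w‖ ≤ ‖w‖ := by
        rw [norm_smul, Real.norm_of_nonneg ht'.1]
        exact mul_le_of_le_one_left (norm_nonneg _) ht'.2
      calc ‖f' (z + t • w) - f' z‖ * ‖w‖ ≤ (C * ‖w‖) * ‖w‖ := by
            gcongr
            exact hb.trans (by gcongr)
        _ = C * ‖w‖ ^ 2 := by ring)
  simpa [sub_right_comm] using key

end Taylor

/-- A bound that holds near every point of a compact set, with constants depending on the point,
holds with uniform constants. -/
theorem exists_uniform_const {X : Type*} [PseudoMetricSpace X] {K : Set X} (hK : IsCompact K)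
    {Q : X → ℝ → ℝ → Prop}
    (hQ : ∀ x r r' C C', Q x r C → r' ≤ r → C ≤ C' → Q x r' C')
    (hloc : ∀ c ∈ K, ∃ r > 0, ∃ C, ∀ x ∈ K, x ∈ ball c r → Q x r C) :
    ∃ r > 0, ∃ C ≥ 0, ∀ x ∈ K, Q x r C := by
  refine hK.induction_on (p := fun s => ∃ r > 0, ∃ C ≥ 0, ∀ x ∈ K, x ∈ s → Q x r C)
    ⟨1, one_pos, 0, le_rfl, by simp⟩
    (fun s t hst ⟨r, hr, C, hC, h⟩ => ⟨r, hr, C, hC, fun x hx hxs => h x hx (hst hxs)⟩)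
    (fun s t ⟨r, hr, C, hC, h⟩ ⟨r', hr', C', hC', h'⟩ =>
      ⟨min r r', lt_min hr hr', max C C', le_max_of_le_left hC, fun x hx hxs => ?_⟩)
    (fun c hc => ?_) |>.imp fun r hr => ⟨hr.1, hr.2.imp fun C hC => ⟨hC.1, fun x hx =>
      hC.2 x hx hx⟩⟩
  · rcases hxs with hxs | hxs
    · exact hQ _ _ _ _ _ (h x hx hxs) (min_le_left _ _) (le_max_left _ _)
    · exact hQ _ _ _ _ _ (h' x hx hxs) (min_le_right _ _) (le_max_right _ _)
  · obtain ⟨r, hr, C, h⟩ := hloc c hc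
    refine ⟨ball c r, mem_nhdsWithin_of_mem_nhds (ball_mem_nhds c hr), r, hr, max C 0,
      le_max_right _ _, fun x hx hxs => hQ _ _ _ _ _ (h x hx hxs) le_rfl (le_max_left _ _)⟩

/-! ### Tangent spaces as kernels, and their orthogonal projections -/

variable {n : ℕ} {M : Set (E n)}

theorem proj_mem (x w : E n) : proj M x w ∈ tangentSpace M x := by
  simp [proj]

theorem proj_eq_self {x w : E n} (hw : w ∈ tangentSpace M x) : proj M x w = w := by
  simpa [proj] using Submodule.starProjection_eq_self_iff.2 hw

theorem inner_proj_left {x w u : E n} (hu : u ∈ tangentSpace M x) :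
    inner ℝ (proj M x w) u = inner ℝ w u := by
  have h := Submodule.inner_starProjection_left_eq_right (𝕜 := ℝ) (tangentSpace M x) w u
  rw [show proj M x w = (tangentSpace M x).starProjection w from rfl, h,
    Submodule.starProjection_eq_self_iff.2 hu]

theorem norm_proj_le (x w : E n) : ‖proj M x w‖ ≤ ‖w‖ :=
  Submodule.norm_starProjection_apply_le (tangentSpace M x) w

/-- The tangent space of the zero set of a submersion is the kernel of its derivative. -/
theorem tangentSpace_eq_ker {c : ℕ} {U : Set (E n)} {h : E n → E c} (hU : IsOpen U)
    (hh : ContDiffOn ℝ (⊤ : ℕ∞) h U) (hsurj : ∀ z ∈ U, Function.Surjective (fderiv ℝ h z))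
    (hMU : M ∩ U = {z ∈ U | h z = 0}) {x : E n} (hxM : x ∈ M) (hxU : x ∈ U) :
    tangentSpace M x = LinearMap.ker (fderiv ℝ h x).toLinearMap := by
  have hUx : U ∈ 𝓝 x := hU.mem_nhds hxU
  have hcd : ContDiffAt ℝ (⊤ : ℕ∞) h x := hh.contDiffAt hUx
  have hd : HasFDerivAt h (fderiv ℝ h x) x := (hcd.differentiableAt (by simp)).hasFDerivAt
  have hx0 : h x = 0 := (hMU.subset ⟨hxM, hxU⟩).2
  apply le_antisymm
  · refine Submodule.span_le.2 ?_
    rintro u ⟨γ, δ, hδ, hγ0, hγM, -, hγ⟩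
    have hcomp : HasDerivAt (fun t => h (γ t)) (fderiv ℝ h x u) 0 := by
      have hd' : HasFDerivAt h (fderiv ℝ h x) (γ 0) := by rw [hγ0]; exact hd
      exact hd'.comp_hasDerivAt 0 hγ
    have hev : (fun t => h (γ t)) =ᶠ[𝓝 0] fun _ => 0 := by
      have h1 : ∀ᶠ t in 𝓝 (0 : ℝ), t ∈ Icc (-δ) δ := Icc_mem_nhds (by linarith) hδ
      have h2 : ∀ᶠ t in 𝓝 (0 : ℝ), γ t ∈ U :=
        hγ.continuousAt.eventually_mem (by rw [hγ0]; exact hUx)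
      filter_upwards [h1, h2] with t ht1 ht2
      exact (hMU.subset ⟨hγM t ht1, ht2⟩).2
    have := hcomp.unique ((hasDerivAt_const (0 : ℝ) (0 : E c)).congr_of_eventuallyEq hev)
    simpa using this
  · intro u hu
    refine Submodule.subset_span ?_
    obtain ⟨B, hB⟩ := (fderiv ℝ h x).exists_rightInverse_of_surjective
      (LinearMap.range_eq_top.2 (hsurj x hxU))
    have hBa : ∀ w, fderiv ℝ h x (B w) = w := fun w => by
      simpa using DFunLike.congr_fun hB w
    -- `Φ` straightens `M`: it satisfies `Dh(x) ∘ Φ = h` and has derivative the identity at `x`. Its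
    -- local inverse therefore sends the line `t • u`, with `u` in the kernel of `Dh(x)`, to a curve
    -- in `M` with velocity `u`.
    let Φ : E n → E n := fun z => B (h z) + ((z - x) - B (fderiv ℝ h x (z - x)))
    have hΦc : ContDiffAt ℝ (⊤ : ℕ∞) Φ x := by
      have h1 : ContDiffAt ℝ (⊤ : ℕ∞) (fun z => B (h z)) x := B.contDiff.contDiffAt.comp x hcd
      exact h1.add (by fun_prop)
    have hΦd : HasFDerivAt Φ ((ContinuousLinearEquiv.refl ℝ (E n) : E n →L[ℝ] E n)) x := by
      have h1 : HasFDerivAt (fun z => B (h z)) (B.comp (fderiv ℝ h x)) x :=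
        B.hasFDerivAt.comp x hd
      have h2 : HasFDerivAt (fun z : E n => z - x) (ContinuousLinearMap.id ℝ (E n)) x :=
        (hasFDerivAt_id x).sub_const x
      have h3 : HasFDerivAt (fun z => B (fderiv ℝ h x (z - x))) ((B.comp (fderiv ℝ h x)).comp
          (ContinuousLinearMap.id ℝ (E n))) x :=
        (B.comp (fderiv ℝ h x)).hasFDerivAt.comp x h2
      have h4 := h1.add (h2.sub h3)
      rw [show B.comp (fderiv ℝ h x) + (ContinuousLinearMap.id ℝ (E n) -
        (B.comp (fderiv ℝ h x)).comp (ContinuousLinearMap.id ℝ (E n))) =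
        ((ContinuousLinearEquiv.refl ℝ (E n) : E n →L[ℝ] E n)) by ext w; simp] at h4
      exact h4
    have hΦx : Φ x = 0 := by simp [Φ, hx0]
    have hhΦ : ∀ z, fderiv ℝ h x (Φ z) = h z := fun z => by simp [Φ, hBa]
    have hne : ((⊤ : ℕ∞) : WithTop ℕ∞) ≠ 0 := by simp
    let Ψ := hΦc.toOpenPartialHomeomorph Φ hΦd hne
    have hxs : x ∈ Ψ.source := hΦc.mem_toOpenPartialHomeomorph_source hΦd hne
    have hinv : ContDiffAt ℝ (⊤ : ℕ∞) Ψ.symm 0 := by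
      have := hΦc.to_localInverse hΦd hne
      rwa [hΦx] at this
    have hcoe : ∀ z, Ψ z = Φ z := fun z => rfl
    have h0t : (0 : E n) ∈ Ψ.target := by
      rw [← hΦx, ← hcoe]; exact Ψ.map_source hxs
    have hsymm0 : Ψ.symm 0 = x := by
      rw [← hΦx, ← hcoe]; exact Ψ.left_inv hxs
    let γ : ℝ → E n := fun t => Ψ.symm (t • u)
    have hline : Tendsto (fun t : ℝ => t • u) (𝓝 0) (𝓝 (0 : E n)) := by
      have : Continuous fun t : ℝ => t • u := by fun_prop
      simpa using this.tendsto 0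
    have hev1 : ∀ᶠ t : ℝ in 𝓝 0, DifferentiableAt ℝ Ψ.symm (t • u) := by
      have hev : ∀ᶠ z in 𝓝 (0 : E n), ContDiffAt ℝ 1 Ψ.symm z :=
        (hinv.of_le (by exact_mod_cast le_top)).eventually (by simp)
      exact hline.eventually (hev.mono fun z hz => hz.differentiableAt (by simp))
    have hev2 : ∀ᶠ t : ℝ in 𝓝 0, t • u ∈ Ψ.target :=
      hline.eventually (Ψ.open_target.mem_nhds h0t)
    have hev3 : ∀ᶠ t : ℝ in 𝓝 0, Ψ.symm (t • u) ∈ U := by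
      have : Tendsto Ψ.symm (𝓝 0) (𝓝 x) := by
        have := hinv.continuousAt.tendsto
        rwa [hsymm0] at this
      exact (this.comp hline).eventually_mem hUx
    obtain ⟨δ, hδ, hall⟩ := Metric.eventually_nhds_iff.1 (hev1.and (hev2.and hev3))
    have hin : ∀ t ∈ Icc (-(δ / 2)) (δ / 2), dist t 0 < δ := fun t ht => by
      rw [Real.dist_eq, sub_zero]
      exact (abs_le.2 ht).trans_lt (by linarith)
    refine ⟨γ, δ / 2, by positivity, by simp [γ, hsymm0], fun t ht => ?_, fun t ht => ?_, ?_⟩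
    · obtain ⟨-, h2, h3⟩ := hall (hin t ht)
      refine (hMU.symm.subset ⟨h3, ?_⟩).1
      rw [← hhΦ, ← hcoe, Ψ.right_inv h2, map_smul]
      simp [show fderiv ℝ h x u = 0 from hu]
    · have hl : DifferentiableAt ℝ (fun t : ℝ => t • u) t := by fun_prop
      exact ((hall (hin t ht)).1.comp t hl).differentiableWithinAt
    · have hd0 : HasFDerivAt Ψ.symm (ContinuousLinearMap.id ℝ (E n)) 0 := by
        have hs := Ψ.hasFDerivAt_symm (f' := ContinuousLinearEquiv.refl ℝ (E n)) h0t
          (by rw [hsymm0]; exact hΦd)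
        simpa using hs
      have hl : HasDerivAt (fun t : ℝ => t • u) u 0 := by
        simpa using (hasDerivAt_id (0 : ℝ)).smul_const u
      have hd0' : HasFDerivAt Ψ.symm (ContinuousLinearMap.id ℝ (E n)) ((0 : ℝ) • u) := by
        simpa using hd0
      exact hd0'.comp_hasDerivAt (0 : ℝ) hl

/-- The orthogonal projection onto the kernel of a surjective map. -/
theorem starProjection_ker_eq {c : ℕ} (D : E n →L[ℝ] E c) (hD : Function.Surjective D) :
    IsUnit (D ∘L ContinuousLinearMap.adjoint D) ∧
    (LinearMap.ker D.toLinearMap).starProjection = ContinuousLinearMap.id ℝ (E n) -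
      ContinuousLinearMap.adjoint D ∘L Ring.inverse (D ∘L ContinuousLinearMap.adjoint D) ∘L D := by
  have hinj : Function.Injective (D ∘L ContinuousLinearMap.adjoint D) := by
    rw [injective_iff_map_eq_zero]
    intro w hw
    have h1 : ContinuousLinearMap.adjoint D w = 0 := by
      have : inner ℝ (ContinuousLinearMap.adjoint D w) (ContinuousLinearMap.adjoint D w) = 0 := by
        rw [ContinuousLinearMap.adjoint_inner_left]
        have : D (ContinuousLinearMap.adjoint D w) = 0 := hw
        simp [this]
      exact inner_self_eq_zero.1 this
    obtain ⟨z, rfl⟩ := hD w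
    have : inner ℝ (D z) (D z) = 0 := by
      rw [← ContinuousLinearMap.adjoint_inner_left, h1, inner_zero_left]
    exact inner_self_eq_zero.1 this
  have hunit : IsUnit (D ∘L ContinuousLinearMap.adjoint D) := by
    let e := (LinearEquiv.ofInjectiveEndo (D ∘L ContinuousLinearMap.adjoint D).toLinearMap
      hinj).toContinuousLinearEquiv
    refine ⟨ContinuousLinearEquiv.unitsEquiv ℝ (E c) |>.symm e, ?_⟩
    ext w
    rfl
  refine ⟨hunit, ?_⟩
  have hmul : ∀ w, D (ContinuousLinearMap.adjoint D
      (Ring.inverse (D ∘L ContinuousLinearMap.adjoint D) w)) = w := fun w =>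
    DFunLike.congr_fun (Ring.mul_inverse_cancel _ hunit) w
  ext1 w
  refine Submodule.eq_starProjection_of_mem_of_inner_eq_zero ?_ fun z hz => ?_
  · simp [hmul]
  · have hz0 : D z = 0 := hz
    simp [ContinuousLinearMap.adjoint_inner_left, hz0]

/-- The orthogonal projection onto the tangent space depends Lipschitz continuously on the
base point, locally. -/
theorem exists_lipschitzOn_proj (hM : IsEmbeddedSubmanifold M) {x : E n} (hx : x ∈ M) :
    ∃ r > 0, ∃ C : ℝ, ∀ y ∈ M, y ∈ ball x r → ∀ z ∈ M, z ∈ ball x r →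
      ‖proj M y - proj M z‖ ≤ C * ‖y - z‖ := by
  obtain ⟨c, hM⟩ := hM
  obtain ⟨U, hU, hxU, h, hh, hsurj, hMU⟩ := hM x hx
  -- Near `x` the projection is `1 - D* (D D*)⁻¹ D` with `D = Dh(z)`. This is `C¹` in `z` because
  -- inversion is smooth at units, and `C¹` maps are locally Lipschitz.
  have hD : ContDiffAt ℝ 1 (fderiv ℝ h) x :=
    (hh.contDiffAt (hU.mem_nhds hxU)).fderiv_right (m := 1) (by norm_cast)
  have hDt : ContDiffAt ℝ 1 (fun z => ContinuousLinearMap.adjoint (fderiv ℝ h z)) x := by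
    let J : (E n →L[ℝ] E c) →L[ℝ] (E c →L[ℝ] E n) :=
      ((ContinuousLinearMap.adjoint : (E n →L[ℝ] E c) ≃ₗᵢ⋆[ℝ] (E c →L[ℝ] E n)).toLinearIsometry
        |>.toContinuousLinearMap)
    exact J.contDiff.contDiffAt.comp x hD
  have hDD : ContDiffAt ℝ 1
      (fun z => fderiv ℝ h z ∘L ContinuousLinearMap.adjoint (fderiv ℝ h z)) x := hD.clm_comp hDt
  have hinv : ContDiffAt ℝ 1 (fun z => Ring.inverse
      (fderiv ℝ h z ∘L ContinuousLinearMap.adjoint (fderiv ℝ h z))) x := by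
    obtain ⟨u, hu⟩ := (starProjection_ker_eq _ (hsurj x hxU)).1
    have := contDiffAt_ringInverse (n := 1) ℝ u
    rw [hu] at this
    exact this.comp x hDD
  obtain ⟨K, t, ht, hK⟩ := (ContDiffAt.sub (contDiffAt_const (c := ContinuousLinearMap.id ℝ (E n)))
    (hDt.clm_comp (hinv.clm_comp hD))).exists_lipschitzOnWith
  obtain ⟨r, hr, hball⟩ := Metric.mem_nhds_iff.1 (inter_mem ht (hU.mem_nhds hxU))
  have heq : ∀ y ∈ M, y ∈ ball x r → proj M y = ContinuousLinearMap.id ℝ (E n) -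
      ContinuousLinearMap.adjoint (fderiv ℝ h y) ∘L Ring.inverse
        (fderiv ℝ h y ∘L ContinuousLinearMap.adjoint (fderiv ℝ h y)) ∘L fderiv ℝ h y := by
    intro y hy hyr
    have hyU := (hball hyr).2
    rw [← (starProjection_ker_eq _ (hsurj y hyU)).2]
    unfold proj
    congr 1
    exact tangentSpace_eq_ker hU hh hsurj hMU hy hyU
  refine ⟨r, hr, K, fun y hy hyr z hz hzr => ?_⟩
  rw [heq y hy hyr, heq z hz hzr]
  exact hK.norm_sub_le (hball hyr).1 (hball hzr).1

end MarsAdmm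

/-! ### Existence of the geometric constants on a compact manifold -/

namespace MarsAdmm

open Set Metric Filter Topology

variable {n : ℕ} {M : Set (E n)} {R : E n → E n → E n} {T : E n → E n → E n → E n}

/-- Nearby points are covered by the local Lipschitz bound, made uniform by compactness. For points
at distance at least `r`, projections have norm at most 1, so their difference is at most `2 ≤ (2 /
r) ‖x - z‖`. -/
theorem exists_proj_lipschitz (hM : IsEmbeddedSubmanifold M) (hK : IsCompact M) :
    ∃ L ≥ 0, ∀ x ∈ M, ∀ z ∈ M, ‖proj M x - proj M z‖ ≤ L * ‖x - z‖ := by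
  obtain ⟨r, hr, C, hC, h⟩ := exists_uniform_const hK
    (Q := fun x r C => ∀ z ∈ M, z ∈ ball x r → ‖proj M x - proj M z‖ ≤ C * ‖x - z‖)
    (fun x r r' C C' hQ hr hC z hz hzr =>
      (hQ z hz (ball_subset_ball hr hzr)).trans (by gcongr))
    (fun c hc => by
      obtain ⟨r, hr, C, h⟩ := exists_lipschitzOn_proj hM hc
      refine ⟨r / 2, by positivity, C, fun x hx hxr z hz hzr => h x hx ?_ z hz ?_⟩
      · exact ball_subset_ball (by linarith) hxr
      · rw [mem_ball] at *
        linarith [dist_triangle z x c])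
  have hone : ∀ x, ‖proj M x‖ ≤ 1 := fun x =>
    ContinuousLinearMap.opNorm_le_bound _ zero_le_one fun w => by
      simpa using norm_proj_le x w
  refine ⟨C + 2 / r, by positivity, fun x hx z hz => ?_⟩
  by_cases hxz : z ∈ ball x r
  · refine (h x hx z hz hxz).trans ?_
    gcongr
    have : 0 ≤ 2 / r := by positivity
    linarith
  · have hd : r ≤ ‖x - z‖ := by
      rw [mem_ball, not_lt, dist_comm, dist_eq_norm] at hxz
      exact hxz
    calc ‖proj M x - proj M z‖ ≤ 1 + 1 := (norm_sub_le _ _).trans (add_le_add (hone x) (hone z))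
      _ = 2 / r * r := by field_simp; norm_num
      _ ≤ 2 / r * ‖x - z‖ := by gcongr
      _ ≤ (C + 2 / r) * ‖x - z‖ := by gcongr; linarith

theorem smul_mem_tangentSum {x ω u : E n} (hx : x ∈ M) (hω : ω ∈ tangentSpace M x)
    (hu : u ∈ tangentSpace M x) (t : ℝ) : ((x, t • ω, u) : E n × E n × E n) ∈ tangentSum M :=
  ⟨hx, Submodule.smul_mem _ _ hω, hu⟩

/-- The derivative of a retraction along the fibre, at the zero section. -/
theorem IsRetraction.fderivWithin_fibre (hR : IsRetraction M R) {x u : E n} (hx : x ∈ M)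
    (hu : u ∈ tangentSpace M x) {L : (E n × E n) →L[ℝ] E n}
    (hL : HasFDerivWithinAt (fun z : E n × E n => R z.1 z.2) L (tangentBundle M) (x, 0)) :
    L (0, u) = u := by
  -- A derivative within the tangent bundle is determined only along directions in which the bundle
  -- contains curves; the ray `t ↦ (x, t u)` suffices to identify it on `(0, u)`.
  have hl : HasDerivAt (fun t : ℝ => ((x, t • u) : E n × E n)) (0, u) 0 := by
    have h1 : HasDerivAt (fun t : ℝ => t • u) u 0 := by
      simpa using (hasDerivAt_id (0 : ℝ)).smul_const u
    exact (hasDerivAt_const (0 : ℝ) x).prodMk h1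
  have hl2 : HasDerivAt (fun t : ℝ => t • u) u 0 := by
    simpa using (hasDerivAt_id (0 : ℝ)).smul_const u
  have h1 : HasDerivAt (fun t : ℝ => R x (t • u)) (L (0, u)) 0 := by
    have hL' : HasFDerivWithinAt (fun z : E n × E n => R z.1 z.2) L (tangentBundle M)
        (x, (0 : ℝ) • u) := by simpa using hL
    have := hL'.comp_hasDerivWithinAt (s := univ) (0 : ℝ) hl.hasDerivWithinAt
      (fun t _ => show ((x, t • u) : E n × E n) ∈ tangentBundle M from
        ⟨hx, Submodule.smul_mem _ _ hu⟩)
    exact this.hasDerivAt univ_mem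
  have h2 : HasDerivAt (fun t : ℝ => R x (t • u)) u 0 := by
    have hL' : HasFDerivWithinAt (R x) (ContinuousLinearMap.id ℝ (E n))
        (tangentSpace M x : Set (E n)) ((0 : ℝ) • u) := by simpa using hR.deriv_zero x hx
    have := hL'.comp_hasDerivWithinAt (s := univ) (0 : ℝ) hl2.hasDerivWithinAt
      (fun t _ => Submodule.smul_mem _ _ hu)
    exact this.hasDerivAt univ_mem
  exact h1.unique h2

/-- For small `u` this is the second order expansion along the fibre at the zero section, whose
linear part is the identity. For `‖u‖ ≥ r` the crude bound `diam M + ‖u‖` is already of order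
`‖u‖²`. -/
theorem IsRetraction.exists_quadratic_bound (hR : IsRetraction M R) (hK : IsCompact M) :
    ∃ q > 0, ∀ x ∈ M, ∀ u ∈ tangentSpace M x, ‖R x u - x - u‖ ≤ q * ‖u‖ ^ 2 := by
  obtain ⟨r, hr, C, hC, h⟩ := exists_uniform_const hK
    (Q := fun x r C => ∀ u ∈ tangentSpace M x, ‖u‖ < r → ‖R x u - x - u‖ ≤ C * ‖u‖ ^ 2)
    (fun x r r' C C' hQ hr hC u hu hur => (hQ u hu (hur.trans_le hr)).trans (by gcongr))
    (fun c hc => by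
      have hmem : ((c, 0) : E n × E n) ∈ tangentBundle M := ⟨hc, Submodule.zero_mem _⟩
      have hsm : ContDiffWithinAt ℝ 2 (fun z : E n × E n => R z.1 z.2) (tangentBundle M) (c, 0) :=
        (hR.smooth _ hmem).of_le (WithTop.coe_le_coe.2 (le_top : (2 : ℕ∞) ≤ ⊤))
      obtain ⟨f', r, hr, C, hC, hf', h⟩ := exists_norm_sub_sub_le_of_segment hsm hmem
      refine ⟨r, hr, C, fun x hx hxr u hu hur => ?_⟩
      have hx0 : ((x, 0) : E n × E n) ∈ ball ((c, 0) : E n × E n) r := by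
        rw [mem_ball, Prod.dist_eq]
        simpa [hr] using hxr
      have key := h (x, 0) (0, u) hx0 (by
        rw [mem_ball, Prod.dist_eq]
        simpa [hur] using hxr) (fun t _ => by
          have hmem : ((x, t • u) : E n × E n) ∈ tangentBundle M :=
            ⟨hx, Submodule.smul_mem _ t hu⟩
          have heq : ((x, 0) : E n × E n) + t • ((0, u) : E n × E n) = (x, t • u) := by simp
          rw [heq]
          exact hmem)
      rw [hR.fderivWithin_fibre hx hu (hf' _ ⟨⟨hx, Submodule.zero_mem _⟩, hx0⟩)] at key
      simpa [hR.map_zero x hx, Prod.norm_def] using key)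
  have hD : 0 ≤ diam M := diam_nonneg
  refine ⟨C + diam M / r ^ 2 + 1 / r, by positivity, fun x hx u hu => ?_⟩
  have h1 : 0 ≤ diam M / r ^ 2 := by positivity
  have h2 : 0 < 1 / r := by positivity
  rcases lt_or_ge ‖u‖ r with hur | hur
  · refine (h x hx u hu hur).trans ?_
    gcongr
    linarith
  · have hd : ‖R x u - x‖ ≤ diam M := by
      rw [← dist_eq_norm]
      exact dist_le_diam_of_mem hK.isBounded (hR.mapsTo x hx u hu) hx
    calc ‖R x u - x - u‖ ≤ diam M + ‖u‖ := (norm_sub_le _ _).trans (by gcongr)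
      _ = diam M / r ^ 2 * r ^ 2 + 1 / r * (r * ‖u‖) := by field_simp
      _ ≤ diam M / r ^ 2 * ‖u‖ ^ 2 + 1 / r * (‖u‖ * ‖u‖) := by gcongr
      _ = (diam M / r ^ 2 + 1 / r) * ‖u‖ ^ 2 := by ring
      _ ≤ (C + diam M / r ^ 2 + 1 / r) * ‖u‖ ^ 2 := by gcongr; linarith

theorem IsIsometricTransport.norm_map (hT : IsIsometricTransport M R T) {x ω u : E n} (hx : x ∈ M)
    (hω : ω ∈ tangentSpace M x) (hu : u ∈ tangentSpace M x) : ‖T x ω u‖ = ‖u‖ := by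
  have h := hT.isometric x hx ω hω u hu u hu
  rw [real_inner_self_eq_norm_sq, real_inner_self_eq_norm_sq] at h
  exact (sq_eq_sq₀ (norm_nonneg _) (norm_nonneg _)).1 h

theorem IsIsometricTransport.map_smul (hT : IsIsometricTransport M R T) {x ω u : E n} (hx : x ∈ M)
    (hω : ω ∈ tangentSpace M x) (hu : u ∈ tangentSpace M x) (a : ℝ) :
    T x ω (a • u) = a • T x ω u := by
  simpa using hT.linear x hx ω hω u hu 0 (Submodule.zero_mem _) a 0

/-- Smoothness compares the transport along `ω` with the transport along `0`, but only for small `ω`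
and `u`. Linearity in `u` removes the restriction on `u`, and isometry handles large `ω`. -/
theorem IsIsometricTransport.exists_dev_bound (hT : IsIsometricTransport M R T)
    (hK : IsCompact M) :
    ∃ ζ ≥ 0, ∀ x ∈ M, ∀ ω ∈ tangentSpace M x, ∀ u ∈ tangentSpace M x,
      ‖T x ω u - u‖ ≤ ζ * ‖ω‖ * ‖u‖ := by
  obtain ⟨r, hr, C, hC, h⟩ := exists_uniform_const hK
    (Q := fun x r C => ∀ ω ∈ tangentSpace M x, ∀ u ∈ tangentSpace M x, ‖ω‖ < r → ‖u‖ < r →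
      ‖T x ω u - u‖ ≤ C * ‖ω‖)
    (fun x r r' C C' hQ hr hC ω hω u hu hωr hur =>
      (hQ ω hω u hu (hωr.trans_le hr) (hur.trans_le hr)).trans (by gcongr))
    (fun c hc => by
      have hmem : ((c, 0, 0) : E n × E n × E n) ∈ tangentSum M :=
        ⟨hc, Submodule.zero_mem _, Submodule.zero_mem _⟩
      have hsm : ContDiffWithinAt ℝ 1 (fun z : E n × E n × E n => T z.1 z.2.1 z.2.2)
          (tangentSum M) (c, 0, 0) := (hT.smooth _ hmem).of_le (by exact_mod_cast le_top)
      obtain ⟨r, hr, C, hC, h⟩ := exists_norm_sub_le_of_segment hsm hmem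
      refine ⟨r, hr, C, fun x hx hxr ω hω u hu hωr hur => ?_⟩
      have key := h (x, 0, u) (0, ω, 0) (by
        rw [mem_ball, Prod.dist_eq, Prod.dist_eq]
        simpa [hr, hur] using hxr) (by
        rw [mem_ball, Prod.dist_eq, Prod.dist_eq]
        simpa [hur, hωr] using hxr) (fun t _ => by
          simpa using smul_mem_tangentSum hx hω hu t)
      simpa [hT.zero_apply x hx u hu, Prod.norm_def] using key)
  refine ⟨2 * C / r + 2 / r, by positivity, fun x hx ω hω u hu => ?_⟩
  have h1 : 0 ≤ 2 * C / r := by positivity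
  have h2 : 0 ≤ 2 / r := by positivity
  rcases lt_or_ge ‖ω‖ r with hωr | hωr
  · rcases eq_or_ne u 0 with rfl | hu0
    · have := hT.norm_map hx hω (Submodule.zero_mem _)
      simp only [norm_zero, norm_eq_zero] at this
      simp [this]
    · have hun : 0 < ‖u‖ := norm_pos_iff.2 hu0
      -- `u` is rescaled to norm `r / 2` to enter the neighbourhood where the local bound holds.
      have key := h x hx ω hω ((r / (2 * ‖u‖)) • u) (Submodule.smul_mem _ _ hu) hωr (by
        rw [norm_smul, Real.norm_of_nonneg (by positivity)]
        have : r / (2 * ‖u‖) * ‖u‖ = r / 2 := by field_simp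
        linarith)
      rw [hT.map_smul hx hω hu, ← smul_sub, norm_smul, Real.norm_of_nonneg (by positivity)] at key
      calc ‖T x ω u - u‖ = 2 * ‖u‖ / r * (r / (2 * ‖u‖) * ‖T x ω u - u‖) := by field_simp
        _ ≤ 2 * ‖u‖ / r * (C * ‖ω‖) := by gcongr
        _ = 2 * C / r * ‖ω‖ * ‖u‖ := by ring
        _ ≤ (2 * C / r + 2 / r) * ‖ω‖ * ‖u‖ := by gcongr; linarith
  · calc ‖T x ω u - u‖ ≤ ‖u‖ + ‖u‖ := by
          simpa [hT.norm_map hx hω hu] using norm_sub_le (T x ω u) u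
      _ = 2 / r * r * ‖u‖ := by field_simp; ring
      _ ≤ 2 / r * ‖ω‖ * ‖u‖ := by gcongr
      _ ≤ (2 * C / r + 2 / r) * ‖ω‖ * ‖u‖ := by gcongr; linarith

theorem exists_isGeomConst (hM : IsEmbeddedSubmanifold M) (hK : IsCompact M)
    (hR : IsRetraction M R) (hT : IsIsometricTransport M R T) :
    ∃ p q Lp ζ : ℝ, IsGeomConst M R T p q Lp ζ := by
  obtain ⟨L, hL, hproj⟩ := exists_proj_lipschitz hM hK
  obtain ⟨q, hq, hquad⟩ := hR.exists_quadratic_bound hK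
  obtain ⟨ζ, hζ, hdev⟩ := hT.exists_dev_bound hK
  have hD : 0 ≤ diam M := diam_nonneg
  -- For `‖u‖ ≤ 1` the quadratic bound gives the factor `1 + q`; for `‖u‖ ≥ 1` the diameter of `M`
  -- suffices.
  refine ⟨1 + q + diam M, q, L, ζ, by positivity, hq, hL, hζ, fun x hx u hu => ?_, hquad,
    fun x hx z hz w => ?_, hdev⟩
  · rcases le_total ‖u‖ 1 with hu1 | hu1
    · calc ‖R x u - x‖ = ‖(R x u - x - u) + u‖ := by congr 1; abel
        _ ≤ q * ‖u‖ ^ 2 + ‖u‖ := (norm_add_le _ _).trans (by gcongr; exact hquad x hx u hu)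
        _ ≤ q * ‖u‖ + ‖u‖ := by
          have : ‖u‖ ^ 2 ≤ ‖u‖ := by nlinarith [norm_nonneg u]
          gcongr
        _ ≤ (1 + q + diam M) * ‖u‖ := by nlinarith [norm_nonneg u, mul_nonneg hD (norm_nonneg u)]
    · calc ‖R x u - x‖ ≤ diam M := by
            rw [← dist_eq_norm]
            exact dist_le_diam_of_mem hK.isBounded (hR.mapsTo x hx u hu) hx
        _ ≤ diam M * ‖u‖ := le_mul_of_one_le_right hD hu1
        _ ≤ (1 + q + diam M) * ‖u‖ := by gcongr; linarith
  · calc ‖proj M x w - proj M z w‖ = ‖(proj M x - proj M z) w‖ := by simp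
      _ ≤ (L * ‖x - z‖) * ‖w‖ :=
        (ContinuousLinearMap.le_opNorm _ _).trans (by gcongr; exact hproj x hx z hz)
      _ = L * ‖w‖ * ‖x - z‖ := by ring

end MarsAdmm

namespace MarsAdmm

open Set Metric Filter Topology

/-! ### Convex analysis of the proximal step -/

section Convex

variable {m : ℕ} {g : E m → ℝ}

/-- Testing the subgradient inequality at `y + s` gives `‖s‖² ≤ L ‖s‖`. -/
theorem subdiff_subset_closedBall {L : ℝ≥0} (hg : LipschitzWith L g) (y : E m) :
    subdiff g y ⊆ closedBall 0 L := by
  intro s hs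
  rw [mem_closedBall_zero_iff]
  have h1 := hs (y + s)
  have h2 : g (y + s) - g y ≤ L * ‖s‖ := by
    have := hg.dist_le_mul (y + s) y
    rw [Real.dist_eq, dist_eq_norm, add_sub_cancel_left] at this
    exact (le_abs_self _).trans this
  rw [add_sub_cancel_left, real_inner_self_eq_norm_sq] at h1
  rcases (norm_nonneg s).eq_or_lt with h0 | h0
  · rw [← h0]; exact L.2
  · exact le_of_mul_le_mul_right (by nlinarith) h0

/-- Optimality condition for the minimization of `g + ρ/2 ‖a - ·‖² - ⟨lam, a - ·⟩`. -/
theorem mem_subdiff_of_isMinOn (hg : ConvexOn ℝ univ g) {ρ c : ℝ} {a lam y : E m}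
    (h : IsMinOn (fun z => c + g z - inner ℝ lam (a - z) + ρ / 2 * ‖a - z‖ ^ 2) univ y) :
    ρ • (a - y) - lam ∈ subdiff g y := by
  intro z
  -- Minimality is tested at `y + t (z - y)` and divided by `t`. The quadratic penalty contributes
  -- only a remainder of order `t`, which disappears in the limit.
  have key : ∀ t ∈ Ioc (0 : ℝ) 1,
      inner ℝ (ρ • (a - y) - lam) (z - y) ≤ g z - g y + t * (ρ / 2 * ‖z - y‖ ^ 2) := by
    intro t ht
    have hmin := h (mem_univ (y + t • (z - y)))
    have hconv := hg.2 (mem_univ y) (mem_univ z) (sub_nonneg.2 ht.2) ht.1.le (by ring)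
    have hy : (1 - t) • y + t • z = y + t • (z - y) := by module
    rw [hy, smul_eq_mul, smul_eq_mul] at hconv
    have hsq : ‖a - (y + t • (z - y))‖ ^ 2 = ‖a - y‖ ^ 2 - 2 * t * inner ℝ (a - y) (z - y)
        + t ^ 2 * ‖z - y‖ ^ 2 := by
      rw [← sub_sub, norm_sub_sq_real, inner_smul_right, norm_smul, mul_pow, Real.norm_eq_abs,
        sq_abs]
      ring
    have hin : inner ℝ lam (a - (y + t • (z - y))) =
        inner ℝ lam (a - y) - t * inner ℝ lam (z - y) := by
      rw [← sub_sub, inner_sub_right, inner_smul_right]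
    have hmin' : c + g y - inner ℝ lam (a - y) + ρ / 2 * ‖a - y‖ ^ 2 ≤
        c + g (y + t • (z - y)) - inner ℝ lam (a - (y + t • (z - y)))
          + ρ / 2 * ‖a - (y + t • (z - y))‖ ^ 2 := hmin
    rw [hsq, hin] at hmin'
    rw [inner_sub_left, inner_smul_left]
    simp only [conj_trivial]
    refine le_of_mul_le_mul_left ?_ ht.1
    nlinarith
  have hlim : Tendsto (fun t : ℝ => g z - g y + t * (ρ / 2 * ‖z - y‖ ^ 2)) (𝓝[>] 0)
      (𝓝 (g z - g y + 0 * (ρ / 2 * ‖z - y‖ ^ 2))) :=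
    ((continuous_const.add (continuous_id.mul continuous_const)).tendsto 0).mono_left
      nhdsWithin_le_nhds
  have := ge_of_tendsto hlim (by
    filter_upwards [Ioc_mem_nhdsGT one_pos] with t ht using key t ht)
  linarith

end Convex

/-- The quadratic upper bound for a function with Lipschitz gradient. -/
theorem le_of_lipschitzOn_gradient {n : ℕ} {F : E n → ℝ} {s : Set (E n)} {L : ℝ≥0}
    (hF : Differentiable ℝ F) (hs : Convex ℝ s) (hL : LipschitzOnWith L (gradient F) s)
    {x z : E n} (hx : x ∈ s) (hz : z ∈ s) :
    F z ≤ F x + inner ℝ (gradient F x) (z - x) + L / 2 * ‖z - x‖ ^ 2 := by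
  -- `φ` is the gap in the quadratic bound along the segment. Its derivative is nonpositive because
  -- the gradient varies by at most `L t ‖z - x‖` there; convexity of `s` keeps the segment inside.
  let φ : ℝ → ℝ := fun t => F (x + t • (z - x)) - t * inner ℝ (gradient F x) (z - x)
    - t ^ 2 * (L / 2 * ‖z - x‖ ^ 2)
  have hd : ∀ t, HasDerivAt φ (inner ℝ (gradient F (x + t • (z - x))) (z - x)
      - inner ℝ (gradient F x) (z - x) - 2 * t * (L / 2 * ‖z - x‖ ^ 2)) t := by
    intro t
    have hl : HasDerivAt (fun t : ℝ => x + t • (z - x)) (z - x) t := by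
      simpa using ((hasDerivAt_id t).smul_const (z - x)).const_add x
    have h1 : HasDerivAt (fun t : ℝ => F (x + t • (z - x)))
        (inner ℝ (gradient F (x + t • (z - x))) (z - x)) t := by
      have h0 := (hF (x + t • (z - x))).hasGradientAt.hasFDerivAt.comp_hasDerivAt t hl
      rwa [InnerProductSpace.toDual_apply_apply] at h0
    have h2 : HasDerivAt (fun t : ℝ => t * inner ℝ (gradient F x) (z - x))
        (inner ℝ (gradient F x) (z - x)) t := by
      simpa using (hasDerivAt_id t).mul_const (inner ℝ (gradient F x) (z - x))
    have h3 : HasDerivAt (fun t : ℝ => t ^ 2 * (L / 2 * ‖z - x‖ ^ 2))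
        (2 * t * (L / 2 * ‖z - x‖ ^ 2)) t := by
      simpa using (hasDerivAt_pow 2 t).mul_const (L / 2 * ‖z - x‖ ^ 2)
    exact (h1.sub h2).sub h3
  have hanti : AntitoneOn φ (Icc 0 1) := by
    refine antitoneOn_of_deriv_nonpos (convex_Icc 0 1)
      (fun t _ => (hd t).continuousAt.continuousWithinAt)
      (fun t _ => (hd t).differentiableAt.differentiableWithinAt) fun t ht => ?_
    rw [interior_Icc] at ht
    rw [(hd t).deriv, ← inner_sub_left]
    have hmem : x + t • (z - x) ∈ s := by
      have := hs hx hz (sub_nonneg.2 ht.2.le) ht.1.le (by ring)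
      convert this using 1
      module
    have h1 : ‖gradient F (x + t • (z - x)) - gradient F x‖ ≤ L * (t * ‖z - x‖) := by
      have := hL.norm_sub_le hmem hx
      rwa [add_sub_cancel_left, norm_smul, Real.norm_of_nonneg ht.1.le] at this
    have h2 := real_inner_le_norm (gradient F (x + t • (z - x)) - gradient F x) (z - x)
    have h3 := mul_le_mul_of_nonneg_right h1 (norm_nonneg (z - x))
    nlinarith
  have := hanti (left_mem_Icc.2 zero_le_one) (right_mem_Icc.2 zero_le_one) zero_le_one
  simp only [φ, one_smul, add_sub_cancel, zero_smul, add_zero] at this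
  linarith

/-! ### Cube roots -/

/-- The cube root of a natural number. -/
noncomputable def cbrt (k : ℕ) : ℝ := (k : ℝ) ^ (1 / 3 : ℝ)

theorem cbrt_nonneg (k : ℕ) : 0 ≤ cbrt k := Real.rpow_nonneg (Nat.cast_nonneg k) _

theorem cbrt_pow_three (k : ℕ) : cbrt k ^ 3 = k := by
  rw [cbrt, ← Real.rpow_natCast, ← Real.rpow_mul (Nat.cast_nonneg k)]
  norm_num

theorem one_le_cbrt {k : ℕ} (hk : 1 ≤ k) : 1 ≤ cbrt k :=
  Real.one_le_rpow (by exact_mod_cast hk) (by norm_num)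

theorem cbrt_pos {k : ℕ} (hk : 1 ≤ k) : 0 < cbrt k := one_pos.trans_le (one_le_cbrt hk)

theorem rpow_neg_div_three (k a : ℕ) : (k : ℝ) ^ (-(a / 3) : ℝ) = (cbrt k ^ a)⁻¹ := by
  rw [cbrt, ← Real.rpow_natCast, ← Real.rpow_mul (Nat.cast_nonneg k),
    ← Real.rpow_neg (Nat.cast_nonneg k)]
  congr 1
  ring

/-- The tangent line bound for the concave cube root. It makes the growth of `ρ_k` of order
`k^{-2/3}`. -/
theorem cbrt_succ_le {k : ℕ} (hk : 1 ≤ k) : cbrt (k + 1) ≤ cbrt k + 1 / (3 * cbrt k ^ 2) := by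
  have ht := cbrt_pos hk
  refine le_of_pow_le_pow_left₀ (n := 3) (by norm_num) (by positivity) ?_
  rw [cbrt_pow_three]
  have hd : 0 ≤ 1 / (3 * cbrt k ^ 2) := by positivity
  have h1 : cbrt k ^ 2 * (1 / (3 * cbrt k ^ 2)) = 1 / 3 := by field_simp
  have h2 : 0 ≤ 3 * cbrt k * (1 / (3 * cbrt k ^ 2)) ^ 2 + (1 / (3 * cbrt k ^ 2)) ^ 3 := by
    positivity
  push_cast
  rw [← cbrt_pow_three k]
  nlinarith

namespace Params

variable {n m : ℕ} (prm : Params n m)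

theorem ρ_eq (k : ℕ) : prm.ρ k = prm.cρ * cbrt k := rfl

theorem η_eq (k : ℕ) : prm.η k = prm.cη / cbrt k := by
  have := rpow_neg_div_three k 1
  simp only [Nat.cast_one, pow_one] at this
  rw [η, this, div_eq_mul_inv]

theorem αSucc_eq (k : ℕ) : prm.αSucc k = prm.cα / cbrt k ^ 2 := by
  have := rpow_neg_div_three k 2
  simp only [Nat.cast_ofNat] at this
  rw [αSucc, this, div_eq_mul_inv]

end Params

/-! ### Pathwise properties of the iterates -/

variable {n m : ℕ} {Ω Ξ : Type*} [MeasurableSpace Ξ]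

/-- The recursion of the algorithm, without the probabilistic requirements on the samples. -/
structure Trajectory.IsRun (S : Trajectory n m Ω Ξ) (Pb : Problem n m Ξ) (prm : Params n m) :
    Prop where
  batch_pos : ∀ k, 1 ≤ k → 1 ≤ S.b k
  x_one : ∀ ω, S.x 1 ω = prm.x₁
  y_one : ∀ ω, S.y 1 ω = prm.y₁
  lam_one : ∀ ω, S.lam 1 ω = prm.lam₁
  v_one : ∀ ω, S.v 1 ω = S.batchGrad Pb 1 ω prm.x₁
  y_succ : ∀ k, 1 ≤ k → ∀ ω,
    IsMinOn (fun z => Pb.augLag (prm.ρ k) (S.x k ω) z (S.lam k ω)) univ (S.y (k + 1) ω)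
  x_succ : ∀ k, 1 ≤ k → ∀ ω, S.x (k + 1) ω = Pb.R (S.x k ω) (S.step Pb prm k ω)
  beta_succ : ∀ k, 1 ≤ k → ∀ ω, S.β (k + 1) ω = S.betaSucc Pb prm k ω
  lam_succ : ∀ k, 1 ≤ k → ∀ ω,
    S.lam (k + 1) ω = S.lam k ω - S.β (k + 1) ω • (Pb.A (S.x (k + 1) ω) - S.y (k + 1) ω)
  v_succ : ∀ k, 1 ≤ k → ∀ ω,
    S.v (k + 1) ω = S.batchGrad Pb (k + 1) ω (S.x (k + 1) ω) + (1 - prm.αSucc k) •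
      Pb.T (S.x k ω) (S.step Pb prm k ω)
        (S.v k ω - S.batchGrad Pb (k + 1) ω (S.x k ω))

theorem Trajectory.IsMarsAdmm.isRun [MeasurableSpace Ω] {μ : Measure Ω} {S : Trajectory n m Ω Ξ}
    {Pb : Problem n m Ξ} {prm : Params n m} (h : S.IsMarsAdmm Pb prm μ) : S.IsRun Pb prm :=
  ⟨h.batch_pos, h.x_one, h.y_one, h.lam_one, h.v_one, h.y_succ, h.x_succ, h.beta_succ, h.lam_succ,
    h.v_succ⟩

/-- The assumptions on the problem and on the parameters. -/
structure Standing (Pb : Problem n m Ξ) (prm : Params n m) (LF Lg : ℝ≥0)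
    (σ Lt cν cγ p q Lp ζ : ℝ) : Prop where
  set : Pb.Setting
  reg : Pb.Regular LF Lg
  var : Pb.BoundedVariance σ
  msl : Pb.MeanSqLipschitz Lt
  adm : prm.Admissible Pb cν cγ
  geom : IsGeomConst Pb.M Pb.R Pb.T p q Lp ζ
  step : prm.StepBound Pb LF Lg Lt p q Lp ζ

namespace Standing

variable {S : Trajectory n m Ω Ξ} {Pb : Problem n m Ξ} {prm : Params n m} {LF Lg : ℝ≥0}
  {σ Lt cν cγ p q Lp ζ : ℝ}

theorem lamMax_nonneg (h : Standing Pb prm LF Lg σ Lt cν cγ p q Lp ζ) : 0 ≤ lamMax Pb prm := by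
  have := h.adm.β₁_pos
  unfold lamMax
  positivity

theorem one_le_cρ (h : Standing Pb prm LF Lg σ Lt cν cγ p q Lp ζ) : 1 ≤ prm.cρ := by
  have h1 : (1 : ℝ) ≤ √2 := Real.one_le_sqrt.2 (by norm_num)
  linarith [h.adm.cρ_ge]

theorem cρ_pos (h : Standing Pb prm LF Lg σ Lt cν cγ p q Lp ζ) : 0 < prm.cρ :=
  one_pos.trans_le h.one_le_cρ

theorem one_le_ρ (h : Standing Pb prm LF Lg σ Lt cν cγ p q Lp ζ) {k : ℕ} (hk : 1 ≤ k) :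
    1 ≤ prm.ρ k := by
  rw [prm.ρ_eq]
  exact one_le_mul_of_one_le_of_one_le h.one_le_cρ (one_le_cbrt hk)

theorem η_pos (h : Standing Pb prm LF Lg σ Lt cν cγ p q Lp ζ) {k : ℕ} (hk : 1 ≤ k) :
    0 < prm.η k := by
  rw [prm.η_eq]
  exact div_pos h.adm.cη_pos (cbrt_pos hk)

theorem ρ_mul_η (_h : Standing Pb prm LF Lg σ Lt cν cγ p q Lp ζ) {k : ℕ} (hk : 1 ≤ k) :
    prm.ρ k * prm.η k = prm.cρ * prm.cη := by
  have := cbrt_pos hk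
  rw [prm.η_eq, prm.ρ_eq]
  field_simp

theorem continuousOn_gradient (h : Standing Pb prm LF Lg σ Lt cν cγ p q Lp ζ) :
    ContinuousOn (gradient Pb.F) Pb.M :=
  h.reg.F_lip.continuousOn.mono (subset_convexHull ℝ _)

theorem norm_gradient_le (h : Standing Pb prm LF Lg σ Lt cν cγ p q Lp ζ) {x : E n}
    (hx : x ∈ Pb.M) : ‖gradient Pb.F x‖ ≤ gradBound Pb :=
  le_csSup (h.reg.compact.image_of_continuousOn h.continuousOn_gradient.norm).bddAbove
    (mem_image_of_mem _ hx)

theorem gradBound_nonneg (h : Standing Pb prm LF Lg σ Lt cν cγ p q Lp ζ) : 0 ≤ gradBound Pb :=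
  (norm_nonneg _).trans (h.norm_gradient_le h.adm.x₁_mem)

theorem batchGrad_mem (k : ℕ) (ω : Ω) (z : E n) :
    S.batchGrad Pb k ω z ∈ tangentSpace Pb.M z :=
  Submodule.smul_mem _ _ (Submodule.sum_mem _ fun _ _ => proj_mem _ _)

/-- The two claims need a joint induction: the retraction stays in `M` only along tangent steps, and
the transport keeps `v` tangent only if both arguments are tangent. -/
theorem x_mem_and_v_mem (h : Standing Pb prm LF Lg σ Lt cν cγ p q Lp ζ) (hS : S.IsRun Pb prm)
    {k : ℕ} (hk : 1 ≤ k) (ω : Ω) :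
    S.x k ω ∈ Pb.M ∧ S.v k ω ∈ tangentSpace Pb.M (S.x k ω) := by
  induction k, hk using Nat.le_induction with
  | base =>
    rw [hS.x_one, hS.v_one]
    exact ⟨h.adm.x₁_mem, batchGrad_mem _ _ _⟩
  | succ k hk ih =>
    have hstep : S.step Pb prm k ω ∈ tangentSpace Pb.M (S.x k ω) :=
      Submodule.neg_mem _ (Submodule.smul_mem _ _ (Submodule.add_mem _ ih.2 (proj_mem _ _)))
    rw [hS.v_succ k hk]
    refine ⟨by rw [hS.x_succ k hk]; exact h.set.retraction.mapsTo _ ih.1 _ hstep, ?_⟩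
    refine Submodule.add_mem _ (batchGrad_mem _ _ _) (Submodule.smul_mem _ _ ?_)
    rw [hS.x_succ k hk]
    exact h.set.transport.mapsTo _ ih.1 _ hstep _ (Submodule.sub_mem _ ih.2 (batchGrad_mem _ _ _))

theorem x_mem (h : Standing Pb prm LF Lg σ Lt cν cγ p q Lp ζ) (hS : S.IsRun Pb prm)
    {k : ℕ} (hk : 1 ≤ k) (ω : Ω) : S.x k ω ∈ Pb.M := (h.x_mem_and_v_mem hS hk ω).1

theorem G_mem (h : Standing Pb prm LF Lg σ Lt cν cγ p q Lp ζ) (hS : S.IsRun Pb prm)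
    {k : ℕ} (hk : 1 ≤ k) (ω : Ω) : S.G Pb prm k ω ∈ tangentSpace Pb.M (S.x k ω) :=
  Submodule.add_mem _ (h.x_mem_and_v_mem hS hk ω).2 (proj_mem _ _)

theorem step_mem (h : Standing Pb prm LF Lg σ Lt cν cγ p q Lp ζ) (hS : S.IsRun Pb prm)
    {k : ℕ} (hk : 1 ≤ k) (ω : Ω) : S.step Pb prm k ω ∈ tangentSpace Pb.M (S.x k ω) :=
  Submodule.neg_mem _ (Submodule.smul_mem _ _ (h.G_mem hS hk ω))

theorem err_mem (h : Standing Pb prm LF Lg σ Lt cν cγ p q Lp ζ) (hS : S.IsRun Pb prm)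
    {k : ℕ} (hk : 1 ≤ k) (ω : Ω) : S.err Pb k ω ∈ tangentSpace Pb.M (S.x k ω) :=
  Submodule.sub_mem _ (h.x_mem_and_v_mem hS hk ω).2 (proj_mem _ _)

theorem norm_step (h : Standing Pb prm LF Lg σ Lt cν cγ p q Lp ζ) {k : ℕ} (hk : 1 ≤ k) (ω : Ω) :
    ‖S.step Pb prm k ω‖ = prm.η k * ‖S.G Pb prm k ω‖ := by
  rw [Trajectory.step, norm_neg, norm_smul, Real.norm_of_nonneg (h.η_pos hk).le]

theorem norm_x_sub_le (h : Standing Pb prm LF Lg σ Lt cν cγ p q Lp ζ) (hS : S.IsRun Pb prm)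
    {k : ℕ} (hk : 1 ≤ k) (ω : Ω) :
    ‖S.x (k + 1) ω - S.x k ω‖ ≤ p * (prm.η k * ‖S.G Pb prm k ω‖) := by
  rw [hS.x_succ k hk, ← h.norm_step hk]
  exact h.geom.retr_fst _ (h.x_mem hS hk ω) _ (h.step_mem hS hk ω)

theorem norm_A_x_sub_le (h : Standing Pb prm LF Lg σ Lt cν cγ p q Lp ζ) (hS : S.IsRun Pb prm)
    {k : ℕ} (hk : 1 ≤ k) (ω : Ω) :
    ‖Pb.A (S.x (k + 1) ω) - Pb.A (S.x k ω)‖ ≤ ‖Pb.A‖ * (p * (prm.η k * ‖S.G Pb prm k ω‖)) := by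
  rw [← map_sub]
  refine (ContinuousLinearMap.le_opNorm _ _).trans ?_
  gcongr
  exact h.norm_x_sub_le hS hk ω

theorem subgradient_mem (h : Standing Pb prm LF Lg σ Lt cν cγ p q Lp ζ) (hS : S.IsRun Pb prm)
    {k : ℕ} (hk : 1 ≤ k) (ω : Ω) :
    prm.ρ k • (Pb.A (S.x k ω) - S.y (k + 1) ω) - S.lam k ω ∈ subdiff Pb.g (S.y (k + 1) ω) :=
  mem_subdiff_of_isMinOn h.reg.g_convex (hS.y_succ k hk ω)

/-- The bound does not depend on `ρ_k`; this is what keeps the gradient of the augmented Lagrangian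
bounded while the penalty grows. -/
theorem norm_subgradient_le (h : Standing Pb prm LF Lg σ Lt cν cγ p q Lp ζ) (hS : S.IsRun Pb prm)
    {k : ℕ} (hk : 1 ≤ k) (ω : Ω) :
    ‖prm.ρ k • (Pb.A (S.x k ω) - S.y (k + 1) ω) - S.lam k ω‖ ≤ Lg := by
  simpa using subdiff_subset_closedBall h.reg.g_lip _ (h.subgradient_mem hS hk ω)

theorem one_le_log_add {k : ℕ} {c : ℝ} (hk : 1 ≤ k) (hc : 2 ≤ c) : 1 ≤ Real.log (k + c) := by
  have hk' : (1 : ℝ) ≤ k := by exact_mod_cast hk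
  rw [Real.le_log_iff_exp_le (by linarith)]
  have := Real.exp_one_lt_d9
  linarith

theorem beta_nonneg (h : Standing Pb prm LF Lg σ Lt cν cγ p q Lp ζ) (hS : S.IsRun Pb prm)
    {k : ℕ} (hk : 1 ≤ k) (ω : Ω) : 0 ≤ S.β (k + 1) ω := by
  have := h.adm.β₁_pos
  have := h.adm.cβ_pos
  have h3 := one_le_log_add (c := 3) hk (by norm_num)
  rw [hS.beta_succ k hk, Trajectory.betaSucc]
  split_ifs
  · positivity
  · exact le_min (by positivity) (by positivity)

theorem beta_le (_h : Standing Pb prm LF Lg σ Lt cν cγ p q Lp ζ) (hS : S.IsRun Pb prm)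
    {k : ℕ} (hk : 1 ≤ k) (ω : Ω) :
    S.β (k + 1) ω ≤ prm.cβ / (cbrt k * Real.log (k + 2) ^ 2) := by
  rw [hS.beta_succ k hk, Trajectory.betaSucc]
  split_ifs
  · exact le_rfl
  · exact min_le_right _ _

/-- The first entry of the minimum defining `β_{k+1}` is designed to make the dual increments
summable. If the residual vanishes, so does the increment, whatever `β_{k+1}` is. -/
theorem beta_mul_le (h : Standing Pb prm LF Lg σ Lt cν cγ p q Lp ζ) (hS : S.IsRun Pb prm)
    {k : ℕ} (hk : 1 ≤ k) (ω : Ω) :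
    S.β (k + 1) ω * ‖Pb.A (S.x (k + 1) ω) - S.y (k + 1) ω‖ ≤
      prm.β₁ * ‖Pb.A prm.x₁ - prm.y₁‖ * (1 / ((k : ℝ) + 2) ^ 2) := by
  have hβ := h.adm.β₁_pos
  have h3 := one_le_log_add (c := 3) hk (by norm_num)
  rcases (norm_nonneg (Pb.A (S.x (k + 1) ω) - S.y (k + 1) ω)).eq_or_lt with h0 | h0
  · rw [← h0, mul_zero]
    positivity
  · have hle : S.β (k + 1) ω ≤ prm.β₁ * ‖Pb.A prm.x₁ - prm.y₁‖ /
        (‖Pb.A (S.x (k + 1) ω) - S.y (k + 1) ω‖ * ((k : ℝ) + 2) ^ 2 * Real.log (k + 3)) := by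
      rw [hS.beta_succ k hk, Trajectory.betaSucc]
      simp only [h0.ne', if_false]
      exact min_le_left _ _
    calc _ ≤ prm.β₁ * ‖Pb.A prm.x₁ - prm.y₁‖ /
        (‖Pb.A (S.x (k + 1) ω) - S.y (k + 1) ω‖ * ((k : ℝ) + 2) ^ 2 * Real.log (k + 3)) *
          ‖Pb.A (S.x (k + 1) ω) - S.y (k + 1) ω‖ := by gcongr
      _ = prm.β₁ * ‖Pb.A prm.x₁ - prm.y₁‖ * (1 / (((k : ℝ) + 2) ^ 2 * Real.log (k + 3))) := by
        field_simp
      _ ≤ _ := by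
        gcongr
        exact le_mul_of_one_le_right (by positivity) h3

theorem norm_lam_le (h : Standing Pb prm LF Lg σ Lt cν cγ p q Lp ζ) (hS : S.IsRun Pb prm)
    {k : ℕ} (hk : 1 ≤ k) (ω : Ω) : ‖S.lam k ω‖ ≤ lamMax Pb prm := by
  have hβ := h.adm.β₁_pos
  -- The range is shifted so that step `k` adds exactly the term `1 / (k + 2)²`. The term `j = 0` is
  -- zero by the convention for division, and the full series is `π² / 6`.
  have key : ‖S.lam k ω‖ ≤ ‖prm.lam₁‖ + prm.β₁ * ‖Pb.A prm.x₁ - prm.y₁‖ *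
      ∑ j ∈ Finset.range (k + 2), 1 / (j : ℝ) ^ 2 := by
    induction k, hk using Nat.le_induction with
    | base =>
      rw [hS.lam_one]
      exact le_add_of_nonneg_right (by positivity)
    | succ k hk ih =>
      rw [hS.lam_succ k hk, Finset.sum_range_succ, mul_add, ← add_assoc]
      refine (norm_sub_le _ _).trans (add_le_add ih ?_)
      rw [norm_smul, Real.norm_of_nonneg (h.beta_nonneg hS hk ω)]
      refine (h.beta_mul_le hS hk ω).trans (le_of_eq ?_)
      push_cast
      rfl
  refine key.trans ?_
  have hsum : ∑ j ∈ Finset.range (k + 2), 1 / (j : ℝ) ^ 2 ≤ Real.pi ^ 2 / 6 :=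
    sum_le_hasSum _ (fun _ _ => by positivity) hasSum_zeta_two
  rw [lamMax, mul_comm (Real.pi ^ 2 / 6) prm.β₁, mul_right_comm]
  gcongr

/-- `ρ_k (A x_k - y_{k+1})` is the subgradient plus `λ_k`, and both are bounded. -/
theorem norm_A_x_sub_y_le (h : Standing Pb prm LF Lg σ Lt cν cγ p q Lp ζ) (hS : S.IsRun Pb prm)
    {k : ℕ} (hk : 1 ≤ k) (ω : Ω) :
    ‖Pb.A (S.x k ω) - S.y (k + 1) ω‖ ≤ (Lg + lamMax Pb prm) / prm.ρ k := by
  have hρ := one_pos.trans_le (h.one_le_ρ hk)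
  rw [le_div_iff₀ hρ, mul_comm]
  calc prm.ρ k * ‖Pb.A (S.x k ω) - S.y (k + 1) ω‖
      = ‖(prm.ρ k • (Pb.A (S.x k ω) - S.y (k + 1) ω) - S.lam k ω) + S.lam k ω‖ := by
        rw [sub_add_cancel, norm_smul, Real.norm_of_nonneg hρ.le]
    _ ≤ Lg + lamMax Pb prm := (norm_add_le _ _).trans
        (add_le_add (h.norm_subgradient_le hS hk ω) (h.norm_lam_le hS hk ω))

theorem feasRes_succ_le (h : Standing Pb prm LF Lg σ Lt cν cγ p q Lp ζ) (hS : S.IsRun Pb prm)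
    {k : ℕ} (hk : 1 ≤ k) (ω : Ω) :
    ‖Pb.A (S.x (k + 1) ω) - S.y (k + 1) ω‖ ≤
      ‖Pb.A‖ * (p * (prm.η k * ‖S.G Pb prm k ω‖)) + (Lg + lamMax Pb prm) / prm.ρ k := by
  rw [← sub_add_sub_cancel _ (Pb.A (S.x k ω))]
  exact (norm_add_le _ _).trans
    (add_le_add (h.norm_A_x_sub_le hS hk ω) (h.norm_A_x_sub_y_le hS hk ω))

theorem norm_feas_succ_le_diam (h : Standing Pb prm LF Lg σ Lt cν cγ p q Lp ζ)
    (hS : S.IsRun Pb prm) {k : ℕ} (hk : 1 ≤ k) (ω : Ω) :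
    ‖Pb.A (S.x (k + 1) ω) - S.y (k + 1) ω‖ ≤
      Lg + lamMax Pb prm + ‖Pb.A‖ * Metric.diam Pb.M := by
  have h1 : ‖Pb.A (S.x (k + 1) ω) - Pb.A (S.x k ω)‖ ≤ ‖Pb.A‖ * Metric.diam Pb.M := by
    rw [← map_sub]
    refine (ContinuousLinearMap.le_opNorm _ _).trans ?_
    gcongr
    rw [← dist_eq_norm]
    exact dist_le_diam_of_mem h.reg.compact.isBounded (h.x_mem hS (by omega) ω) (h.x_mem hS hk ω)
  have h2 : (Lg + lamMax Pb prm) / prm.ρ k ≤ Lg + lamMax Pb prm :=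
    div_le_self (add_nonneg Lg.2 h.lamMax_nonneg) (h.one_le_ρ hk)
  rw [← sub_add_sub_cancel _ (Pb.A (S.x k ω))]
  refine (norm_add_le _ _).trans ?_
  linarith [h.norm_A_x_sub_y_le hS hk ω]

/-- The penalty is dropped and the multiplier term is bounded by Cauchy–Schwarz. The index is `k +
1` because the arbitrary `y_1` admits no bound on its feasibility gap. -/
theorem psiStar_le_augLag (h : Standing Pb prm LF Lg σ Lt cν cγ p q Lp ζ) (hS : S.IsRun Pb prm)
    {k : ℕ} (hk : 1 ≤ k) (ω : Ω) :
    psiStar Pb prm Lg ≤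
      Pb.augLag (prm.ρ (k + 1)) (S.x (k + 1) ω) (S.y (k + 1) ω) (S.lam (k + 1) ω) := by
  have hF : sInf (Pb.F '' Pb.M) ≤ Pb.F (S.x (k + 1) ω) :=
    csInf_le (h.reg.compact.image h.reg.F_diff.continuous).bddBelow
      (mem_image_of_mem _ (h.x_mem hS (by omega) ω))
  have hg : sInf (range Pb.g) ≤ Pb.g (S.y (k + 1) ω) := csInf_le h.reg.g_bdd (mem_range_self _)
  have hin : inner ℝ (S.lam (k + 1) ω) (Pb.A (S.x (k + 1) ω) - S.y (k + 1) ω) ≤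
      lamMax Pb prm * (Lg + lamMax Pb prm + ‖Pb.A‖ * Metric.diam Pb.M) :=
    (real_inner_le_norm _ _).trans (mul_le_mul (h.norm_lam_le hS (by omega) ω)
      (h.norm_feas_succ_le_diam hS hk ω) (norm_nonneg _) h.lamMax_nonneg)
  have hρ := one_pos.trans_le (h.one_le_ρ (k := k + 1) (by omega))
  have hsq : 0 ≤ prm.ρ (k + 1) / 2 * ‖Pb.A (S.x (k + 1) ω) - S.y (k + 1) ω‖ ^ 2 := by positivity
  unfold psiStar Problem.augLag
  linarith

end Standing

end MarsAdmm

/-! ### Pathwise residual bounds and one-step descent of the augmented Lagrangian -/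

namespace MarsAdmm

open Set Metric Filter Topology

variable {n m : ℕ} {Ω Ξ : Type*} [MeasurableSpace Ξ]

/-- The Euclidean gradient in `x` of the augmented Lagrangian. -/
noncomputable def Problem.lagGrad (Pb : Problem n m Ξ) (ρ : ℝ) (x : E n) (y lam : E m) : E n :=
  gradient Pb.F x + Pb.At (ρ • (Pb.A x - y) - lam)

theorem Problem.norm_At (Pb : Problem n m Ξ) : ‖Pb.At‖ = ‖Pb.A‖ :=
  LinearIsometryEquiv.norm_map _ _

theorem Problem.inner_At (Pb : Problem n m Ξ) (u : E m) (w : E n) :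
    inner ℝ (Pb.At u) w = inner ℝ u (Pb.A w) :=
  ContinuousLinearMap.adjoint_inner_left _ _ _

theorem Problem.norm_At_le (Pb : Problem n m Ξ) (u : E m) : ‖Pb.At u‖ ≤ ‖Pb.A‖ * ‖u‖ := by
  rw [← Pb.norm_At]
  exact ContinuousLinearMap.le_opNorm _ _

/-- The part of the merit decrease that does not depend on the iterates. -/
noncomputable def residualTerm (Pb : Problem n m Ξ) (prm : Params n m) (Lg : ℝ) (k : ℕ) : ℝ :=
  (2 * prm.cβ / prm.cρ ^ 2 * ((k : ℝ)⁻¹ / Real.log (k + 2) ^ 2)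
    + 1 / (3 * prm.cρ) * (cbrt k ^ 4)⁻¹) * (Lg + lamMax Pb prm) ^ 2

namespace Standing

variable {S : Trajectory n m Ω Ξ} {Pb : Problem n m Ξ} {prm : Params n m} {LF Lg : ℝ≥0}
  {σ Lt cν cγ p q Lp ζ : ℝ}

theorem augLag_le (h : Standing Pb prm LF Lg σ Lt cν cγ p q Lp ζ) {x z : E n} (hx : x ∈ Pb.M)
    (hz : z ∈ Pb.M) {ρ : ℝ} (hρ : 0 ≤ ρ) (y lam : E m) :
    Pb.augLag ρ z y lam ≤ Pb.augLag ρ x y lam + inner ℝ (Pb.lagGrad ρ x y lam) (z - x)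
      + (LF + ρ * ‖Pb.A‖ ^ 2) / 2 * ‖z - x‖ ^ 2 := by
  have hF := le_of_lipschitzOn_gradient h.reg.F_diff (convex_convexHull ℝ Pb.M) h.reg.F_lip
    (subset_convexHull ℝ _ hx) (subset_convexHull ℝ _ hz)
  have hsplit : Pb.A z - y = (Pb.A x - y) + Pb.A (z - x) := by rw [map_sub]; abel
  have hsq : ‖Pb.A z - y‖ ^ 2 = ‖Pb.A x - y‖ ^ 2 + 2 * inner ℝ (Pb.A x - y) (Pb.A (z - x))
      + ‖Pb.A (z - x)‖ ^ 2 := by rw [hsplit, norm_add_sq_real]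
  have hin : inner ℝ lam (Pb.A z - y) = inner ℝ lam (Pb.A x - y) + inner ℝ lam (Pb.A (z - x)) := by
    rw [hsplit, inner_add_right]
  have hA : ‖Pb.A (z - x)‖ ^ 2 ≤ ‖Pb.A‖ ^ 2 * ‖z - x‖ ^ 2 := by
    rw [← mul_pow]
    gcongr
    exact ContinuousLinearMap.le_opNorm _ _
  have hgr : inner ℝ (Pb.lagGrad ρ x y lam) (z - x) = inner ℝ (gradient Pb.F x) (z - x)
      + ρ * inner ℝ (Pb.A x - y) (Pb.A (z - x)) - inner ℝ lam (Pb.A (z - x)) := by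
    rw [Problem.lagGrad, inner_add_left, Pb.inner_At, inner_sub_left, real_inner_smul_left]
    ring
  have := mul_le_mul_of_nonneg_left hA (by positivity : 0 ≤ ρ / 2)
  unfold Problem.augLag
  rw [hsq, hin, hgr]
  nlinarith

/-- The multiplier part of the gradient is `Aᵀ` applied to a subgradient of `g`, so it is bounded
independently of `ρ_k`. -/
theorem norm_lagGrad_le (h : Standing Pb prm LF Lg σ Lt cν cγ p q Lp ζ) (hS : S.IsRun Pb prm)
    {k : ℕ} (hk : 1 ≤ k) (ω : Ω) :
    ‖Pb.lagGrad (prm.ρ k) (S.x k ω) (S.y (k + 1) ω) (S.lam k ω)‖ ≤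
      gradBound Pb + ‖Pb.A‖ * Lg := by
  refine (norm_add_le _ _).trans (add_le_add (h.norm_gradient_le (h.x_mem hS hk ω)) ?_)
  refine (Pb.norm_At_le _).trans ?_
  gcongr
  exact h.norm_subgradient_le hS hk ω

/-- `G_k` is the Riemannian gradient of the augmented Lagrangian with `grad F` replaced by its
estimator `v_k`, so the two differ by `ε_k`. -/
theorem proj_lagGrad (h : Standing Pb prm LF Lg σ Lt cν cγ p q Lp ζ)
    {k : ℕ} (hk : 1 ≤ k) (ω : Ω) :
    proj Pb.M (S.x k ω) (Pb.lagGrad (prm.ρ k) (S.x k ω) (S.y (k + 1) ω) (S.lam k ω)) =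
      S.G Pb prm k ω - S.err Pb k ω := by
  have hρ := (one_pos.trans_le (h.one_le_ρ hk)).ne'
  rw [Trajectory.G, Trajectory.err, Problem.lagGrad, map_add, ← map_smul Pb.At,
    smul_sub _ _ ((prm.ρ k)⁻¹ • _), smul_inv_smul₀ hρ]
  simp only [Problem.gradF, rgrad]
  abel

theorem statRes_succ_eq (k : ℕ) (ω : Ω) :
    statRes Pb (S.x (k + 1) ω) (S.lamBar Pb prm (k + 1) ω) =
      ‖proj Pb.M (S.x (k + 1) ω)
        (Pb.lagGrad (prm.ρ k) (S.x (k + 1) ω) (S.y (k + 1) ω) (S.lam k ω))‖ := by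
  rw [statRes, Trajectory.lamBar, Problem.lagGrad, map_add, Problem.gradF, rgrad, add_comm,
    add_tsub_cancel_right, ← map_neg, neg_sub]

theorem lipConst_le (h : Standing Pb prm LF Lg σ Lt cν cγ p q Lp ζ) :
    Lp * (gradBound Pb + ‖Pb.A‖ * Lg) * p + p * (LF + ‖Pb.A‖ ^ 2) ≤ lipConst Pb LF Lg p Lp ζ := by
  have : 0 ≤ ζ * (gradBound Pb + ‖Pb.A‖ * Lg) :=
    mul_nonneg h.geom.ζ_nonneg (add_nonneg h.gradBound_nonneg (by positivity))
  unfold lipConst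
  nlinarith

/-- The residual is the projected Lagrangian gradient at `x_{k+1}`. Moving it back to `x_k`, where
it equals `G_k - ε_k`, changes the tangent space and the gradient; the stepsize condition on `N`
bounds both changes together by `‖G_k‖`. -/
theorem statRes_succ_le (h : Standing Pb prm LF Lg σ Lt cν cγ p q Lp ζ) (hS : S.IsRun Pb prm)
    {k : ℕ} (hk : 1 ≤ k) (ω : Ω) :
    statRes Pb (S.x (k + 1) ω) (S.lamBar Pb prm (k + 1) ω) ≤
      2 * ‖S.G Pb prm k ω‖ + ‖S.err Pb k ω‖ := by
  rw [statRes_succ_eq]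
  have hρ1 := h.one_le_ρ hk
  have hx := h.x_mem hS hk ω
  have hx' := h.x_mem hS (k := k + 1) (by omega) ω
  have hpη := h.norm_x_sub_le hS hk ω
  have hpr := h.proj_lagGrad (S := S) hk ω
  have hbd := h.norm_lagGrad_le hS hk ω
  have hη := h.η_pos hk
  have hp := h.geom.p_pos
  have hLp := h.geom.Lp_nonneg
  have hB := h.gradBound_nonneg
  set g := ‖S.G Pb prm k ω‖
  set x := S.x k ω
  set x' := S.x (k + 1) ω
  set y := S.y (k + 1) ω
  set lam := S.lam k ω
  have h1 : ‖proj Pb.M x' (Pb.lagGrad (prm.ρ k) x y lam) -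
      proj Pb.M x (Pb.lagGrad (prm.ρ k) x y lam)‖ ≤
      Lp * (gradBound Pb + ‖Pb.A‖ * Lg) * (p * (prm.η k * g)) := by
    refine (h.geom.proj_lip x' hx' x hx _).trans ?_
    gcongr
  have h2 : ‖proj Pb.M x' (Pb.lagGrad (prm.ρ k) x' y lam - Pb.lagGrad (prm.ρ k) x y lam)‖ ≤
      prm.ρ k * (LF + ‖Pb.A‖ ^ 2) * (p * (prm.η k * g)) := by
    refine (norm_proj_le _ _).trans ?_
    have heq : Pb.lagGrad (prm.ρ k) x' y lam - Pb.lagGrad (prm.ρ k) x y lam =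
        (gradient Pb.F x' - gradient Pb.F x) + prm.ρ k • Pb.At (Pb.A (x' - x)) := by
      simp only [Problem.lagGrad, map_sub, map_smul, smul_sub]
      abel
    have hg := h.reg.F_lip.norm_sub_le (subset_convexHull ℝ _ hx') (subset_convexHull ℝ _ hx)
    have hA : ‖prm.ρ k • Pb.At (Pb.A (x' - x))‖ ≤ prm.ρ k * (‖Pb.A‖ ^ 2 * ‖x' - x‖) := by
      rw [norm_smul, Real.norm_of_nonneg (by linarith), pow_two, mul_assoc ‖Pb.A‖]
      gcongr
      exact (Pb.norm_At_le _).trans (by gcongr; exact ContinuousLinearMap.le_opNorm _ _)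
    rw [heq]
    calc _ ≤ LF * ‖x' - x‖ + prm.ρ k * (‖Pb.A‖ ^ 2 * ‖x' - x‖) :=
          (norm_add_le _ _).trans (add_le_add hg hA)
      _ ≤ prm.ρ k * (LF * ‖x' - x‖) + prm.ρ k * (‖Pb.A‖ ^ 2 * ‖x' - x‖) :=
          add_le_add (le_mul_of_one_le_left (by positivity) hρ1) le_rfl
      _ = prm.ρ k * (LF + ‖Pb.A‖ ^ 2) * ‖x' - x‖ := by ring
      _ ≤ _ := by gcongr
  -- `1 ≤ ρ_k` lets the factor `ρ_k` be put on both terms; then `ρ_k η_k = c_ρ c_η` and `c_η c_ρ N ≤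
  -- 1`.
  have h3 : Lp * (gradBound Pb + ‖Pb.A‖ * Lg) * (p * (prm.η k * g))
      + prm.ρ k * (LF + ‖Pb.A‖ ^ 2) * (p * (prm.η k * g)) ≤ g := by
    calc _ ≤ prm.ρ k * (Lp * (gradBound Pb + ‖Pb.A‖ * Lg) * (p * (prm.η k * g)))
          + prm.ρ k * (LF + ‖Pb.A‖ ^ 2) * (p * (prm.η k * g)) :=
          add_le_add (le_mul_of_one_le_left (by positivity) hρ1) le_rfl
      _ = (prm.ρ k * prm.η k) *
          (Lp * (gradBound Pb + ‖Pb.A‖ * Lg) * p + p * (LF + ‖Pb.A‖ ^ 2)) * g := by ring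
      _ ≤ (prm.cρ * prm.cη) * lipConst Pb LF Lg p Lp ζ * g := by
          rw [h.ρ_mul_η hk]
          have := h.cρ_pos
          have := h.adm.cη_pos
          gcongr
          exact h.lipConst_le
      _ ≤ 1 * g := by
          gcongr
          linarith [h.step.le_N]
      _ = g := one_mul _
  have hsum : proj Pb.M x' (Pb.lagGrad (prm.ρ k) x' y lam) =
      proj Pb.M x' (Pb.lagGrad (prm.ρ k) x' y lam - Pb.lagGrad (prm.ρ k) x y lam)
      + (proj Pb.M x' (Pb.lagGrad (prm.ρ k) x y lam) - proj Pb.M x (Pb.lagGrad (prm.ρ k) x y lam))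
      + proj Pb.M x (Pb.lagGrad (prm.ρ k) x y lam) := by
    rw [map_sub]; abel
  rw [hsum]
  refine (norm_add₃_le).trans ?_
  have h4 : ‖proj Pb.M x (Pb.lagGrad (prm.ρ k) x y lam)‖ ≤ g + ‖S.err Pb k ω‖ := by
    rw [hpr]
    exact norm_sub_le _ _
  linarith

theorem cρ_mul_cη_le_one (h : Standing Pb prm LF Lg σ Lt cν cγ p q Lp ζ) :
    prm.cρ * prm.cη ≤ 1 := by
  have hc := h.cρ_pos
  have hη := h.adm.cη_pos
  have hM : 0 ≤ smoothConst Pb prm LF Lg p q := by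
    have := h.geom.q_pos
    have := h.gradBound_nonneg
    have := h.lamMax_nonneg
    have : 0 ≤ Metric.diam Pb.M := diam_nonneg
    unfold smoothConst Theta
    positivity
  have := mul_nonneg (mul_nonneg hη.le hM) hc.le
  nlinarith [h.step.le_M]

/-- `-λ̄_{k+1}` differs from the subgradient of the `y`-step by `ρ_k A (x_{k+1} - x_k)`, and the
factor `ρ_k` is cancelled by the stepsize `η_k`. -/
theorem dualRes_succ_le (h : Standing Pb prm LF Lg σ Lt cν cγ p q Lp ζ) (hS : S.IsRun Pb prm)
    {k : ℕ} (hk : 1 ≤ k) (ω : Ω) :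
    dualRes Pb (S.y (k + 1) ω) (S.lamBar Pb prm (k + 1) ω) ≤ p * ‖Pb.A‖ * ‖S.G Pb prm k ω‖ := by
  refine (infDist_le_dist_of_mem (h.subgradient_mem hS hk ω)).trans ?_
  have hρ := one_pos.trans_le (h.one_le_ρ hk)
  have hp := h.geom.p_pos
  have heq : -S.lamBar Pb prm (k + 1) ω -
      (prm.ρ k • (Pb.A (S.x k ω) - S.y (k + 1) ω) - S.lam k ω) =
      prm.ρ k • (Pb.A (S.x (k + 1) ω) - Pb.A (S.x k ω)) := by
    rw [Trajectory.lamBar, add_tsub_cancel_right]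
    module
  rw [dist_eq_norm, heq, norm_smul, Real.norm_of_nonneg hρ.le]
  calc _ ≤ prm.ρ k * (‖Pb.A‖ * (p * (prm.η k * ‖S.G Pb prm k ω‖))) := by
        gcongr
        exact h.norm_A_x_sub_le hS hk ω
    _ = (prm.ρ k * prm.η k) * (p * ‖Pb.A‖ * ‖S.G Pb prm k ω‖) := by ring
    _ ≤ 1 * (p * ‖Pb.A‖ * ‖S.G Pb prm k ω‖) := by
        rw [h.ρ_mul_η hk]
        gcongr
        exact h.cρ_mul_cη_le_one
    _ = _ := one_mul _

/-- The descent of the augmented Lagrangian in the `x`-step. -/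
theorem augLag_x_step_le (h : Standing Pb prm LF Lg σ Lt cν cγ p q Lp ζ) (hS : S.IsRun Pb prm)
    {k : ℕ} (hk : 1 ≤ k) (ω : Ω) :
    Pb.augLag (prm.ρ k) (S.x (k + 1) ω) (S.y (k + 1) ω) (S.lam k ω) ≤
      Pb.augLag (prm.ρ k) (S.x k ω) (S.y (k + 1) ω) (S.lam k ω)
        - prm.η k / 2 * ‖S.G Pb prm k ω‖ ^ 2
        + prm.η k * inner ℝ (S.err Pb k ω) (S.G Pb prm k ω) := by
  have hρ1 := h.one_le_ρ hk
  have hx := h.x_mem hS hk ω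
  have hx' := h.x_mem hS (k := k + 1) (by omega) ω
  have hst := h.step_mem hS hk ω
  have hη := h.η_pos hk
  have hq := h.geom.q_pos
  have hp := h.geom.p_pos
  have hB := h.gradBound_nonneg
  have hl := h.lamMax_nonneg
  have hD : 0 ≤ Metric.diam Pb.M := diam_nonneg
  have h0 := h.augLag_le hx hx' (zero_le_one.trans hρ1) (S.y (k + 1) ω) (S.lam k ω)
  have h1 : ‖S.x (k + 1) ω - S.x k ω‖ ^ 2 ≤ p ^ 2 * (prm.η k ^ 2 * ‖S.G Pb prm k ω‖ ^ 2) := by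
    rw [← mul_pow, ← mul_pow]
    gcongr
    exact h.norm_x_sub_le hS hk ω
  have hin : inner ℝ (Pb.lagGrad (prm.ρ k) (S.x k ω) (S.y (k + 1) ω) (S.lam k ω))
      (S.x (k + 1) ω - S.x k ω) ≤
      Theta Pb prm Lg * (q * (prm.η k ^ 2 * ‖S.G Pb prm k ω‖ ^ 2))
        - prm.η k * ‖S.G Pb prm k ω‖ ^ 2
        + prm.η k * inner ℝ (S.err Pb k ω) (S.G Pb prm k ω) := by
    -- The displacement is split into the tangent step and the second order error of the retraction.
    -- Against the tangent step the gradient may be replaced by its projection `G_k - ε_k`; against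
    -- the error it is bounded by `Θ`.
    rw [show S.x (k + 1) ω - S.x k ω = (S.x (k + 1) ω - S.x k ω - S.step Pb prm k ω)
      + S.step Pb prm k ω by abel, inner_add_right, ← inner_proj_left hst, h.proj_lagGrad hk]
    have ha : inner ℝ (S.G Pb prm k ω - S.err Pb k ω) (S.step Pb prm k ω) =
        - prm.η k * ‖S.G Pb prm k ω‖ ^ 2
        + prm.η k * inner ℝ (S.err Pb k ω) (S.G Pb prm k ω) := by
      rw [Trajectory.step, inner_neg_right, real_inner_smul_right, inner_sub_left,
        real_inner_self_eq_norm_sq]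
      ring
    have hb : ‖S.x (k + 1) ω - S.x k ω - S.step Pb prm k ω‖ ≤
        q * (prm.η k ^ 2 * ‖S.G Pb prm k ω‖ ^ 2) := by
      have := h.geom.retr_snd _ hx _ hst
      rwa [← hS.x_succ k hk, h.norm_step hk, mul_pow] at this
    have hΘ : ‖Pb.lagGrad (prm.ρ k) (S.x k ω) (S.y (k + 1) ω) (S.lam k ω)‖ ≤ Theta Pb prm Lg := by
      refine (h.norm_lagGrad_le hS hk ω).trans ?_
      have e1 : 0 ≤ ‖Pb.A‖ ^ 2 * Metric.diam Pb.M := by positivity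
      have e2 : 0 ≤ ‖Pb.A‖ * lamMax Pb prm := by positivity
      have e3 : 0 ≤ ‖Pb.A‖ * (2 * ‖Pb.A‖ * Metric.diam Pb.M) := by positivity
      unfold Theta
      nlinarith
    have hc := (real_inner_le_norm (Pb.lagGrad (prm.ρ k) (S.x k ω) (S.y (k + 1) ω) (S.lam k ω))
      (S.x (k + 1) ω - S.x k ω - S.step Pb prm k ω)).trans
        (mul_le_mul hΘ hb (norm_nonneg _) ((norm_nonneg _).trans hΘ))
    rw [ha]
    linarith
  have hΘ0 : 0 ≤ Theta Pb prm Lg := by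
    unfold Theta
    positivity
  -- All terms quadratic in the step use up at most half of the first order decrease, since `ρ_k η_k
  -- M = c_ρ c_η M ≤ 1`.
  have hM : (LF + prm.ρ k * ‖Pb.A‖ ^ 2) / 2 * ‖S.x (k + 1) ω - S.x k ω‖ ^ 2
      + Theta Pb prm Lg * (q * (prm.η k ^ 2 * ‖S.G Pb prm k ω‖ ^ 2)) ≤
      prm.η k / 2 * ‖S.G Pb prm k ω‖ ^ 2 := by
    calc _ ≤ (prm.ρ k * LF + prm.ρ k * ‖Pb.A‖ ^ 2) / 2 *
          (p ^ 2 * (prm.η k ^ 2 * ‖S.G Pb prm k ω‖ ^ 2))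
          + prm.ρ k * (Theta Pb prm Lg * (q * (prm.η k ^ 2 * ‖S.G Pb prm k ω‖ ^ 2))) := by
          refine add_le_add ?_ (le_mul_of_one_le_left (by positivity) hρ1)
          gcongr
          exact le_mul_of_one_le_left LF.2 hρ1
      _ = (prm.ρ k * prm.η k) * smoothConst Pb prm LF Lg p q *
          (prm.η k / 2 * ‖S.G Pb prm k ω‖ ^ 2) := by
          unfold smoothConst; ring
      _ ≤ 1 * (prm.η k / 2 * ‖S.G Pb prm k ω‖ ^ 2) := by
          gcongr
          rw [h.ρ_mul_η hk]
          have := h.step.le_M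
          have := mul_pos h.adm.cη_pos h.cρ_pos
          linarith
      _ = _ := one_mul _
  linarith

theorem augLag_dual_step_eq (hS : S.IsRun Pb prm) {k : ℕ} (hk : 1 ≤ k) (ω : Ω) :
    Pb.augLag (prm.ρ (k + 1)) (S.x (k + 1) ω) (S.y (k + 1) ω) (S.lam (k + 1) ω) =
      Pb.augLag (prm.ρ k) (S.x (k + 1) ω) (S.y (k + 1) ω) (S.lam k ω)
        + (S.β (k + 1) ω + (prm.ρ (k + 1) - prm.ρ k) / 2) *
          ‖Pb.A (S.x (k + 1) ω) - S.y (k + 1) ω‖ ^ 2 := by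
  unfold Problem.augLag
  rw [hS.lam_succ k hk, inner_sub_left, real_inner_smul_left, real_inner_self_eq_norm_sq]
  ring

/-- The squared feasibility gap has a part from the motion of `x`, absorbed into the decrease in
`‖G_k‖²`, and a part of order `1 / ρ_k²`, which after multiplication by the coefficient is summable.
-/
theorem penalty_increment_le (h : Standing Pb prm LF Lg σ Lt cν cγ p q Lp ζ)
    (hS : S.IsRun Pb prm) {k : ℕ} (hk : 1 ≤ k) (ω : Ω) :
    (S.β (k + 1) ω + (prm.ρ (k + 1) - prm.ρ k) / 2) *
      ‖Pb.A (S.x (k + 1) ω) - S.y (k + 1) ω‖ ^ 2 ≤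
    prm.η k / (8 * cbrt k ^ 2) * ‖S.G Pb prm k ω‖ ^ 2 + residualTerm Pb prm Lg k := by
  have ht := one_le_cbrt hk
  have ht0 := cbrt_pos hk
  have hc := h.cρ_pos
  have hcη := h.adm.cη_pos
  have hcβ := h.adm.cβ_pos
  have hlog := one_le_log_add (c := 2) hk le_rfl
  have hp := h.geom.p_pos
  have hη := h.η_pos hk
  have hl := h.lamMax_nonneg
  have hkt := cbrt_pow_three k
  have hβ := h.beta_le hS hk ω
  have hβ0 := h.beta_nonneg hS hk ω
  have hr := h.feasRes_succ_le hS hk ω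
  set t := cbrt k with htdef
  set g := ‖S.G Pb prm k ω‖
  set ℓ := Real.log (k + 2)
  set w := (Lg : ℝ) + lamMax Pb prm
  have hw : 0 ≤ w := add_nonneg Lg.2 hl
  have hinc : (prm.ρ (k + 1) - prm.ρ k) / 2 ≤ prm.cρ / (6 * t ^ 2) := by
    have := mul_le_mul_of_nonneg_left (cbrt_succ_le hk) hc.le
    rw [prm.ρ_eq, prm.ρ_eq]
    calc _ ≤ (prm.cρ * (t + 1 / (3 * t ^ 2)) - prm.cρ * t) / 2 := by gcongr
      _ = _ := by field_simp; ring
  have hr2 : ‖Pb.A (S.x (k + 1) ω) - S.y (k + 1) ω‖ ^ 2 ≤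
      2 * (‖Pb.A‖ ^ 2 * p ^ 2 * prm.η k ^ 2 * g ^ 2) + 2 * (w ^ 2 / (prm.cρ ^ 2 * t ^ 2)) := by
    have h1 := pow_le_pow_left₀ (norm_nonneg _) hr 2
    refine h1.trans ?_
    rw [prm.ρ_eq, ← htdef]
    have e1 : (‖Pb.A‖ * (p * (prm.η k * g))) ^ 2 = ‖Pb.A‖ ^ 2 * p ^ 2 * prm.η k ^ 2 * g ^ 2 := by
      ring
    have e2 : (w / (prm.cρ * t)) ^ 2 = w ^ 2 / (prm.cρ ^ 2 * t ^ 2) := by ring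
    rw [← e1, ← e2]
    exact add_sq_le.trans (by linarith)
  have hcoef : S.β (k + 1) ω + (prm.ρ (k + 1) - prm.ρ k) / 2 ≤
      prm.cβ / (t * ℓ ^ 2) + prm.cρ / (6 * t ^ 2) := add_le_add hβ hinc
  have hcoef0 : 0 ≤ prm.cβ / (t * ℓ ^ 2) + prm.cρ / (6 * t ^ 2) := by positivity
  -- With `c_β ≤ c_ρ / 3` and `ln(k + 2) ≥ 1`, the coefficient is at most `c_ρ / (3t) + c_ρ / (6t)`.
  -- This cruder bound is used only for the `G`-part.
  have hcoef2 : prm.cβ / (t * ℓ ^ 2) + prm.cρ / (6 * t ^ 2) ≤ prm.cρ / (2 * t) := by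
    have e1 : prm.cβ / (t * ℓ ^ 2) ≤ (prm.cρ / 3) / (t * 1) := by
      gcongr
      · exact h.adm.cβ_le
      · exact one_le_pow₀ hlog
    have e2 : prm.cρ / (6 * t ^ 2) ≤ prm.cρ / (6 * t) := by
      gcongr
      nlinarith
    refine (add_le_add e1 e2).trans (le_of_eq ?_)
    field_simp
    norm_num
  have hG : (prm.cβ / (t * ℓ ^ 2) + prm.cρ / (6 * t ^ 2)) *
      (2 * (‖Pb.A‖ ^ 2 * p ^ 2 * prm.η k ^ 2 * g ^ 2)) ≤ prm.η k / (8 * t ^ 2) * g ^ 2 := by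
    calc _ ≤ prm.cρ / (2 * t) * (2 * (‖Pb.A‖ ^ 2 * p ^ 2 * prm.η k ^ 2 * g ^ 2)) := by gcongr
      _ = (prm.cη * (8 * p ^ 2 * ‖Pb.A‖ ^ 2 * prm.cρ)) * (prm.η k / (8 * t ^ 2) * g ^ 2) := by
        rw [prm.η_eq, ← htdef]
        field_simp
      _ ≤ 1 * (prm.η k / (8 * t ^ 2) * g ^ 2) := by
        gcongr
        exact h.step.le_A
      _ = _ := one_mul _
  have hR : (prm.cβ / (t * ℓ ^ 2) + prm.cρ / (6 * t ^ 2)) * (2 * (w ^ 2 / (prm.cρ ^ 2 * t ^ 2))) =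
      residualTerm Pb prm Lg k := by
    have hres : residualTerm Pb prm Lg k = (2 * prm.cβ / prm.cρ ^ 2 * ((t ^ 3)⁻¹ / ℓ ^ 2)
        + 1 / (3 * prm.cρ) * (t ^ 4)⁻¹) * w ^ 2 := by
      rw [hkt]
      rfl
    rw [hres]
    field_simp
    ring
  calc _ ≤ (prm.cβ / (t * ℓ ^ 2) + prm.cρ / (6 * t ^ 2)) *
        (2 * (‖Pb.A‖ ^ 2 * p ^ 2 * prm.η k ^ 2 * g ^ 2) + 2 * (w ^ 2 / (prm.cρ ^ 2 * t ^ 2))) := by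
        gcongr
    _ ≤ _ := by rw [mul_add, hR]; gcongr

/-- The pathwise descent of the augmented Lagrangian in one iteration. -/
theorem augLag_succ_le (h : Standing Pb prm LF Lg σ Lt cν cγ p q Lp ζ) (hS : S.IsRun Pb prm)
    {k : ℕ} (hk : 1 ≤ k) (ω : Ω) :
    Pb.augLag (prm.ρ (k + 1)) (S.x (k + 1) ω) (S.y (k + 1) ω) (S.lam (k + 1) ω) ≤
      Pb.augLag (prm.ρ k) (S.x k ω) (S.y k ω) (S.lam k ω)
        - prm.η k * (3 / 8 - 1 / (8 * cbrt k ^ 2)) * ‖S.G Pb prm k ω‖ ^ 2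
        + 2 * prm.η k * ‖S.err Pb k ω‖ ^ 2 + residualTerm Pb prm Lg k := by
  have hy : Pb.augLag (prm.ρ k) (S.x k ω) (S.y (k + 1) ω) (S.lam k ω) ≤
      Pb.augLag (prm.ρ k) (S.x k ω) (S.y k ω) (S.lam k ω) := hS.y_succ k hk ω (mem_univ _)
  have hx := h.augLag_x_step_le hS hk ω
  have hd := augLag_dual_step_eq hS hk ω
  have hpen := h.penalty_increment_le hS hk ω
  -- Young's inequality with weight `1/8`: of the coefficient `1/2` in the `x`-step, `3/8` remains.
  have hin : inner ℝ (S.err Pb k ω) (S.G Pb prm k ω) ≤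
      ‖S.G Pb prm k ω‖ ^ 2 / 8 + 2 * ‖S.err Pb k ω‖ ^ 2 := by
    have := real_inner_le_norm (S.err Pb k ω) (S.G Pb prm k ω)
    nlinarith [sq_nonneg (‖S.G Pb prm k ω‖ - 4 * ‖S.err Pb k ω‖)]
  have hin' := mul_le_mul_of_nonneg_left hin (h.η_pos hk).le
  have e : prm.η k / (8 * cbrt k ^ 2) = prm.η k * (1 / (8 * cbrt k ^ 2)) := by ring
  rw [e] at hpen
  rw [hd]
  linarith

end Standing

end MarsAdmm

namespace MarsAdmm

open Set Metric Filter Topology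

/-! ### Measurability -/

/-- `y` factors through a 1-Lipschitz function on the range of `c`. That range need not be
measurable, so the preimage of an open set is exhibited as the preimage under `c` of an open union
of balls. It applies to argmins specified only pointwise. -/
theorem measurable_of_dist_le {Ω X Y : Type*} [MeasurableSpace Ω] [PseudoMetricSpace X]
    [MeasurableSpace X] [OpensMeasurableSpace X] [PseudoMetricSpace Y] [MeasurableSpace Y]
    [BorelSpace Y] {c : Ω → X} {y : Ω → Y} (hc : Measurable c)
    (h : ∀ ω ω', dist (y ω) (y ω') ≤ dist (c ω) (c ω')) : Measurable y := by
  refine measurable_of_isOpen fun U hU => ?_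
  have heq : y ⁻¹' U = c ⁻¹' (⋃ ω, ⋃ δ, ⋃ _ : ball (y ω) δ ⊆ U, ball (c ω) δ) := by
    ext ω
    simp only [mem_preimage, mem_iUnion, exists_prop]
    constructor
    · intro hω
      obtain ⟨δ, hδ, hball⟩ := Metric.isOpen_iff.1 hU _ hω
      exact ⟨ω, δ, hball, mem_ball_self hδ⟩
    · rintro ⟨ω', δ, hball, hω⟩
      exact hball ((h ω ω').trans_lt hω)
  rw [heq]
  refine hc (IsOpen.measurableSet ?_)
  exact isOpen_iUnion fun _ => isOpen_iUnion fun _ => isOpen_iUnion fun _ => isOpen_ball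

theorem measurable_comp_of_continuousOn {Ω X Y : Type*} [MeasurableSpace Ω] [TopologicalSpace X]
    [MeasurableSpace X] [BorelSpace X] [TopologicalSpace Y] [MeasurableSpace Y]
    [BorelSpace Y] {s : Set X} {f : X → Y} (hf : ContinuousOn f s) {Z : Ω → X}
    (hZ : Measurable Z) (hmem : ∀ ω, Z ω ∈ s) : Measurable fun ω => f (Z ω) :=
  hf.domRestrict.measurable.comp (hZ.subtype_mk (h := hmem))

/-- The subdifferential has closed graph and values in a fixed compact ball. A sublevel set of the
distance is thus the projection of a closed set along a compact factor, hence closed. -/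
theorem measurable_infDist_subdiff {Ω : Type*} [MeasurableSpace Ω] {m : ℕ} {g : E m → ℝ}
    {L : ℝ≥0} (hg : LipschitzWith L g) {Y Λ : Ω → E m} (hY : Measurable Y) (hΛ : Measurable Λ)
    (hne : ∀ ω, (subdiff g (Y ω)).Nonempty) :
    Measurable fun ω => infDist (Λ ω) (subdiff g (Y ω)) := by
  have hgc := hg.continuous
  have hclosed : IsClosed {w : (E m × E m) | w.2 ∈ subdiff g w.1} := by
    have : {w : (E m × E m) | w.2 ∈ subdiff g w.1} =
        ⋂ z, {w : (E m × E m) | g w.1 + inner ℝ w.2 (z - w.1) ≤ g z} := by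
      ext w; simp [subdiff]
    rw [this]
    exact isClosed_iInter fun z => isClosed_le (by fun_prop) continuous_const
  have hsub : ∀ y, IsClosed (subdiff g y) := fun y =>
    hclosed.preimage (f := fun s => (y, s)) (by fun_prop)
  have hset : ∀ r : ℝ, IsClosed {w : E m × E m | ∃ s ∈ subdiff g w.1, dist w.2 s ≤ r} := by
    intro r
    let K := closedBall (0 : E m) L
    have : CompactSpace K := isCompact_iff_compactSpace.1 (isCompact_closedBall _ _)
    have h1 : IsClosed {w : (E m × E m) × K | (w.2 : E m) ∈ subdiff g w.1.1 ∧
        dist w.1.2 (w.2 : E m) ≤ r} :=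
      (hclosed.preimage (f := fun w : (E m × E m) × K => (w.1.1, (w.2 : E m))) (by fun_prop)).inter
        (isClosed_le (f := fun w : (E m × E m) × K => dist w.1.2 (w.2 : E m)) (by fun_prop)
          continuous_const)
    convert isClosedMap_fst_of_compactSpace _ h1 using 1
    ext w
    constructor
    · rintro ⟨s, hs, hd⟩
      exact ⟨(w, ⟨s, subdiff_subset_closedBall hg _ hs⟩), ⟨hs, hd⟩, rfl⟩
    · rintro ⟨⟨w', s⟩, ⟨hs, hd⟩, rfl⟩
      exact ⟨s, hs, hd⟩
  refine measurable_of_Iic fun r => ?_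
  have heq : (fun ω => infDist (Λ ω) (subdiff g (Y ω))) ⁻¹' Iic r =
      (fun ω => (Y ω, Λ ω)) ⁻¹' {w : E m × E m | ∃ s ∈ subdiff g w.1, dist w.2 s ≤ r} := by
    ext ω
    constructor
    · intro h
      obtain ⟨s, hs, hd⟩ := (hsub (Y ω)).exists_infDist_eq_dist (hne ω) (Λ ω)
      exact ⟨s, hs, hd ▸ h⟩
    · rintro ⟨s, hs, hd⟩
      exact (infDist_le_dist_of_mem hs).trans hd
  rw [heq]
  exact (hY.prodMk hΛ) (hset r).measurableSet

/-- The proximal step is nonexpansive. -/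
theorem dist_le_of_mem_subdiff {m : ℕ} {g : E m → ℝ} {ρ : ℝ} (hρ : 0 < ρ) {a lam y a' lam' y' : E m}
    (h : ρ • (a - y) - lam ∈ subdiff g y) (h' : ρ • (a' - y') - lam' ∈ subdiff g y') :
    dist y y' ≤ dist (a - ρ⁻¹ • lam) (a' - ρ⁻¹ • lam') := by
  have e : ∀ a y lam : E m, ρ • (a - y) - lam = ρ • ((a - ρ⁻¹ • lam) - y) := fun a y lam => by
    rw [smul_sub, smul_sub, smul_sub, smul_inv_smul₀ hρ.ne']
    abel
  rw [e] at h h'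
  set c := a - ρ⁻¹ • lam
  set c' := a' - ρ⁻¹ • lam'
  have h1 := h y'
  have h2 := h' y
  rw [real_inner_smul_left] at h1 h2
  -- Monotonicity of the subdifferential: adding the two subgradient inequalities eliminates `g`.
  have h3 : inner ℝ (c - y) (y' - y) + inner ℝ (c' - y') (y - y') ≤ 0 := by
    refine nonpos_of_mul_nonpos_right (a := ρ) ?_ hρ
    linarith
  have h4 : inner ℝ (c - y) (y' - y) + inner ℝ (c' - y') (y - y') =
      ‖y - y'‖ ^ 2 - inner ℝ (c - c') (y - y') := by
    rw [← real_inner_self_eq_norm_sq, ← neg_sub y y', inner_neg_right, ← sub_eq_neg_add,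
      ← inner_sub_left, ← inner_sub_left]
    congr 1
    abel
  have h5 := real_inner_le_norm (c - c') (y - y')
  rw [dist_eq_norm, dist_eq_norm]
  rcases (norm_nonneg (y - y')).eq_or_lt with h0 | h0
  · rw [← h0]; exact norm_nonneg _
  · exact le_of_mul_le_mul_right (by nlinarith) h0

/-- A Carathéodory argument: for fixed `x` the directional derivatives are limits of measurable
difference quotients, and for fixed sample the gradient is continuous in `x`. -/
theorem measurable_gradient {n : ℕ} {Ξ : Type*} [MeasurableSpace Ξ] {f : E n → Ξ → ℝ}
    (hd : ∀ s, ContDiff ℝ 1 fun x => f x s) (hm : ∀ x, Measurable (f x)) :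
    Measurable fun z : E n × Ξ => gradient (fun x => f x z.2) z.1 := by
  have hfd : ∀ (x v : E n), Measurable fun s => fderiv ℝ (fun x => f x s) x v := by
    intro x v
    refine measurable_of_tendsto_metrizable
      (f := fun (k : ℕ) s => (k : ℝ) • (f (x + (k : ℝ)⁻¹ • v) s - f x s))
      (fun k => ((hm _).sub (hm _)).const_smul (k : ℝ)) ?_
    rw [tendsto_pi_nhds]
    intro s
    exact ((((hd s).differentiable (by simp)) x).hasFDerivAt.lim_real v).comp
      tendsto_natCast_atTop_atTop
  have hx : ∀ x, Measurable fun s => gradient (fun x => f x s) x := by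
    intro x
    let b := EuclideanSpace.basisFun (Fin n) ℝ
    have : (fun s => gradient (fun x => f x s) x) =
        fun s => ∑ i, (fderiv ℝ (fun x => f x s) x (b i)) • b i := by
      ext1 s
      rw [← b.sum_repr' (gradient (fun x => f x s) x)]
      refine Finset.sum_congr rfl fun i _ => ?_
      rw [real_inner_comm, inner_gradient_left]
    rw [this]
    exact Finset.measurable_sum _ fun i _ => (hfd x (b i)).smul_const _
  refine measurable_uncurry_of_continuous_of_measurable
    (u := fun x s => gradient (fun x => f x s) x) (fun s => ?_) hx
  exact (LinearIsometryEquiv.continuous _).comp ((hd s).continuous_fderiv (by simp))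

variable {n m : ℕ} {Ω Ξ : Type*} [MeasurableSpace Ξ]

namespace Standing

variable {S : Trajectory n m Ω Ξ} {Pb : Problem n m Ξ} {prm : Params n m} {LF Lg : ℝ≥0}
  {σ Lt cν cγ p q Lp ζ : ℝ}

section

variable {Ω' : Type*} [MeasurableSpace Ω']

theorem continuousOn_proj (h : Standing Pb prm LF Lg σ Lt cν cγ p q Lp ζ) :
    ContinuousOn (proj Pb.M) Pb.M := by
  refine (LipschitzOnWith.of_dist_le_mul (K := ⟨Lp, h.geom.Lp_nonneg⟩)
    fun x hx z hz => ?_).continuousOn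
  rw [dist_eq_norm, dist_eq_norm]
  refine ContinuousLinearMap.opNorm_le_bound _ (mul_nonneg h.geom.Lp_nonneg (norm_nonneg _))
    fun w => ?_
  refine (h.geom.proj_lip x hx z hz w).trans (le_of_eq ?_)
  change Lp * ‖w‖ * ‖x - z‖ = Lp * ‖x - z‖ * ‖w‖
  ring

theorem measurable_proj (h : Standing Pb prm LF Lg σ Lt cν cγ p q Lp ζ) {X W : Ω' → E n}
    (hX : Measurable X) (hW : Measurable W) (hmem : ∀ ω, X ω ∈ Pb.M) :
    Measurable fun ω => proj Pb.M (X ω) (W ω) := by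
  have hc : ContinuousOn (fun z : E n × E n => proj Pb.M z.1 z.2) (Pb.M ×ˢ univ) :=
    (h.continuousOn_proj.comp continuousOn_fst fun z hz => hz.1).clm_apply continuousOn_snd
  exact measurable_comp_of_continuousOn (Z := fun ω => (X ω, W ω)) hc (hX.prodMk hW)
    fun ω => ⟨hmem ω, mem_univ _⟩

theorem continuousOn_gradF (h : Standing Pb prm LF Lg σ Lt cν cγ p q Lp ζ) :
    ContinuousOn Pb.gradF Pb.M :=
  h.continuousOn_proj.clm_apply h.continuousOn_gradient

theorem measurable_gradF (h : Standing Pb prm LF Lg σ Lt cν cγ p q Lp ζ) {X : Ω' → E n}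
    (hX : Measurable X) (hmem : ∀ ω, X ω ∈ Pb.M) : Measurable fun ω => Pb.gradF (X ω) :=
  measurable_comp_of_continuousOn h.continuousOn_gradF hX hmem

theorem measurable_gradf (h : Standing Pb prm LF Lg σ Lt cν cγ p q Lp ζ) {X : Ω' → E n}
    {s : Ω' → Ξ} (hX : Measurable X) (hs : Measurable s) (hmem : ∀ ω, X ω ∈ Pb.M) :
    Measurable fun ω => Pb.gradf (X ω) (s ω) :=
  h.measurable_proj hX
    ((measurable_gradient h.set.f_diff h.set.f_meas).comp (hX.prodMk hs)) hmem

theorem measurable_R (h : Standing Pb prm LF Lg σ Lt cν cγ p q Lp ζ) {X U : Ω' → E n}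
    (hX : Measurable X) (hU : Measurable U) (hmem : ∀ ω, X ω ∈ Pb.M)
    (hU' : ∀ ω, U ω ∈ tangentSpace Pb.M (X ω)) : Measurable fun ω => Pb.R (X ω) (U ω) :=
  measurable_comp_of_continuousOn (Z := fun ω => (X ω, U ω))
    h.set.retraction.smooth.continuousOn (hX.prodMk hU)
    fun ω => ⟨hmem ω, hU' ω⟩

theorem measurable_T (h : Standing Pb prm LF Lg σ Lt cν cγ p q Lp ζ) {X U V : Ω' → E n}
    (hX : Measurable X) (hU : Measurable U) (hV : Measurable V) (hmem : ∀ ω, X ω ∈ Pb.M)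
    (hU' : ∀ ω, U ω ∈ tangentSpace Pb.M (X ω)) (hV' : ∀ ω, V ω ∈ tangentSpace Pb.M (X ω)) :
    Measurable fun ω => Pb.T (X ω) (U ω) (V ω) :=
  measurable_comp_of_continuousOn (Z := fun ω => (X ω, U ω, V ω))
    h.set.transport.smooth.continuousOn (hX.prodMk (hU.prodMk hV))
    fun ω => ⟨hmem ω, hU' ω, hV' ω⟩

end

variable [MeasurableSpace Ω]

theorem measurable_batchGrad (h : Standing Pb prm LF Lg σ Lt cν cγ p q Lp ζ) {k : ℕ}
    (hξ : ∀ i, Measurable (S.ξ k i)) {X : Ω → E n} (hX : Measurable X) (hmem : ∀ ω, X ω ∈ Pb.M) :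
    Measurable fun ω => S.batchGrad Pb k ω (X ω) :=
  (Finset.measurable_sum _ fun i _ => h.measurable_gradf hX (hξ i) hmem).const_smul
    (S.b k : ℝ)⁻¹

theorem measurable_y_succ (h : Standing Pb prm LF Lg σ Lt cν cγ p q Lp ζ) (hS : S.IsRun Pb prm)
    {k : ℕ} (hk : 1 ≤ k) (hx : Measurable (S.x k)) (hlam : Measurable (S.lam k)) :
    Measurable (S.y (k + 1)) :=
  measurable_of_dist_le (c := fun ω => Pb.A (S.x k ω) - (prm.ρ k)⁻¹ • S.lam k ω)
    ((Pb.A.measurable.comp hx).sub (hlam.const_smul (prm.ρ k)⁻¹)) fun ω ω' =>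
    dist_le_of_mem_subdiff (one_pos.trans_le (h.one_le_ρ hk)) (h.subgradient_mem hS hk ω)
      (h.subgradient_mem hS hk ω')

theorem measurable_G (h : Standing Pb prm LF Lg σ Lt cν cγ p q Lp ζ) (hS : S.IsRun Pb prm)
    {k : ℕ} (hk : 1 ≤ k) (hx : Measurable (S.x k)) (hlam : Measurable (S.lam k))
    (hv : Measurable (S.v k)) : Measurable (S.G Pb prm k) :=
  hv.add (h.measurable_proj hx ((Pb.At.measurable.comp (((Pb.A.measurable.comp hx).sub
    (h.measurable_y_succ hS hk hx hlam)).sub (hlam.const_smul (prm.ρ k)⁻¹))).const_smul (prm.ρ k))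
    (h.x_mem hS hk))

theorem measurable_step (h : Standing Pb prm LF Lg σ Lt cν cγ p q Lp ζ) (hS : S.IsRun Pb prm)
    {k : ℕ} (hk : 1 ≤ k) (hx : Measurable (S.x k)) (hlam : Measurable (S.lam k))
    (hv : Measurable (S.v k)) : Measurable (S.step Pb prm k) :=
  ((h.measurable_G hS hk hx hlam hv).const_smul (prm.η k)).neg

theorem measurable_betaSucc {k : ℕ} (hx : Measurable (S.x (k + 1)))
    (hy : Measurable (S.y (k + 1))) : Measurable (S.betaSucc Pb prm k) := by
  have hr : Measurable fun ω => ‖Pb.A (S.x (k + 1) ω) - S.y (k + 1) ω‖ :=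
    ((Pb.A.measurable.comp hx).sub hy).norm
  unfold Trajectory.betaSucc
  refine Measurable.ite (hr (measurableSet_singleton 0)) measurable_const ?_
  exact (measurable_const.div ((hr.mul_const _).mul_const _)).min measurable_const

/-- The iterates with index `k` are measurable functions of the first `k` batches. -/
theorem measurable_iterates (h : Standing Pb prm LF Lg σ Lt cν cγ p q Lp ζ) (hS : S.IsRun Pb prm)
    {k : ℕ} (hk : 1 ≤ k) (hξ : ∀ j ≤ k, ∀ i, Measurable (S.ξ j i)) :
    Measurable (S.x k) ∧ Measurable (S.lam k) ∧ Measurable (S.v k) := by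
  induction k, hk using Nat.le_induction with
  | base =>
    rw [funext hS.x_one, funext hS.lam_one, funext hS.v_one]
    exact ⟨measurable_const, measurable_const,
      h.measurable_batchGrad (X := fun _ => prm.x₁) (hξ 1 le_rfl) measurable_const
        fun _ => h.adm.x₁_mem⟩
  | succ k hk ih =>
    obtain ⟨hx, hlam, hv⟩ := ih fun j hj => hξ j (by omega)
    have hst := h.measurable_step hS hk hx hlam hv
    have hy := h.measurable_y_succ hS hk hx hlam
    have hx' : Measurable (S.x (k + 1)) := by
      rw [funext (hS.x_succ k hk)]
      exact h.measurable_R hx hst (h.x_mem hS hk) (h.step_mem hS hk)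
    refine ⟨hx', ?_, ?_⟩
    · rw [funext (hS.lam_succ k hk)]
      have hβ : Measurable (S.β (k + 1)) := by
        rw [funext (hS.beta_succ k hk)]
        exact measurable_betaSucc hx' hy
      exact hlam.sub (hβ.smul ((Pb.A.measurable.comp hx').sub hy))
    · rw [funext (hS.v_succ k hk)]
      refine (h.measurable_batchGrad (hξ _ le_rfl) hx' (h.x_mem hS (by omega))).add
        (Measurable.const_smul (h.measurable_T hx hst (hv.sub (h.measurable_batchGrad
          (hξ _ le_rfl) hx (h.x_mem hS hk))) (h.x_mem hS hk) (h.step_mem hS hk) fun ω => ?_) (1 - prm.αSucc k))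
      exact Submodule.sub_mem _ (h.x_mem_and_v_mem hS hk ω).2 (batchGrad_mem _ _ _)

theorem measurable_y (h : Standing Pb prm LF Lg σ Lt cν cγ p q Lp ζ) (hS : S.IsRun Pb prm)
    {k : ℕ} (hk : 1 ≤ k) (hξ : ∀ j i, Measurable (S.ξ j i)) : Measurable (S.y k) := by
  obtain rfl | ⟨j, hj, rfl⟩ : k = 1 ∨ ∃ j, 1 ≤ j ∧ k = j + 1 := by
    rcases hk.eq_or_lt with h1 | h1
    · exact Or.inl h1.symm
    · exact Or.inr ⟨k - 1, by omega, by omega⟩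
  · rw [funext hS.y_one]
    exact measurable_const
  · obtain ⟨hx, hlam, -⟩ := h.measurable_iterates hS hj fun j _ => hξ j
    exact h.measurable_y_succ hS hj hx hlam

end Standing

end MarsAdmm

namespace MarsAdmm

open Set Metric Filter Topology

/-! ### Second moments -/

section Moments

variable {n : ℕ} {Ω Ξ Z : Type*} [MeasurableSpace Ω] [MeasurableSpace Ξ] [MeasurableSpace Z]
  {μ : Measure Ω} {P : Measure Ξ}

/-- Centring does not increase the second moment. This lets the mean-squared Lipschitz assumption,
which is about uncentred differences, bound centred noise. -/
theorem integral_norm_sub_integral_sq_le [IsProbabilityMeasure P] {W : Ξ → E n}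
    (hW : MemLp W 2 P) :
    Integrable (fun s => ‖W s - ∫ s, W s ∂P‖ ^ 2) P ∧
      ∫ s, ‖W s - ∫ s, W s ∂P‖ ^ 2 ∂P ≤ ∫ s, ‖W s‖ ^ 2 ∂P := by
  have hWi : Integrable W P := hW.integrable (by norm_num)
  set c := ∫ s, W s ∂P
  have hin : Integrable (fun s => inner ℝ c (W s)) P := hWi.const_inner c
  have hsq : Integrable (fun s => ‖W s‖ ^ 2) P := hW.integrable_norm_pow (by norm_num)
  have heq : (fun s => ‖W s - c‖ ^ 2) = fun s => ‖W s‖ ^ 2 - 2 * inner ℝ c (W s) + ‖c‖ ^ 2 := by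
    ext s
    rw [norm_sub_sq_real, real_inner_comm]
  have hsub : Integrable (fun s => ‖W s‖ ^ 2 - 2 * inner ℝ c (W s)) P :=
    hsq.sub (hin.const_mul 2)
  rw [heq]
  refine ⟨hsub.add (integrable_const _), ?_⟩
  rw [integral_add hsub (integrable_const _),
    integral_sub hsq (hin.const_mul 2), integral_const_mul, integral_inner hWi]
  simp only [integral_const, probReal_univ, one_smul]
  rw [real_inner_self_eq_norm_sq]
  nlinarith [sq_nonneg ‖c‖]

theorem norm_add_sq_le (u w : E n) : ‖u + w‖ ^ 2 ≤ 2 * ‖u‖ ^ 2 + 2 * ‖w‖ ^ 2 := by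
  have := pow_le_pow_left₀ (norm_nonneg _) (norm_add_le u w) 2
  nlinarith [sq_nonneg (‖u‖ - ‖w‖)]

/-- Convexity of the squared norm is enough: no variance reduction by the batch size is claimed, so
each sample only has to be independent of the past. -/
theorem norm_mean_sq_le {b : ℕ} (X : Fin b → E n) :
    ‖(b : ℝ)⁻¹ • ∑ i, X i‖ ^ 2 ≤ (b : ℝ)⁻¹ * ∑ i, ‖X i‖ ^ 2 := by
  have h1 : ‖∑ i, X i‖ ^ 2 ≤ b * ∑ i, ‖X i‖ ^ 2 := by
    refine (pow_le_pow_left₀ (norm_nonneg _) (norm_sum_le _ _) 2).trans ?_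
    simpa using sq_sum_le_card_mul_sum_sq (s := Finset.univ) (f := fun i => ‖X i‖)
  rw [norm_smul, mul_pow, norm_inv, Real.norm_natCast]
  rcases Nat.eq_zero_or_pos b with rfl | hb
  · simp
  · have hb' : (0 : ℝ) < b := by exact_mod_cast hb
    calc _ ≤ (b : ℝ)⁻¹ ^ 2 * (b * ∑ i, ‖X i‖ ^ 2) := by gcongr
      _ = _ := by field_simp

variable [IsProbabilityMeasure μ]

theorem map_prodMk_eq {ζ : Ω → Z} {ξ : Ω → Ξ} (hζ : Measurable ζ) (hξ : Measurable ξ)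
    (hlaw : μ.map ξ = P) (hind : IndepFun ζ ξ μ) :
    μ.map (fun ω => (ζ ω, ξ ω)) = (μ.map ζ).prod P := by
  rw [(indepFun_iff_map_prod_eq_prod_map_map hζ.aemeasurable hξ.aemeasurable).1 hind, hlaw]

variable [IsProbabilityMeasure P]

/-- The second moment of a function of two independent variables. -/
theorem integral_norm_sq_le_of_indep {ζ : Ω → Z} {ξ : Ω → Ξ} (hζ : Measurable ζ)
    (hξ : Measurable ξ) (hlaw : μ.map ξ = P) (hind : IndepFun ζ ξ μ) {D : Z × Ξ → E n}
    (hD : Measurable D) (hD2 : ∀ z, Integrable (fun s => ‖D (z, s)‖ ^ 2) P) {V : Z → ℝ}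
    (hVm : Measurable V) (hV : ∀ z, ∫ s, ‖D (z, s)‖ ^ 2 ∂P ≤ V z)
    (hVi : Integrable (fun ω => V (ζ ω)) μ) :
    Integrable (fun ω => ‖D (ζ ω, ξ ω)‖ ^ 2) μ ∧
      ∫ ω, ‖D (ζ ω, ξ ω)‖ ^ 2 ∂μ ≤ ∫ ω, V (ζ ω) ∂μ := by
  have hmap := map_prodMk_eq hζ hξ hlaw hind
  have hm : Measurable fun w : Z × Ξ => ‖D w‖ ^ 2 := hD.norm.pow_const 2
  have : IsProbabilityMeasure (μ.map ζ) := Measure.isProbabilityMeasure_map hζ.aemeasurable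
  have hVi' : Integrable V (μ.map ζ) :=
    (integrable_map_measure hVm.aestronglyMeasurable hζ.aemeasurable).2 hVi
  have hmi : StronglyMeasurable fun z => ∫ s, ‖D (z, s)‖ ^ 2 ∂P :=
    hm.stronglyMeasurable.integral_prod_right
  have hI : Integrable (fun z => ∫ s, ‖D (z, s)‖ ^ 2 ∂P) (μ.map ζ) := by
    refine hVi'.mono' hmi.aestronglyMeasurable (Eventually.of_forall fun z => ?_)
    rw [Real.norm_of_nonneg (integral_nonneg fun _ => by positivity)]
    exact hV z
  have hprod : Integrable (fun w : Z × Ξ => ‖D w‖ ^ 2) ((μ.map ζ).prod P) := by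
    refine (integrable_prod_iff hm.aestronglyMeasurable).2 ⟨Eventually.of_forall hD2, ?_⟩
    simpa using hI
  have hpair : Measurable fun ω => (ζ ω, ξ ω) := hζ.prodMk hξ
  constructor
  · rw [← hmap] at hprod
    exact (integrable_map_measure hm.aestronglyMeasurable hpair.aemeasurable).1 hprod
  · calc ∫ ω, ‖D (ζ ω, ξ ω)‖ ^ 2 ∂μ = ∫ w, ‖D w‖ ^ 2 ∂((μ.map ζ).prod P) := by
          rw [← hmap, integral_map hpair.aemeasurable hm.aestronglyMeasurable]
      _ = ∫ z, ∫ s, ‖D (z, s)‖ ^ 2 ∂P ∂(μ.map ζ) := integral_prod _ hprod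
      _ ≤ ∫ z, V z ∂(μ.map ζ) := integral_mono hI hVi' hV
      _ = ∫ ω, V (ζ ω) ∂μ := integral_map hζ.aemeasurable hVm.aestronglyMeasurable

/-- Noise that is centred given an independent variable is orthogonal to functions of it. -/
theorem integral_inner_eq_zero_of_indep {ζ : Ω → Z} {ξ : Ω → Ξ} (hζ : Measurable ζ)
    (hξ : Measurable ξ) (hlaw : μ.map ξ = P) (hind : IndepFun ζ ξ μ) {D : Z × Ξ → E n}
    (hD : Measurable D) (hDi : ∀ z, Integrable (fun s => D (z, s)) P)
    (hmean : ∀ z, ∫ s, D (z, s) ∂P = 0) {a : Z → E n} (ha : Measurable a)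
    (ha2 : Integrable (fun ω => ‖a (ζ ω)‖ ^ 2) μ)
    (hD2 : Integrable (fun ω => ‖D (ζ ω, ξ ω)‖ ^ 2) μ) :
    Integrable (fun ω => inner ℝ (a (ζ ω)) (D (ζ ω, ξ ω))) μ ∧
      ∫ ω, inner ℝ (a (ζ ω)) (D (ζ ω, ξ ω)) ∂μ = 0 := by
  have hmap := map_prodMk_eq hζ hξ hlaw hind
  have hpair : Measurable fun ω => (ζ ω, ξ ω) := hζ.prodMk hξ
  have : IsProbabilityMeasure (μ.map ζ) := Measure.isProbabilityMeasure_map hζ.aemeasurable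
  have hm : Measurable fun w : Z × Ξ => inner ℝ (a w.1) (D w) :=
    (ha.comp measurable_fst).inner hD
  have hInt : Integrable (fun ω => inner ℝ (a (ζ ω)) (D (ζ ω, ξ ω))) μ := by
    refine (ha2.add hD2).mono' (hm.comp hpair).aestronglyMeasurable
      (Eventually.of_forall fun ω => ?_)
    refine (norm_inner_le_norm _ _).trans ?_
    simp only [Pi.add_apply]
    nlinarith [sq_nonneg (‖a (ζ ω)‖ - ‖D (ζ ω, ξ ω)‖), sq_nonneg ‖a (ζ ω)‖,
      sq_nonneg ‖D (ζ ω, ξ ω)‖]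
  refine ⟨hInt, ?_⟩
  have hprod : Integrable (fun w : Z × Ξ => inner ℝ (a w.1) (D w)) ((μ.map ζ).prod P) := by
    rw [← hmap]
    exact (integrable_map_measure hm.aestronglyMeasurable hpair.aemeasurable).2 hInt
  calc ∫ ω, inner ℝ (a (ζ ω)) (D (ζ ω, ξ ω)) ∂μ
      = ∫ w : Z × Ξ, inner ℝ (a w.1) (D w) ∂((μ.map ζ).prod P) := by
        rw [← hmap, integral_map hpair.aemeasurable hm.aestronglyMeasurable]
    _ = ∫ z, ∫ s, inner ℝ (a z) (D (z, s)) ∂P ∂(μ.map ζ) := integral_prod _ hprod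
    _ = 0 := by
        have hz : ∀ z, ∫ s, inner ℝ (a z) (D (z, s)) ∂P = 0 := fun z => by
          rw [integral_inner (hDi z), hmean, inner_zero_right]
        simp [hz]

/-- The second moment of a predictable term plus a batch average of centred noise. -/
theorem integral_norm_add_mean_sq_le {ζ : Ω → Z} {b : ℕ} (hb : 1 ≤ b) {ξ : Fin b → Ω → Ξ}
    (hζ : Measurable ζ) (hξ : ∀ i, Measurable (ξ i)) (hlaw : ∀ i, μ.map (ξ i) = P)
    (hind : ∀ i, IndepFun ζ (ξ i) μ) {D : Z × Ξ → E n} (hD : Measurable D)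
    (hDi : ∀ z, Integrable (fun s => D (z, s)) P)
    (hD2 : ∀ z, Integrable (fun s => ‖D (z, s)‖ ^ 2) P)
    (hmean : ∀ z, ∫ s, D (z, s) ∂P = 0) {V : Z → ℝ} (hVm : Measurable V)
    (hV : ∀ z, ∫ s, ‖D (z, s)‖ ^ 2 ∂P ≤ V z) (hVi : Integrable (fun ω => V (ζ ω)) μ)
    {a : Z → E n} (ha : Measurable a) (ha2 : Integrable (fun ω => ‖a (ζ ω)‖ ^ 2) μ) :
    Integrable (fun ω => ‖a (ζ ω) + (b : ℝ)⁻¹ • ∑ i, D (ζ ω, ξ i ω)‖ ^ 2) μ ∧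
      ∫ ω, ‖a (ζ ω) + (b : ℝ)⁻¹ • ∑ i, D (ζ ω, ξ i ω)‖ ^ 2 ∂μ ≤
        ∫ ω, ‖a (ζ ω)‖ ^ 2 ∂μ + ∫ ω, V (ζ ω) ∂μ := by
  have h1 := fun i => integral_norm_sq_le_of_indep hζ (hξ i) (hlaw i) (hind i) hD hD2 hVm hV hVi
  have h2 := fun i => integral_inner_eq_zero_of_indep hζ (hξ i) (hlaw i) (hind i) hD hDi hmean ha
    ha2 (h1 i).1
  have hb0 : (b : ℝ) ≠ 0 := by
    have : b ≠ 0 := by omega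
    exact_mod_cast this
  have hpt : ∀ ω, ‖a (ζ ω) + (b : ℝ)⁻¹ • ∑ i, D (ζ ω, ξ i ω)‖ ^ 2 ≤ ‖a (ζ ω)‖ ^ 2 +
      (b : ℝ)⁻¹ * ∑ i, (2 * inner ℝ (a (ζ ω)) (D (ζ ω, ξ i ω)) + ‖D (ζ ω, ξ i ω)‖ ^ 2) := by
    intro ω
    rw [norm_add_sq_real, real_inner_smul_right, inner_sum, Finset.sum_add_distrib,
      ← Finset.mul_sum]
    have := norm_mean_sq_le fun i => D (ζ ω, ξ i ω)
    linarith
  have hi : ∀ i, Integrable (fun ω => 2 * inner ℝ (a (ζ ω)) (D (ζ ω, ξ i ω))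
      + ‖D (ζ ω, ξ i ω)‖ ^ 2) μ := fun i => ((h2 i).1.const_mul 2).add (h1 i).1
  have hsum : Integrable (fun ω => (b : ℝ)⁻¹ * ∑ i, (2 * inner ℝ (a (ζ ω)) (D (ζ ω, ξ i ω))
      + ‖D (ζ ω, ξ i ω)‖ ^ 2)) μ := (integrable_finsetSum _ fun i _ => hi i).const_mul _
  have hbd := ha2.add hsum
  have hmeas : Measurable fun ω => ‖a (ζ ω) + (b : ℝ)⁻¹ • ∑ i, D (ζ ω, ξ i ω)‖ ^ 2 :=
    ((ha.comp hζ).add ((Finset.measurable_sum _ fun i _ =>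
      hD.comp (hζ.prodMk (hξ i))).const_smul (b : ℝ)⁻¹)).norm.pow_const 2
  have hInt : Integrable (fun ω => ‖a (ζ ω) + (b : ℝ)⁻¹ • ∑ i, D (ζ ω, ξ i ω)‖ ^ 2) μ := by
    refine hbd.mono' hmeas.aestronglyMeasurable (Eventually.of_forall fun ω => ?_)
    rw [Real.norm_of_nonneg (by positivity)]
    exact hpt ω
  refine ⟨hInt, (integral_mono hInt hbd hpt).trans ?_⟩
  simp only [Pi.add_apply]
  rw [integral_add ha2 hsum, integral_const_mul, integral_finsetSum _ fun i _ => hi i]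
  gcongr
  have hle : ∑ i, ∫ ω, (2 * inner ℝ (a (ζ ω)) (D (ζ ω, ξ i ω)) + ‖D (ζ ω, ξ i ω)‖ ^ 2) ∂μ ≤
      ∑ _i : Fin b, ∫ ω, V (ζ ω) ∂μ := by
    refine Finset.sum_le_sum fun i _ => ?_
    rw [integral_add ((h2 i).1.const_mul 2) (h1 i).1, integral_const_mul, (h2 i).2]
    linarith [(h1 i).2]
  calc _ ≤ (b : ℝ)⁻¹ * ∑ _i : Fin b, ∫ ω, V (ζ ω) ∂μ := by gcongr
    _ = _ := by simp [hb0]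

end Moments

end MarsAdmm

/-! ### The estimation error: noise, independence and the variance recursion -/

namespace MarsAdmm

open Set Metric Filter Topology

variable {n m : ℕ} {Ω Ξ : Type*} [MeasurableSpace Ξ]

/-- A vector transport acts on a tangent space as a continuous linear map. -/
theorem IsIsometricTransport.exists_clm {M : Set (E n)} {R : E n → E n → E n}
    {T : E n → E n → E n → E n} (hT : IsIsometricTransport M R T) {x w : E n} (hx : x ∈ M)
    (hw : w ∈ tangentSpace M x) :
    ∃ L : E n →L[ℝ] E n, ∀ u ∈ tangentSpace M x, T x w u = L u := by
  let L₀ : E n →ₗ[ℝ] E n :=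
    { toFun := fun u => T x w (proj M x u)
      map_add' := fun u u' => by
        simpa using hT.linear x hx w hw _ (proj_mem x u) _ (proj_mem x u') 1 1
      map_smul' := fun a u => by
        simpa using hT.map_smul hx hw (proj_mem x u) a }
  refine ⟨LinearMap.toContinuousLinearMap L₀, fun u hu => ?_⟩
  change T x w u = T x w (proj M x u)
  rw [proj_eq_self hu]

/-- The noise that one sample `s` adds to the gradient estimator, at base point `x` and with
tangent step `w`. -/
noncomputable def Problem.noise (Pb : Problem n m Ξ) (α : ℝ) (x w : E n) (s : Ξ) : E n :=
  (Pb.gradf (Pb.R x w) s - Pb.gradF (Pb.R x w))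
    - (1 - α) • Pb.T x w (Pb.gradf x s - Pb.gradF x)

theorem Problem.gradf_sub_gradF_mem (Pb : Problem n m Ξ) (x : E n) (s : Ξ) :
    Pb.gradf x s - Pb.gradF x ∈ tangentSpace Pb.M x :=
  Submodule.sub_mem _ (proj_mem _ _) (proj_mem _ _)

namespace Standing

variable {S : Trajectory n m Ω Ξ} {Pb : Problem n m Ξ} {prm : Params n m} {LF Lg : ℝ≥0}
  {σ Lt cν cγ p q Lp ζ : ℝ}

/-- The noise is `α` times the centred gradient at the new point plus `α - 1` times a centred
gradient difference. The first part is small because `α` is, the second because the step `w` is. -/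
theorem noise_props (h : Standing Pb prm LF Lg σ Lt cν cγ p q Lp ζ) (α : ℝ) {x w : E n}
    (hx : x ∈ Pb.M) (hw : w ∈ tangentSpace Pb.M x) :
    Integrable (Pb.noise α x w) Pb.P ∧ Integrable (fun s => ‖Pb.noise α x w s‖ ^ 2) Pb.P ∧
    ∫ s, Pb.noise α x w s ∂Pb.P = 0 ∧
    ∫ s, ‖Pb.noise α x w s‖ ^ 2 ∂Pb.P ≤
      2 * α ^ 2 * σ ^ 2 + 2 * (1 - α) ^ 2 * Lt ^ 2 * ‖w‖ ^ 2 := by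
  have := h.set.isProb
  obtain ⟨L, hL⟩ := h.set.transport.exists_clm hx hw
  have hx' : Pb.R x w ∈ Pb.M := h.set.retraction.mapsTo x hx w hw
  have hX := h.var.memLp x hx
  have hY := h.var.memLp _ hx'
  have hXi : Integrable (Pb.gradf x) Pb.P := hX.integrable (by norm_num)
  have hYi : Integrable (Pb.gradf (Pb.R x w)) Pb.P := hY.integrable (by norm_num)
  have hXm := h.var.unbiased x hx
  have hYm := h.var.unbiased _ hx'
  have hLX : ∀ s, Pb.T x w (Pb.gradf x s) = L (Pb.gradf x s) := fun s => hL _ (proj_mem _ _)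
  let W : Ξ → E n := fun s => L (Pb.gradf x s) - Pb.gradf (Pb.R x w) s
  have hLXm : MemLp (fun s => L (Pb.gradf x s)) 2 Pb.P := L.comp_memLp' hX
  have hW : MemLp W 2 Pb.P := hLXm.sub hY
  have hLi : Integrable (fun s => L (Pb.gradf x s)) Pb.P := L.integrable_comp hXi
  have hWm : ∫ s, W s ∂Pb.P = L (Pb.gradF x) - Pb.gradF (Pb.R x w) := by
    rw [integral_sub hLi hYi, L.integral_comp_comm hXi, hXm, hYm]
  -- `W` is the transported difference of stochastic gradients, the quantity that the mean-squared
  -- Lipschitz assumption controls.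
  have hnoise : Pb.noise α x w = fun s => α • (Pb.gradf (Pb.R x w) s - Pb.gradF (Pb.R x w))
      + (α - 1) • (W s - ∫ s, W s ∂Pb.P) := by
    ext1 s
    rw [hWm, Problem.noise, hL _ (Pb.gradf_sub_gradF_mem _ _), map_sub]
    simp only [W]
    module
  have hA : MemLp (fun s => Pb.gradf (Pb.R x w) s - Pb.gradF (Pb.R x w)) 2 Pb.P :=
    hY.sub (memLp_const _)
  have hB : MemLp (fun s => W s - ∫ s, W s ∂Pb.P) 2 Pb.P := hW.sub (memLp_const _)
  have hN : MemLp (Pb.noise α x w) 2 Pb.P := by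
    rw [hnoise]
    exact (hA.const_smul α).add (hB.const_smul (α - 1))
  have hAi := hA.integrable (q := 2) (by norm_num)
  have hBi := hB.integrable (q := 2) (by norm_num)
  have hA2 : Integrable (fun s => ‖Pb.gradf (Pb.R x w) s - Pb.gradF (Pb.R x w)‖ ^ 2) Pb.P :=
    hA.integrable_norm_pow (by norm_num)
  have hN2 : Integrable (fun s => ‖Pb.noise α x w s‖ ^ 2) Pb.P :=
    hN.integrable_norm_pow (by norm_num)
  refine ⟨hN.integrable (by norm_num), hN2, ?_, ?_⟩
  · have hAi' : Integrable (fun s => α • (Pb.gradf (Pb.R x w) s - Pb.gradF (Pb.R x w))) Pb.P :=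
      hAi.smul α
    have hBi' : Integrable (fun s => (α - 1) • (W s - ∫ s, W s ∂Pb.P)) Pb.P := hBi.smul (α - 1)
    simp only [hnoise]
    rw [integral_add hAi' hBi', integral_smul, integral_smul,
      integral_sub hYi (integrable_const _),
      integral_sub (hW.integrable (by norm_num)) (integrable_const _), hYm]
    simp
  · obtain ⟨hWv, hWle⟩ := integral_norm_sub_integral_sq_le hW
    have hmsl : ∫ s, ‖W s‖ ^ 2 ∂Pb.P ≤ Lt ^ 2 * ‖w‖ ^ 2 := by
      have := h.msl x hx w hw
      simpa only [hLX] using this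
    have hvar := h.var.variance _ hx'
    have hpt : ∀ s, ‖Pb.noise α x w s‖ ^ 2 ≤
        2 * α ^ 2 * ‖Pb.gradf (Pb.R x w) s - Pb.gradF (Pb.R x w)‖ ^ 2
        + 2 * (1 - α) ^ 2 * ‖W s - ∫ s, W s ∂Pb.P‖ ^ 2 := by
      intro s
      rw [hnoise]
      refine (norm_add_sq_le _ _).trans (le_of_eq ?_)
      rw [norm_smul, norm_smul, mul_pow, mul_pow, Real.norm_eq_abs, Real.norm_eq_abs, sq_abs,
        sq_abs]
      ring
    refine (integral_mono hN2 ((hA2.const_mul _).add (hWv.const_mul _)) hpt).trans ?_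
    simp only [Pi.add_apply]
    rw [integral_add (hA2.const_mul _) (hWv.const_mul _), integral_const_mul, integral_const_mul]
    calc _ ≤ 2 * α ^ 2 * σ ^ 2 + 2 * (1 - α) ^ 2 * (Lt ^ 2 * ‖w‖ ^ 2) := by
          gcongr
          exact hWle.trans hmsl
      _ = _ := by ring

/-- The recursion for the estimation error. -/
theorem err_succ_eq (h : Standing Pb prm LF Lg σ Lt cν cγ p q Lp ζ) (hS : S.IsRun Pb prm)
    {k : ℕ} (hk : 1 ≤ k) (ω : Ω) :
    S.err Pb (k + 1) ω =
      (1 - prm.αSucc k) • Pb.T (S.x k ω) (S.step Pb prm k ω) (S.err Pb k ω)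
      + (S.b (k + 1) : ℝ)⁻¹ • ∑ i, Pb.noise (prm.αSucc k) (S.x k ω) (S.step Pb prm k ω)
          (S.ξ (k + 1) i ω) := by
  obtain ⟨L, hL⟩ := h.set.transport.exists_clm (h.x_mem hS hk ω) (h.step_mem hS hk ω)
  have hb : (S.b (k + 1) : ℝ) ≠ 0 := by
    have := hS.batch_pos (k + 1) (by omega)
    have : S.b (k + 1) ≠ 0 := by omega
    exact_mod_cast this
  have hn : ∀ i, Pb.noise (prm.αSucc k) (S.x k ω) (S.step Pb prm k ω) (S.ξ (k + 1) i ω) =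
      (Pb.gradf (S.x (k + 1) ω) (S.ξ (k + 1) i ω)
        - (1 - prm.αSucc k) • L (Pb.gradf (S.x k ω) (S.ξ (k + 1) i ω)))
      - (Pb.gradF (S.x (k + 1) ω) - (1 - prm.αSucc k) • L (Pb.gradF (S.x k ω))) := by
    intro i
    rw [Problem.noise, hL _ (Pb.gradf_sub_gradF_mem _ _),
      ← hS.x_succ k hk, map_sub]
    module
  have hm : S.v k ω - S.batchGrad Pb (k + 1) ω (S.x k ω) ∈ tangentSpace Pb.M (S.x k ω) :=
    Submodule.sub_mem _ (h.x_mem_and_v_mem hS hk ω).2 (batchGrad_mem _ _ _)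
  rw [hL _ (h.err_mem hS hk ω), Finset.sum_congr rfl fun i _ => hn i, Finset.sum_sub_distrib,
    Finset.sum_sub_distrib, Finset.sum_const, Finset.card_univ, Fintype.card_fin, smul_sub,
    smul_sub, ← Nat.cast_smul_eq_nsmul ℝ, inv_smul_smul₀ hb, ← Finset.smul_sum, ← map_sum,
    smul_comm _ (1 - prm.αSucc k)]
  rw [Trajectory.err, hS.v_succ k hk, hL _ hm, Trajectory.batchGrad, Trajectory.batchGrad,
    Trajectory.err, map_sub, map_sub, map_smul]
  module

/-- The supremum is the σ-algebra of all samples up to batch `k`. Used as the σ-algebra on `Ω`, it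
turns plain measurability of the iterates into measurability with respect to the past. -/
theorem measurable_past {k j : ℕ} (hj : j ≤ k) (i : Fin (S.b j)) :
    Measurable[⨆ j ∈ {j : Σ k : ℕ, Fin (S.b k) | j.1 ≤ k},
      MeasurableSpace.comap (S.ξ j.1 j.2) inferInstance] (S.ξ j i) := by
  rw [measurable_iff_comap_le]
  exact le_iSup₂_of_le (f := fun (j : Σ k : ℕ, Fin (S.b k)) (_ : j ∈ {j : Σ k : ℕ, Fin (S.b k) |
    j.1 ≤ k}) => MeasurableSpace.comap (S.ξ j.1 j.2) inferInstance) ⟨j, i⟩ hj le_rfl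

/-- The base point, the tangent step and the estimation error, as a point of `TM ⊕ TM`. -/
noncomputable def state (h : Standing Pb prm LF Lg σ Lt cν cγ p q Lp ζ) (hS : S.IsRun Pb prm)
    {k : ℕ} (hk : 1 ≤ k) (ω : Ω) : tangentSum Pb.M :=
  ⟨(S.x k ω, S.step Pb prm k ω, S.err Pb k ω),
    h.x_mem hS hk ω, h.step_mem hS hk ω, h.err_mem hS hk ω⟩

theorem measurable_state [MeasurableSpace Ω] (h : Standing Pb prm LF Lg σ Lt cν cγ p q Lp ζ)
    (hS : S.IsRun Pb prm) {k : ℕ} (hk : 1 ≤ k) (hξ : ∀ j ≤ k, ∀ i, Measurable (S.ξ j i)) :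
    Measurable (h.state hS hk) := by
  obtain ⟨hx, hlam, hv⟩ := h.measurable_iterates hS hk hξ
  exact Measurable.subtype_mk (hx.prodMk ((h.measurable_step hS hk hx hlam hv).prodMk
    (hv.sub (h.measurable_gradF hx (h.x_mem hS hk)))))

theorem measurable_noise (h : Standing Pb prm LF Lg σ Lt cν cγ p q Lp ζ) (α : ℝ) :
    Measurable fun w : tangentSum Pb.M × Ξ => Pb.noise α w.1.1.1 w.1.1.2.1 w.2 := by
  have h1 : Measurable fun w : tangentSum Pb.M × Ξ => w.1.1.1 :=
    measurable_fst.comp (measurable_subtype_coe.comp measurable_fst)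
  have h2 : Measurable fun w : tangentSum Pb.M × Ξ => w.1.1.2.1 :=
    (measurable_fst.comp measurable_snd).comp (measurable_subtype_coe.comp measurable_fst)
  have hR := h.measurable_R h1 h2 (fun w => w.1.2.1) (fun w => w.1.2.2.1)
  have hRm : ∀ w : tangentSum Pb.M × Ξ, Pb.R w.1.1.1 w.1.1.2.1 ∈ Pb.M := fun w =>
    h.set.retraction.mapsTo _ w.1.2.1 _ w.1.2.2.1
  refine ((h.measurable_gradf hR measurable_snd hRm).sub (h.measurable_gradF hR hRm)).sub
    ((h.measurable_T h1 h2 ((h.measurable_gradf h1 measurable_snd fun w => w.1.2.1).sub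
      (h.measurable_gradF h1 fun w => w.1.2.1)) (fun w => w.1.2.1) (fun w => w.1.2.2.1)
      fun w => ?_).const_smul (1 - α))
  exact Pb.gradf_sub_gradF_mem _ _

/-- Since `G_k` is `ε_k` plus a bounded vector, square integrability of `ε_k` passes to `G_k`, which
keeps the induction on integrability going. -/
theorem norm_G_sq_le (h : Standing Pb prm LF Lg σ Lt cν cγ p q Lp ζ) (hS : S.IsRun Pb prm)
    {k : ℕ} (hk : 1 ≤ k) (ω : Ω) :
    ‖S.G Pb prm k ω‖ ^ 2 ≤ 2 * ‖S.err Pb k ω‖ ^ 2 + 2 * (gradBound Pb + ‖Pb.A‖ * Lg) ^ 2 := by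
  have heq : S.G Pb prm k ω = S.err Pb k ω + proj Pb.M (S.x k ω)
      (Pb.lagGrad (prm.ρ k) (S.x k ω) (S.y (k + 1) ω) (S.lam k ω)) := by
    rw [h.proj_lagGrad hk]; abel
  rw [heq]
  refine (norm_add_sq_le _ _).trans ?_
  gcongr
  exact (norm_proj_le _ _).trans (h.norm_lagGrad_le hS hk ω)

variable [MeasurableSpace Ω] {μ : Measure Ω}

/-- Random variables determined by the first `k` batches are independent of the later samples. -/
theorem indepFun_of_measurable_past (hS : S.IsMarsAdmm Pb prm μ) {k : ℕ} {Z : Type*}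
    [mZ : MeasurableSpace Z] {X : Ω → Z}
    (hX : Measurable[⨆ j ∈ {j : Σ k : ℕ, Fin (S.b k) | j.1 ≤ k},
      MeasurableSpace.comap (S.ξ j.1 j.2) inferInstance] X) (i : Fin (S.b (k + 1))) :
    IndepFun X (S.ξ (k + 1) i) μ := by
  have hdis : Disjoint {j : Σ k : ℕ, Fin (S.b k) | j.1 ≤ k}
      {(⟨k + 1, i⟩ : Σ k : ℕ, Fin (S.b k))} := by
    rw [disjoint_singleton_right]
    simp
  have hind := indep_iSup_of_disjoint
    (m := fun j : Σ k : ℕ, Fin (S.b k) => MeasurableSpace.comap (S.ξ j.1 j.2) inferInstance)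
    (fun j => (hS.sample_meas j.1 j.2).comap_le) hS.sample_indep.iIndep hdis
  rw [IndepFun_iff_Indep]
  refine indep_of_indep_of_le_left (indep_of_indep_of_le_right hind ?_) hX.comap_le
  simp

theorem measurable_of_isMarsAdmm (h : Standing Pb prm LF Lg σ Lt cν cγ p q Lp ζ)
    (hS : S.IsMarsAdmm Pb prm μ) {k : ℕ} (hk : 1 ≤ k) :
    Measurable (S.x k) ∧ Measurable (S.lam k) ∧ Measurable (S.v k) ∧ Measurable (S.y k) ∧
      Measurable (S.G Pb prm k) ∧ Measurable (S.err Pb k) := by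
  obtain ⟨hx, hlam, hv⟩ := h.measurable_iterates hS.isRun hk fun j _ => hS.sample_meas j
  exact ⟨hx, hlam, hv, h.measurable_y hS.isRun hk hS.sample_meas,
    h.measurable_G hS.isRun hk hx hlam hv, hv.sub (h.measurable_gradF hx (h.x_mem hS.isRun hk))⟩

variable [IsProbabilityMeasure μ]

/-- The first estimator is a batch average without a past: the general moment bound is used with a
one-point past and zero predictable term. -/
theorem integrable_err_one (h : Standing Pb prm LF Lg σ Lt cν cγ p q Lp ζ)
    (hS : S.IsMarsAdmm Pb prm μ) :
    Integrable (fun ω => ‖S.err Pb 1 ω‖ ^ 2) μ ∧ ∫ ω, ‖S.err Pb 1 ω‖ ^ 2 ∂μ ≤ σ ^ 2 := by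
  have := h.set.isProb
  have hx := h.adm.x₁_mem
  have hM := h.var.memLp _ hx
  have hMi : Integrable (Pb.gradf prm.x₁) Pb.P := hM.integrable (by norm_num)
  have hD : MemLp (fun s => Pb.gradf prm.x₁ s - Pb.gradF prm.x₁) 2 Pb.P := hM.sub (memLp_const _)
  have hb : (S.b 1 : ℝ) ≠ 0 := by
    have := hS.batch_pos 1 le_rfl
    have : S.b 1 ≠ 0 := by omega
    exact_mod_cast this
  have heq : ∀ ω, S.err Pb 1 ω = 0 + (S.b 1 : ℝ)⁻¹ •
      ∑ i, (Pb.gradf prm.x₁ (S.ξ 1 i ω) - Pb.gradF prm.x₁) := by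
    intro ω
    rw [zero_add, Finset.sum_sub_distrib, smul_sub, Finset.sum_const, Finset.card_univ,
      Fintype.card_fin, ← Nat.cast_smul_eq_nsmul ℝ, inv_smul_smul₀ hb, Trajectory.err, hS.v_one,
      hS.x_one, Trajectory.batchGrad]
  have hmeas : Measurable fun w : Unit × Ξ => Pb.gradf prm.x₁ w.2 - Pb.gradF prm.x₁ :=
    (h.measurable_gradf measurable_const measurable_snd fun _ => hx).sub measurable_const
  have key := integral_norm_add_mean_sq_le (μ := μ) (P := Pb.P) (ζ := fun _ => ())
    (hS.batch_pos 1 le_rfl) measurable_const (hS.sample_meas 1) (hS.sample_law 1)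
    (fun i => indepFun_const_left () _)
    (D := fun w : Unit × Ξ => Pb.gradf prm.x₁ w.2 - Pb.gradF prm.x₁) hmeas
    (fun _ => hD.integrable (by norm_num)) (fun _ => hD.integrable_norm_pow (by norm_num))
    (fun _ => by
      rw [integral_sub hMi (integrable_const _), h.var.unbiased _ hx]
      simp) (V := fun _ => σ ^ 2) measurable_const (fun _ => h.var.variance _ hx)
    (integrable_const _) (a := fun _ => (0 : E n)) measurable_const (by simp)
  simp only [heq]
  refine ⟨key.1, key.2.trans ?_⟩
  simp

theorem integrable_G_of_err (h : Standing Pb prm LF Lg σ Lt cν cγ p q Lp ζ)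
    (hS : S.IsMarsAdmm Pb prm μ) {k : ℕ} (hk : 1 ≤ k)
    (he : Integrable (fun ω => ‖S.err Pb k ω‖ ^ 2) μ) :
    Integrable (fun ω => ‖S.G Pb prm k ω‖ ^ 2) μ := by
  have hG := (h.measurable_of_isMarsAdmm hS hk).2.2.2.2.1
  refine ((he.const_mul 2).add (integrable_const (2 * (gradBound Pb + ‖Pb.A‖ * Lg) ^ 2))).mono'
    (hG.norm.pow_const 2).aestronglyMeasurable (Eventually.of_forall fun ω => ?_)
  rw [Real.norm_of_nonneg (by positivity)]
  exact h.norm_G_sq_le hS.isRun hk ω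

/-- The recursive bound on the variance of the gradient estimator. -/
theorem integral_err_succ_le (h : Standing Pb prm LF Lg σ Lt cν cγ p q Lp ζ)
    (hS : S.IsMarsAdmm Pb prm μ) {k : ℕ} (hk : 1 ≤ k)
    (he : Integrable (fun ω => ‖S.err Pb k ω‖ ^ 2) μ) :
    Integrable (fun ω => ‖S.err Pb (k + 1) ω‖ ^ 2) μ ∧
    ∫ ω, ‖S.err Pb (k + 1) ω‖ ^ 2 ∂μ ≤ (1 - prm.αSucc k) ^ 2 * ∫ ω, ‖S.err Pb k ω‖ ^ 2 ∂μ
      + (2 * prm.αSucc k ^ 2 * σ ^ 2 + 2 * (1 - prm.αSucc k) ^ 2 * Lt ^ 2 * prm.η k ^ 2 *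
        ∫ ω, ‖S.G Pb prm k ω‖ ^ 2 ∂μ) := by
  have := h.set.isProb
  have hrun := hS.isRun
  have hGi := h.integrable_G_of_err hS hk he
  set α := prm.αSucc k
  have hstate := h.measurable_state hrun hk fun j _ => hS.sample_meas j
  have hTm : Measurable fun z : tangentSum Pb.M => Pb.T z.1.1 z.1.2.1 z.1.2.2 :=
    h.measurable_T (measurable_fst.comp measurable_subtype_coe)
      ((measurable_fst.comp measurable_snd).comp measurable_subtype_coe)
      ((measurable_snd.comp measurable_snd).comp measurable_subtype_coe)
      (fun z => z.2.1) (fun z => z.2.2.1) (fun z => z.2.2.2)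
  have ha : ∀ ω, ‖(1 - α) • Pb.T (h.state hrun hk ω).1.1 (h.state hrun hk ω).1.2.1
      (h.state hrun hk ω).1.2.2‖ ^ 2 = (1 - α) ^ 2 * ‖S.err Pb k ω‖ ^ 2 := by
    intro ω
    rw [norm_smul, h.set.transport.norm_map (h.state hrun hk ω).2.1 (h.state hrun hk ω).2.2.1
      (h.state hrun hk ω).2.2.2, mul_pow, Real.norm_eq_abs, sq_abs]
    rfl
  have hV : ∀ ω, 2 * α ^ 2 * σ ^ 2 + 2 * (1 - α) ^ 2 * Lt ^ 2 * ‖(h.state hrun hk ω).1.2.1‖ ^ 2 =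
      2 * α ^ 2 * σ ^ 2 + 2 * (1 - α) ^ 2 * Lt ^ 2 * prm.η k ^ 2 * ‖S.G Pb prm k ω‖ ^ 2 := by
    intro ω
    change 2 * α ^ 2 * σ ^ 2 + 2 * (1 - α) ^ 2 * Lt ^ 2 * ‖S.step Pb prm k ω‖ ^ 2 = _
    rw [h.norm_step hk]
    ring
  have hVi : Integrable (fun ω => 2 * α ^ 2 * σ ^ 2
      + 2 * (1 - α) ^ 2 * Lt ^ 2 * prm.η k ^ 2 * ‖S.G Pb prm k ω‖ ^ 2) μ :=
    (integrable_const _).add (hGi.const_mul _)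
  have key := integral_norm_add_mean_sq_le (μ := μ) (P := Pb.P) (ζ := h.state hrun hk)
    (hS.batch_pos (k + 1) (by omega)) hstate (hS.sample_meas (k + 1)) (hS.sample_law (k + 1))
    -- The instance left as a hole is the σ-algebra of the past, so the state is measurable with
    -- respect to batches up to `k` and independent of batch `k + 1`.
    (fun i => indepFun_of_measurable_past hS
      (@measurable_state _ _ _ _ _ _ _ _ _ _ _ _ _ _ _ _ _ _ (_) h hrun _ hk
        fun j hj i => measurable_past hj i) i)
    (D := fun w => Pb.noise α w.1.1.1 w.1.1.2.1 w.2) (h.measurable_noise α)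
    (fun z => (h.noise_props α z.2.1 z.2.2.1).1) (fun z => (h.noise_props α z.2.1 z.2.2.1).2.1)
    (fun z => (h.noise_props α z.2.1 z.2.2.1).2.2.1)
    (V := fun z => 2 * α ^ 2 * σ ^ 2 + 2 * (1 - α) ^ 2 * Lt ^ 2 * ‖z.1.2.1‖ ^ 2)
    (measurable_const.add ((((measurable_fst.comp measurable_snd).comp
      measurable_subtype_coe).norm.pow_const 2).const_mul _))
    (fun z => (h.noise_props α z.2.1 z.2.2.1).2.2.2)
    (by simpa only [hV] using hVi)
    (a := fun z => (1 - α) • Pb.T z.1.1 z.1.2.1 z.1.2.2) (hTm.const_smul (1 - α))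
    (by simpa only [ha] using he.const_mul _)
  simp only [ha, hV] at key
  have herr : ∀ ω, S.err Pb (k + 1) ω = (1 - α) • Pb.T (h.state hrun hk ω).1.1
      (h.state hrun hk ω).1.2.1 (h.state hrun hk ω).1.2.2 + (S.b (k + 1) : ℝ)⁻¹ •
      ∑ i, Pb.noise α (h.state hrun hk ω).1.1 (h.state hrun hk ω).1.2.1 (S.ξ (k + 1) i ω) :=
    h.err_succ_eq hrun hk
  simp only [herr]
  refine ⟨key.1, key.2.trans (le_of_eq ?_)⟩
  rw [integral_const_mul, integral_add (integrable_const _) (hGi.const_mul _), integral_const,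
    integral_const_mul]
  simp

theorem integrable_err (h : Standing Pb prm LF Lg σ Lt cν cγ p q Lp ζ)
    (hS : S.IsMarsAdmm Pb prm μ) {k : ℕ} (hk : 1 ≤ k) :
    Integrable (fun ω => ‖S.err Pb k ω‖ ^ 2) μ := by
  induction k, hk using Nat.le_induction with
  | base => exact (h.integrable_err_one hS).1
  | succ k hk ih => exact (h.integral_err_succ_le hS hk ih).1

theorem integrable_G (h : Standing Pb prm LF Lg σ Lt cν cγ p q Lp ζ)
    (hS : S.IsMarsAdmm Pb prm μ) {k : ℕ} (hk : 1 ≤ k) :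
    Integrable (fun ω => ‖S.G Pb prm k ω‖ ^ 2) μ :=
  h.integrable_G_of_err hS hk (h.integrable_err hS hk)

end Standing

end MarsAdmm

namespace MarsAdmm

open Set Metric Filter Topology

/-! ### Sums -/

theorem summable_constC₁ : Summable fun k : ℕ => ((k : ℝ) + 1) ^ (-(4 / 3) : ℝ) := by
  have h : Summable fun k : ℕ => (k : ℝ) ^ (-(4 / 3) : ℝ) :=
    Real.summable_nat_rpow.2 (by norm_num)
  simpa using (summable_nat_add_iff 1).2 h

/-- Comparison with the telescoping series of `1 / ln(k + 2) - 1 / ln(k + 3)`: the increment of the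
logarithm is at least `1 / (k + 3) ≥ 1 / (3 (k + 1))`, whence the factor 3. -/
theorem summable_constC₂ : Summable fun k : ℕ => ((k : ℝ) + 1)⁻¹ / Real.log ((k : ℝ) + 3) ^ 2 := by
  have hlog : ∀ k : ℕ, 0 < Real.log ((k : ℝ) + 2) := fun k =>
    Real.log_pos (by linarith [(Nat.cast_nonneg k : (0 : ℝ) ≤ k)])
  have hlog' : ∀ k : ℕ, 0 < Real.log ((k : ℝ) + 3) := fun k =>
    Real.log_pos (by linarith [(Nat.cast_nonneg k : (0 : ℝ) ≤ k)])
  have hterm : ∀ k : ℕ, ((k : ℝ) + 1)⁻¹ / Real.log ((k : ℝ) + 3) ^ 2 ≤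
      3 * ((Real.log ((k : ℝ) + 2))⁻¹ - (Real.log ((k + 1 : ℕ) + 2 : ℝ))⁻¹) := by
    intro k
    have hk : (0 : ℝ) ≤ k := Nat.cast_nonneg k
    have e : (((k + 1 : ℕ) : ℝ) + 2) = (k : ℝ) + 3 := by push_cast; ring
    rw [e]
    set a := Real.log ((k : ℝ) + 2)
    set b := Real.log ((k : ℝ) + 3)
    have ha : 0 < a := hlog k
    have hb : 0 < b := hlog' k
    have hab : a ≤ b := Real.log_le_log (by linarith) (by linarith)
    have hd : ((k : ℝ) + 3)⁻¹ ≤ b - a := by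
      have h1 := Real.one_sub_inv_le_log_of_pos
        (show 0 < ((k : ℝ) + 3) / ((k : ℝ) + 2) by positivity)
      rw [Real.log_div (by positivity) (by positivity)] at h1
      refine le_trans (le_of_eq ?_) h1
      field_simp
      ring
    have h3 : ((k : ℝ) + 1)⁻¹ ≤ 3 * ((k : ℝ) + 3)⁻¹ := by
      rw [← div_eq_mul_inv, inv_eq_one_div, div_le_div_iff₀ (by positivity) (by positivity)]
      linarith
    calc ((k : ℝ) + 1)⁻¹ / b ^ 2 ≤ 3 * (b - a) / (a * b) := by
          have : a * b ≤ b ^ 2 := by nlinarith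
          gcongr
          linarith
      _ = 3 * (a⁻¹ - b⁻¹) := by field_simp
  refine summable_of_sum_range_le (c := 3 * (Real.log 2)⁻¹) (fun k => by
    have := hlog' k
    positivity) fun N => ?_
  have htel : ∀ N : ℕ, ∑ k ∈ Finset.range N,
      3 * ((Real.log ((k : ℝ) + 2))⁻¹ - (Real.log ((k + 1 : ℕ) + 2 : ℝ))⁻¹) =
      3 * ((Real.log ((0 : ℕ) + 2 : ℝ))⁻¹ - (Real.log ((N : ℝ) + 2))⁻¹) := fun N => by
    rw [← Finset.mul_sum, Finset.sum_range_sub' (fun k : ℕ => (Real.log ((k : ℝ) + 2))⁻¹)]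
  refine (Finset.sum_le_sum fun k _ => hterm k).trans ?_
  rw [htel]
  have := inv_nonneg.2 (hlog N).le
  simp only [CharP.cast_eq_zero, zero_add]
  linarith

/-- Euler's constant is below `2/3`. The remaining `1/3` of the budget `1 + ln K` is spent on the
first iteration in `varianceWeight`. -/
theorem sum_inv_le (N : ℕ) :
    ∑ j ∈ Finset.range N, ((j : ℝ) + 1)⁻¹ ≤ Real.log ((N : ℝ) + 1) + 2 / 3 := by
  have h1 := (Real.eulerMascheroniSeq_lt_eulerMascheroniConstant N).trans
    Real.eulerMascheroniConstant_lt_two_thirds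
  rw [Real.eulerMascheroniSeq, harmonic] at h1
  push_cast at h1
  linarith

/-! ### The merit function -/

variable {n m : ℕ} {Ω Ξ : Type*} [MeasurableSpace Ξ]

namespace Standing

variable {S : Trajectory n m Ω Ξ} {Pb : Problem n m Ξ} {prm : Params n m} {LF Lg : ℝ≥0}
  {σ Lt cν cγ p q Lp ζ : ℝ}

theorem sum_residualTerm_le (h : Standing Pb prm LF Lg σ Lt cν cγ p q Lp ζ) (N : ℕ) :
    ∑ j ∈ Finset.range N, residualTerm Pb prm Lg (j + 1) ≤
      (constC₁ / (3 * prm.cρ) + 2 * prm.cβ * constC₂ / prm.cρ ^ 2) * (Lg + lamMax Pb prm) ^ 2 := by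
  have hc := h.cρ_pos
  have hcβ := h.adm.cβ_pos
  have h1 : ∑ j ∈ Finset.range N, ((j : ℝ) + 1) ^ (-(4 / 3) : ℝ) ≤ constC₁ :=
    summable_constC₁.sum_le_tsum _ fun j _ => by positivity
  have h2 : ∑ j ∈ Finset.range N, ((j : ℝ) + 1)⁻¹ / Real.log ((j : ℝ) + 3) ^ 2 ≤ constC₂ :=
    summable_constC₂.sum_le_tsum _ fun j _ => by positivity
  have heq : ∀ j : ℕ, residualTerm Pb prm Lg (j + 1) =
      (2 * prm.cβ / prm.cρ ^ 2 * (((j : ℝ) + 1)⁻¹ / Real.log ((j : ℝ) + 3) ^ 2)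
      + 1 / (3 * prm.cρ) * ((j : ℝ) + 1) ^ (-(4 / 3) : ℝ)) * (Lg + lamMax Pb prm) ^ 2 := by
    intro j
    have e := rpow_neg_div_three (j + 1) 4
    rw [residualTerm, ← e]
    push_cast
    rw [show (j : ℝ) + 1 + 2 = j + 3 by ring]
  rw [Finset.sum_congr rfl fun j _ => heq j, ← Finset.sum_mul, Finset.sum_add_distrib,
    ← Finset.mul_sum, ← Finset.mul_sum]
  calc _ ≤ (2 * prm.cβ / prm.cρ ^ 2 * constC₂ + 1 / (3 * prm.cρ) * constC₁)
        * (Lg + lamMax Pb prm) ^ 2 := by gcongr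
    _ = _ := by ring

/-- From `c_ρ c_η ≤ 1` and `8 ≤ c_ν c_γ ≤ c_ρ c_γ`. It makes the error term of the descent small
against the weights `γ_k`. -/
theorem cη_le (h : Standing Pb prm LF Lg σ Lt cν cγ p q Lp ζ) : prm.cη ≤ cγ / 8 := by
  have h1 := h.cρ_mul_cη_le_one
  have hη := h.adm.cη_pos
  have hγ := h.adm.cγ_pos
  have h2 : 8 ≤ prm.cρ * cγ := h.adm.cν_mul.trans (by gcongr; exact h.adm.cν_le)
  have h3 : 8 * prm.cη ≤ (prm.cρ * cγ) * prm.cη := by gcongr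
  have h4 : (prm.cρ * prm.cη) * cγ ≤ 1 * cγ := by gcongr
  linarith

/-- With `s` the cube root of `k - 1`, `(t - s)(t² + t s + s²) = 1`, and `s ≥ 1` makes the second
factor at least `3 t`; hence the requirement `2 ≤ k`. -/
theorem cbrt_sub_le {k : ℕ} (hk : 2 ≤ k) : cbrt k - cbrt (k - 1) ≤ 1 / (3 * cbrt k) := by
  have ht := one_le_cbrt (k := k) (by omega)
  have hs := one_le_cbrt (k := k - 1) (by omega)
  have h1 := cbrt_pow_three k
  have h2 := cbrt_pow_three (k - 1)
  rw [Nat.cast_sub (by omega)] at h2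
  push_cast at h2
  set t := cbrt k
  set s := cbrt (k - 1)
  have hfac : (t - s) * (t ^ 2 + t * s + s ^ 2) = 1 := by linear_combination h1 - h2
  have hpos : 0 < t ^ 2 + t * s + s ^ 2 := by positivity
  have hts : 0 ≤ t - s := by
    by_contra hneg
    nlinarith [mul_pos_of_neg_of_neg (not_le.1 hneg) (neg_neg_of_pos hpos)]
  rw [le_div_iff₀ (by positivity)]
  have : 3 * t ≤ t ^ 2 + t * s + s ^ 2 := by nlinarith [sq_nonneg (t - 1)]
  nlinarith

/-- The weight of the variance terms in the decrease of the merit function. -/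
noncomputable def varianceWeight (k : ℕ) : ℝ := (k : ℝ)⁻¹ + if k = 1 then 1 / 3 else 0

theorem sum_varianceWeight_le (N : ℕ) :
    ∑ j ∈ Finset.range N, varianceWeight (j + 1) ≤ 1 + Real.log ((N : ℝ) + 1) := by
  have h1 := sum_inv_le N
  have h2 : ∑ j ∈ Finset.range N, (if j = 0 then (1 / 3 : ℝ) else 0) ≤ 1 / 3 := by
    simp only [Finset.sum_ite_eq', Finset.mem_range]
    split_ifs <;> norm_num
  simp only [varianceWeight, Finset.sum_add_distrib, Nat.add_eq_right]
  push_cast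
  linarith

/-- The scalar inequality behind the decrease of the merit function. -/
theorem merit_arith (h : Standing Pb prm LF Lg σ Lt cν cγ p q Lp ζ) {k : ℕ} (hk : 1 ≤ k)
    {e g L L' e' r : ℝ} (he : 0 ≤ e) (hg : 0 ≤ g) (he1 : k = 1 → e ≤ σ ^ 2)
    (hL : L' ≤ L - prm.η k * (3 / 8 - 1 / (8 * cbrt k ^ 2)) * g + 2 * prm.η k * e + r)
    (he' : e' ≤ (1 - prm.αSucc k) ^ 2 * e + (2 * prm.αSucc k ^ 2 * σ ^ 2
      + 2 * (1 - prm.αSucc k) ^ 2 * Lt ^ 2 * prm.η k ^ 2 * g)) :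
    L' + cγ * cbrt k * e' ≤ L + cγ * cbrt (k - 1) * e
      - 1 / 8 * ((prm.cη * g + prm.cα * cγ * e) / cbrt k)
      + 2 * cγ * prm.cα ^ 2 * σ ^ 2 * varianceWeight k + r := by
  have ht := one_le_cbrt hk
  have ht0 := cbrt_pos hk
  have hkt := cbrt_pow_three k
  have hγ := h.adm.cγ_pos
  have hη := h.adm.cη_pos
  have hα1 := h.adm.cα_le
  have hα0 : (4 / 5 : ℝ) ≤ prm.cα := by have := h.adm.cα_ge; norm_num at this ⊢; exact this
  have hηγ := h.cη_le
  rw [prm.αSucc_eq, prm.η_eq] at he'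
  rw [prm.η_eq] at hL
  set t := cbrt k
  set a := prm.cα / t ^ 2 with hadef
  have ha0 : 0 ≤ a := by positivity
  have ha1 : a ≤ 1 := by
    rw [hadef, div_le_one (by positivity)]
    nlinarith
  have hsq : (1 - a) ^ 2 ≤ 1 - a := by nlinarith
  have hmul := mul_le_mul_of_nonneg_left he' (by positivity : 0 ≤ cγ * t)
  -- The drift of the estimator costs at most `1/4` of `η_k ‖G_k‖²`; here `c_γ ≤ c_ρ` meets the
  -- stepsize condition on `L̃`.
  have hLt : 2 * cγ * prm.cη * Lt ^ 2 ≤ 1 / 4 := by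
    have h1 := h.step.le_L
    have h2 : cγ * (prm.cη * Lt ^ 2) ≤ prm.cρ * (prm.cη * Lt ^ 2) := by
      gcongr
      exact h.adm.cγ_le
    linarith
  have hGterm : cγ * t * (2 * (1 - a) ^ 2 * Lt ^ 2 * (prm.cη / t) ^ 2 * g) ≤
      prm.cη / t * (1 / 4 * (1 - 4 / 5 / t ^ 2)) * g := by
    have e1 : cγ * t * (2 * (1 - a) ^ 2 * Lt ^ 2 * (prm.cη / t) ^ 2 * g) =
        prm.cη / t * (2 * cγ * prm.cη * Lt ^ 2 * (1 - a) ^ 2) * g := by field_simp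
    have e2 : 4 / 5 / t ^ 2 ≤ a := by rw [hadef]; gcongr
    rw [e1]
    gcongr
    linarith
  have hVterm : cγ * t * (2 * a ^ 2 * σ ^ 2) = 2 * cγ * prm.cα ^ 2 * σ ^ 2 * (k : ℝ)⁻¹ := by
    rw [← hkt, hadef]
    field_simp
  -- The leftover is `1/4 - 3/8 = -1/8`. At order `t⁻²`, the gain `1/5` from `c_α ≥ 4/5` exceeds the
  -- loss `1/8` from the penalty increment by `3/40`.
  have hGfin : prm.cη / t * (1 / 4 * (1 - 4 / 5 / t ^ 2)) * g
      - prm.cη / t * (3 / 8 - 1 / (8 * t ^ 2)) * g ≤ - (1 / 8 * (prm.cη / t * g)) := by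
    have : 0 ≤ prm.cη / t * g * (3 / 40 / t ^ 2) := by positivity
    have e : prm.cη / t * (1 / 4 * (1 - 4 / 5 / t ^ 2)) * g
      - prm.cη / t * (3 / 8 - 1 / (8 * t ^ 2)) * g + 1 / 8 * (prm.cη / t * g) =
      - (prm.cη / t * g * (3 / 40 / t ^ 2)) := by
      field_simp
      ring
    linarith
  have hηt : 2 * (prm.cη / t) ≤ cγ / (4 * t) := by
    have : 2 * (prm.cη / t) ≤ 2 * (cγ / 8 / t) := by gcongr
    refine this.trans (le_of_eq ?_)
    field_simp
    norm_num
  have hsplit : 1 / 8 * ((prm.cη * g + prm.cα * cγ * e) / t) =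
      1 / 8 * (prm.cη / t * g) + prm.cα * cγ / (8 * t) * e := by
    field_simp
  rw [hsplit, varianceWeight]
  rcases hk.eq_or_lt with h1 | h1
  · subst h1
    have ht1 : t = 1 := by
      have : t = (1 : ℝ) ^ (1 / 3 : ℝ) := by simp [t, cbrt]
      rw [this, Real.one_rpow]
    have hs0 : cbrt (1 - 1) = 0 := by
      simp [cbrt]
    have haα : a = prm.cα := by rw [hadef, ht1]; simp
    -- As `γ_1 = 0`, the first error has no weight to be paid from. It is charged to `σ²` instead,
    -- which is the extra `1/3` in `varianceWeight`.
    have hE : cγ * ((1 - prm.cα) ^ 2 + 1 / 4 + prm.cα / 8) * e ≤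
        2 * cγ * prm.cα ^ 2 * σ ^ 2 * (1 / 3) := by
      have h2 : (1 - prm.cα) ^ 2 + 1 / 4 + prm.cα / 8 ≤ 2 / 3 * prm.cα ^ 2 := by nlinarith
      calc _ ≤ cγ * (2 / 3 * prm.cα ^ 2) * σ ^ 2 := by
            gcongr
            exact he1 rfl
        _ = _ := by ring
    have hcoef : cγ * t * (1 - a) ^ 2 + 2 * (prm.cη / t) + prm.cα * cγ / (8 * t) ≤
        cγ * ((1 - prm.cα) ^ 2 + 1 / 4 + prm.cα / 8) := by
      rw [haα, ht1]
      linarith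
    have hcoef' := mul_le_mul_of_nonneg_right hcoef he
    rw [hs0, if_pos rfl]
    linarith
  · have hs := cbrt_sub_le (k := k) (by omega)
    -- The contraction yields `c_γ c_α / t`. It must cover the growth of `γ` (`1/3`), the descent
    -- error (`1/4`) and the retained progress (`c_α / 8`), which requires `c_α ≥ 2/3`.
    have hE : cγ * t * (1 - a) ^ 2 + 2 * (prm.cη / t) + prm.cα * cγ / (8 * t) ≤
        cγ * cbrt (k - 1) := by
      have h2 : cγ * t * (1 - a) ^ 2 ≤ cγ * t * (1 - a) := by gcongr
      have h3 : cγ * t * (1 - a) = cγ * t - cγ * prm.cα / t := by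
        rw [hadef]; field_simp
      have h4 : cγ * (t - cbrt (k - 1)) ≤ cγ * (1 / (3 * t)) := by gcongr
      have h5 : cγ * (1 / (3 * t)) + cγ / (4 * t) + prm.cα * cγ / (8 * t) ≤ cγ * prm.cα / t := by
        have : cγ * (1 / (3 * t)) + cγ / (4 * t) + prm.cα * cγ / (8 * t) =
            cγ * (7 / 12 + prm.cα / 8) / t := by field_simp; ring
        rw [this]
        gcongr
        linarith
      linarith
    have hEe := mul_le_mul_of_nonneg_right hE he
    rw [if_neg (by omega), add_zero]
    linarith

theorem continuous_augLag (h : Standing Pb prm LF Lg σ Lt cν cγ p q Lp ζ) (ρ : ℝ) :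
    Continuous fun z : E n × E m × E m => Pb.augLag ρ z.1 z.2.1 z.2.2 := by
  have hF := h.reg.F_diff.continuous
  have hg := h.reg.g_lip.continuous
  unfold Problem.augLag
  fun_prop

/-- Together with the bounds on `x` and `λ` this confines the iterates at a fixed index to a compact
set, where the continuous Lagrangian is bounded and thus integrable. -/
theorem exists_norm_y_le (h : Standing Pb prm LF Lg σ Lt cν cγ p q Lp ζ) (hS : S.IsRun Pb prm)
    {k : ℕ} (hk : 1 ≤ k) : ∃ r, ∀ ω, ‖S.y k ω‖ ≤ r := by
  obtain rfl | ⟨j, hj, rfl⟩ : k = 1 ∨ ∃ j, 1 ≤ j ∧ k = j + 1 := by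
    rcases hk.eq_or_lt with h1 | h1
    · exact Or.inl h1.symm
    · exact Or.inr ⟨k - 1, by omega, by omega⟩
  · exact ⟨‖prm.y₁‖, fun ω => by rw [hS.y_one]⟩
  · obtain ⟨C, hC⟩ := h.reg.compact.isBounded.exists_norm_le
    refine ⟨‖Pb.A‖ * C + (Lg + lamMax Pb prm + ‖Pb.A‖ * Metric.diam Pb.M), fun ω => ?_⟩
    have h1 : ‖Pb.A (S.x (j + 1) ω)‖ ≤ ‖Pb.A‖ * C :=
      (ContinuousLinearMap.le_opNorm _ _).trans (by
        gcongr
        exact hC _ (h.x_mem hS (by omega) ω))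
    calc ‖S.y (j + 1) ω‖ =
          ‖Pb.A (S.x (j + 1) ω) - (Pb.A (S.x (j + 1) ω) - S.y (j + 1) ω)‖ := by
          rw [sub_sub_cancel]
      _ ≤ _ := (norm_sub_le _ _).trans (add_le_add h1 (h.norm_feas_succ_le_diam hS hj ω))

variable [MeasurableSpace Ω] {μ : Measure Ω} [IsProbabilityMeasure μ]

theorem integrable_augLag (h : Standing Pb prm LF Lg σ Lt cν cγ p q Lp ζ)
    (hS : S.IsMarsAdmm Pb prm μ) {k : ℕ} (hk : 1 ≤ k) :
    Integrable (fun ω => Pb.augLag (prm.ρ k) (S.x k ω) (S.y k ω) (S.lam k ω)) μ := by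
  obtain ⟨hx, hlam, -, hy, -, -⟩ := h.measurable_of_isMarsAdmm hS hk
  obtain ⟨r, hr⟩ := h.exists_norm_y_le hS.isRun hk
  have hK : IsCompact (Pb.M ×ˢ closedBall (0 : E m) r ×ˢ closedBall (0 : E m) (lamMax Pb prm)) :=
    h.reg.compact.prod ((isCompact_closedBall _ _).prod (isCompact_closedBall _ _))
  have hc := h.continuous_augLag (prm.ρ k)
  obtain ⟨C, hC⟩ := hK.exists_bound_of_continuousOn hc.continuousOn
  refine Integrable.of_bound
    (hc.measurable.comp (hx.prodMk (hy.prodMk hlam))).aestronglyMeasurable C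
    (Eventually.of_forall fun ω => hC (S.x k ω, S.y k ω, S.lam k ω)
      ⟨h.x_mem hS.isRun hk ω, by simpa using hr ω, ?_⟩)
  simpa using h.norm_lam_le hS.isRun hk ω

theorem merit_eq (h : Standing Pb prm LF Lg σ Lt cν cγ p q Lp ζ)
    (hS : S.IsMarsAdmm Pb prm μ) {k : ℕ} (hk : 1 ≤ k) :
    merit Pb prm μ S cγ k = ∫ ω, Pb.augLag (prm.ρ k) (S.x k ω) (S.y k ω) (S.lam k ω) ∂μ
      + cγ * cbrt (k - 1) * ∫ ω, ‖S.err Pb k ω‖ ^ 2 ∂μ := by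
  have e : ((k : ℝ) - 1) ^ (1 / 3 : ℝ) = cbrt (k - 1) := by
    rw [cbrt, Nat.cast_sub hk, Nat.cast_one]
  rw [merit, e, integral_add (h.integrable_augLag hS hk) ((h.integrable_err hS hk).const_mul _),
    integral_const_mul]

/-- The weighted second moments that the merit function controls. -/
noncomputable def progress (Pb : Problem n m Ξ) (prm : Params n m) (S : Trajectory n m Ω Ξ)
    (μ : Measure Ω) (cγ : ℝ) (k : ℕ) : ℝ :=
  prm.cη * ∫ ω, ‖S.G Pb prm k ω‖ ^ 2 ∂μ + prm.cα * cγ * ∫ ω, ‖S.err Pb k ω‖ ^ 2 ∂μ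

theorem merit_succ_le (h : Standing Pb prm LF Lg σ Lt cν cγ p q Lp ζ)
    (hS : S.IsMarsAdmm Pb prm μ) {k : ℕ} (hk : 1 ≤ k) :
    merit Pb prm μ S cγ (k + 1) ≤ merit Pb prm μ S cγ k
      - 1 / 8 * (progress Pb prm S μ cγ k / cbrt k)
      + 2 * cγ * prm.cα ^ 2 * σ ^ 2 * varianceWeight k + residualTerm Pb prm Lg k := by
  have hLi := h.integrable_augLag hS hk
  have hLi' := h.integrable_augLag hS (k := k + 1) (by omega)
  have hei := h.integrable_err hS hk
  have hGi := h.integrable_G hS hk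
  rw [h.merit_eq hS hk, h.merit_eq hS (k := k + 1) (by omega), add_tsub_cancel_right]
  refine h.merit_arith hk (integral_nonneg fun _ => by positivity)
    (integral_nonneg fun _ => by positivity) ?_ ?_ (h.integral_err_succ_le hS hk hei).2
  · rintro rfl
    exact (h.integrable_err_one hS).2
  · have i1 := hLi.sub (hGi.const_mul (prm.η k * (3 / 8 - 1 / (8 * cbrt k ^ 2))))
    have i2 := i1.add (hei.const_mul (2 * prm.η k))
    have i3 := i2.add (integrable_const (residualTerm Pb prm Lg k))
    refine (integral_mono hLi' i3 fun ω => h.augLag_succ_le hS.isRun hk ω).trans (le_of_eq ?_)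
    rw [integral_add' i2 (integrable_const _), integral_add' i1 (hei.const_mul _),
      integral_sub' hLi (hGi.const_mul _), integral_const_mul, integral_const_mul]
    simp

theorem psiStar_le_merit (h : Standing Pb prm LF Lg σ Lt cν cγ p q Lp ζ)
    (hS : S.IsMarsAdmm Pb prm μ) {k : ℕ} (hk : 1 ≤ k) :
    psiStar Pb prm Lg ≤ merit Pb prm μ S cγ (k + 1) := by
  rw [h.merit_eq hS (by omega)]
  have h1 : psiStar Pb prm Lg ≤ ∫ ω, Pb.augLag (prm.ρ (k + 1)) (S.x (k + 1) ω) (S.y (k + 1) ω)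
      (S.lam (k + 1) ω) ∂μ := by
    have := integral_mono (integrable_const (psiStar Pb prm Lg))
      (h.integrable_augLag hS (k := k + 1) (by omega))
      (fun ω => h.psiStar_le_augLag hS.isRun hk ω)
    simpa using this
  have h2 : 0 ≤ cγ * cbrt (k + 1 - 1) * ∫ ω, ‖S.err Pb (k + 1) ω‖ ^ 2 ∂μ :=
    mul_nonneg (mul_nonneg h.adm.cγ_pos.le (cbrt_nonneg _)) (integral_nonneg fun _ => by positivity)
  linarith

/-- The one-step decrease is telescoped over `N` iterations; the residual terms are summable and the
variance weights add up to at most `1 + ln(N + 1)`. -/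
theorem sum_progress_le (h : Standing Pb prm LF Lg σ Lt cν cγ p q Lp ζ)
    (hS : S.IsMarsAdmm Pb prm μ) {N : ℕ} (hN : 1 ≤ N) :
    ∑ j ∈ Finset.range N, progress Pb prm S μ cγ (j + 1) / cbrt (j + 1) ≤
      8 * constC Pb prm Lg σ cγ (merit Pb prm μ S cγ 1) (N + 1) := by
  have htel : merit Pb prm μ S cγ (N + 1) ≤ merit Pb prm μ S cγ 1
      - 1 / 8 * ∑ j ∈ Finset.range N, progress Pb prm S μ cγ (j + 1) / cbrt (j + 1)
      + 2 * cγ * prm.cα ^ 2 * σ ^ 2 * ∑ j ∈ Finset.range N, varianceWeight (j + 1)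
      + ∑ j ∈ Finset.range N, residualTerm Pb prm Lg (j + 1) := by
    clear hN
    induction N with
    | zero => simp
    | succ N ih =>
      have := h.merit_succ_le hS (k := N + 1) (by omega)
      simp only [Finset.sum_range_succ, mul_add]
      linarith
  have h1 := h.psiStar_le_merit hS hN
  have h2 := h.sum_residualTerm_le N
  have hγ := h.adm.cγ_pos
  have h3 := mul_le_mul_of_nonneg_left (sum_varianceWeight_le N)
    (by positivity : 0 ≤ 2 * cγ * prm.cα ^ 2 * σ ^ 2)
  unfold constC
  push_cast
  linarith

end Standing

end MarsAdmm

/-! ### Choice of the index and bounds in expectation -/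

namespace MarsAdmm

open Set Metric Filter Topology

variable {n m : ℕ} {Ω Ξ : Type*} [MeasurableSpace Ξ]

/-- Jensen's inequality, read off from the nonnegativity of the variance. -/
theorem integral_le_sqrt_of_sq [MeasurableSpace Ω] {μ : Measure Ω} [IsProbabilityMeasure μ]
    {X : Ω → ℝ} (hX : Measurable X) (hX2 : Integrable (fun ω => X ω ^ 2) μ) {c : ℝ}
    (hc : ∫ ω, X ω ^ 2 ∂μ ≤ c) : Integrable X μ ∧ ∫ ω, X ω ∂μ ≤ √c := by
  have hLp : MemLp X 2 μ := (memLp_two_iff_integrable_sq hX.aestronglyMeasurable).2 hX2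
  have hXi : Integrable X μ := hLp.integrable (by norm_num)
  refine ⟨hXi, Real.le_sqrt_of_sq_le (le_trans ?_ hc)⟩
  have hvar := variance_nonneg X μ
  rw [variance_eq_sub hLp] at hvar
  simp only [Pi.pow_apply] at hvar
  linarith

theorem cbrt_mono {j k : ℕ} (h : j ≤ k) : cbrt j ≤ cbrt k :=
  Real.rpow_le_rpow (Nat.cast_nonneg j) (by exact_mod_cast h) (by norm_num)

namespace Standing

variable {S : Trajectory n m Ω Ξ} {Pb : Problem n m Ξ} {prm : Params n m} {LF Lg : ℝ≥0}
  {σ Lt cν cγ p q Lp ζ : ℝ} [MeasurableSpace Ω] {μ : Measure Ω} [IsProbabilityMeasure μ]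

theorem min_pos (h : Standing Pb prm LF Lg σ Lt cν cγ p q Lp ζ) :
    0 < min (4 * prm.cα * cγ) prm.cη := by
  have h1 := h.adm.cγ_pos
  have h2 : 0 < prm.cα := by
    have := h.adm.cα_ge
    norm_num at this
    linarith
  exact lt_min (by positivity) h.adm.cη_pos

/-- Some iterate in the second half of the run has small second moments. -/
theorem exists_index (h : Standing Pb prm LF Lg σ Lt cν cγ p q Lp ζ)
    (hS : S.IsMarsAdmm Pb prm μ) {K : ℕ} (hK : 2 < K) :
    ∃ k, 1 ≤ k ∧ ⌈(K : ℝ) / 2⌉₊ ≤ k + 1 ∧ k + 1 ≤ K ∧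
      ∫ ω, ‖S.G Pb prm k ω‖ ^ 2 ∂μ + (∫ ω, ‖S.err Pb k ω‖ ^ 2 ∂μ) / 4 ≤
        2 * constQ Pb prm Lg σ cγ (merit Pb prm μ S cγ 1) K / cbrt (K + 1) ^ 2 := by
  set c := ⌈(K : ℝ) / 2⌉₊ with hcdef
  have hc1 : K ≤ 2 * c := by
    have := Nat.le_ceil ((K : ℝ) / 2)
    rw [← hcdef] at this
    have : (K : ℝ) ≤ 2 * c := by linarith
    exact_mod_cast this
  have hc2 : 2 * c ≤ K + 1 := by
    have := Nat.ceil_lt_add_one (show 0 ≤ (K : ℝ) / 2 by positivity)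
    rw [← hcdef] at this
    have : (2 * c : ℝ) < K + 2 := by linarith
    have : 2 * c < K + 2 := by exact_mod_cast this
    omega
  set C := constC Pb prm Lg σ cγ (merit Pb prm μ S cγ 1) K
  set τ := cbrt (K + 1)
  have hτ : 0 < τ := cbrt_pos (by omega)
  have hτ3 : τ ^ 3 = (K : ℝ) + 1 := by simpa using cbrt_pow_three (K + 1)
  have hm := h.min_pos
  have hγ := h.adm.cγ_pos
  have hη := h.adm.cη_pos
  have hα : 0 < prm.cα := by
    have := h.adm.cα_ge
    norm_num at this
    linarith
  have hnn : ∀ k, 0 ≤ progress Pb prm S μ cγ k := fun k => by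
    have h1 : 0 ≤ ∫ ω, ‖S.G Pb prm k ω‖ ^ 2 ∂μ := integral_nonneg fun _ => by positivity
    have h2 : 0 ≤ ∫ ω, ‖S.err Pb k ω‖ ^ 2 ∂μ := integral_nonneg fun _ => by positivity
    unfold progress
    positivity
  have hsum := h.sum_progress_le hS (N := K - 1) (by omega)
  rw [Nat.sub_add_cancel (by omega)] at hsum
  -- The residual index is `κ = j + 2`, so this range corresponds exactly to `κ` from `⌈K/2⌉` to
  -- `K`. The weights `1 / cbrt (j + 1)` are bounded below by `1 / τ`.
  have hsum2 : ∑ j ∈ Finset.Ico (c - 2) (K - 1), progress Pb prm S μ cγ (j + 1) ≤ 8 * C * τ := by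
    rw [← div_le_iff₀ hτ, Finset.sum_div]
    refine le_trans (Finset.sum_le_sum fun j hj => ?_) ((Finset.sum_le_sum_of_subset_of_nonneg
      (fun j hj => ?_) fun j _ _ => div_nonneg (hnn _) (cbrt_nonneg _)).trans hsum)
    · rw [Finset.mem_Ico] at hj
      have := cbrt_pos (k := j + 1) (by omega)
      exact div_le_div_of_nonneg_left (hnn _) this (cbrt_mono (by omega))
    · rw [Finset.mem_Ico] at hj
      exact Finset.mem_range.2 hj.2
  have hC0 : 0 ≤ C := by
    have : 0 ≤ 8 * C * τ := (Finset.sum_nonneg fun j _ => hnn _).trans hsum2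
    have := nonneg_of_mul_nonneg_left this hτ
    linarith
  -- There are `K + 1 - c` indices and `2 c ≤ K + 1`. The average progress is therefore at most `8 C
  -- τ / (τ³ / 2) = 16 C / τ²`.
  have hcard : ((K : ℝ) + 1) / 2 ≤ (Finset.Ico (c - 2) (K - 1)).card := by
    rw [Nat.card_Ico]
    have : K + 1 ≤ 2 * (K - 1 - (c - 2)) := by omega
    have : ((K + 1 : ℕ) : ℝ) ≤ ((2 * (K - 1 - (c - 2)) : ℕ) : ℝ) := by exact_mod_cast this
    push_cast at this ⊢
    linarith
  have hne : (Finset.Ico (c - 2) (K - 1)).Nonempty := Finset.nonempty_Ico.2 (by omega)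
  obtain ⟨j, hj, hle⟩ := Finset.exists_le_of_sum_le (f := fun j => progress Pb prm S μ cγ (j + 1))
    (g := fun _ => 16 * C / τ ^ 2) hne (by
      rw [Finset.sum_const, nsmul_eq_mul]
      refine hsum2.trans ?_
      calc 8 * C * τ = τ ^ 3 / 2 * (16 * C / τ ^ 2) := by field_simp; ring
        _ ≤ _ := by
          rw [hτ3]
          gcongr)
  rw [Finset.mem_Ico] at hj
  refine ⟨j + 1, by omega, by omega, by omega, ?_⟩
  set g := ∫ ω, ‖S.G Pb prm (j + 1) ω‖ ^ 2 ∂μ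
  set e := ∫ ω, ‖S.err Pb (j + 1) ω‖ ^ 2 ∂μ
  have hg0 : 0 ≤ g := integral_nonneg fun _ => by positivity
  have he0 : 0 ≤ e := integral_nonneg fun _ => by positivity
  have hp : progress Pb prm S μ cγ (j + 1) = prm.cη * g + prm.cα * cγ * e := rfl
  rw [hp] at hle
  -- The factor 4 in the minimum matches the weight `1/4` of the error, which is what squaring `2
  -- ‖G‖ + ‖ε‖` calls for.
  have h1 : min (4 * prm.cα * cγ) prm.cη * (g + e / 4) ≤ 16 * C / τ ^ 2 := by
    refine le_trans ?_ hle
    have a1 : min (4 * prm.cα * cγ) prm.cη * g ≤ prm.cη * g := by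
      gcongr
      exact min_le_right _ _
    have a2 : min (4 * prm.cα * cγ) prm.cη * (e / 4) ≤ 4 * prm.cα * cγ * (e / 4) := by
      gcongr
      exact min_le_left _ _
    linarith
  have h2 : 2 * constQ Pb prm Lg σ cγ (merit Pb prm μ S cγ 1) K / τ ^ 2 =
      16 * C / τ ^ 2 / min (4 * prm.cα * cγ) prm.cη := by
    rw [constQ]
    ring
  rw [h2, le_div_iff₀ hm, mul_comm]
  exact h1

/-- The explicit bounds on the three residuals. -/
theorem exists_residual_bounds (h : Standing Pb prm LF Lg σ Lt cν cγ p q Lp ζ)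
    (hS : S.IsMarsAdmm Pb prm μ) {K : ℕ} (hK : 2 < K) :
    ∃ κ : ℕ, ⌈(K : ℝ) / 2⌉₊ ≤ κ ∧ κ ≤ K ∧ 1 ≤ κ ∧
      let Q := constQ Pb prm Lg σ cγ (merit Pb prm μ S cγ 1) K
      ExpLe μ (fun ω => statRes Pb (S.x κ ω) (S.lamBar Pb prm κ ω))
        (4 * √Q * ((K : ℝ) + 1) ^ (-(1 / 3) : ℝ)) ∧
      ExpLe μ (fun ω => dualRes Pb (S.y κ ω) (S.lamBar Pb prm κ ω))
        (2 * p * ‖Pb.A‖ * √Q * ((K : ℝ) + 1) ^ (-(1 / 3) : ℝ)) ∧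
      ExpLe μ (fun ω => feasRes Pb (S.x κ ω) (S.y κ ω))
        (2 * (2 * p * ‖Pb.A‖ * prm.cη * √Q + (Lg + lamMax Pb prm) / prm.cρ)
          * ((K : ℝ) - 2) ^ (-(1 / 3) : ℝ)) := by
  obtain ⟨k, hk, hk1, hk2, hle⟩ := h.exists_index hS hK
  refine ⟨k + 1, hk1, hk2, by omega, ?_⟩
  intro Q
  have hrun := hS.isRun
  set τ := cbrt (K + 1)
  have hτ : 0 < τ := cbrt_pos (by omega)
  have hτpow : ((K : ℝ) + 1) ^ (-(1 / 3) : ℝ) = τ⁻¹ := by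
    have := rpow_neg_div_three (K + 1) 1
    simpa using this
  set τ' := cbrt (K - 2)
  have hτ' : 0 < τ' := cbrt_pos (by omega)
  have hτpow' : ((K : ℝ) - 2) ^ (-(1 / 3) : ℝ) = τ'⁻¹ := by
    have := rpow_neg_div_three (K - 2) 1
    rw [Nat.cast_sub (by omega)] at this
    simpa using this
  have hp := h.geom.p_pos
  have hη := h.adm.cη_pos
  have hρ := h.cρ_pos
  obtain ⟨-, hlam, -, -, hG, hE⟩ := h.measurable_of_isMarsAdmm hS hk
  obtain ⟨hx', -, -, hy', -, -⟩ := h.measurable_of_isMarsAdmm hS (k := k + 1) (by omega)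
  have hGi := h.integrable_G hS hk
  have hEi := h.integrable_err hS hk
  have hE0 : 0 ≤ ∫ ω, ‖S.err Pb k ω‖ ^ 2 ∂μ := integral_nonneg fun _ => by positivity
  have hG0 : 0 ≤ ∫ ω, ‖S.G Pb prm k ω‖ ^ 2 ∂μ := integral_nonneg fun _ => by positivity
  -- Nonnegativity of `Q` over `τ²` is inherited from the nonnegative quantity that it bounds.
  have hQτ : 0 ≤ Q / τ ^ 2 := by
    have : 2 * Q / τ ^ 2 = 2 * (Q / τ ^ 2) := by ring
    rw [this] at hle
    linarith
  have hsqrt : √(Q / τ ^ 2) = √Q * τ⁻¹ := by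
    rw [Real.sqrt_div' _ (by positivity), Real.sqrt_sq hτ.le, div_eq_mul_inv]
  obtain ⟨hG1, hG2⟩ := integral_le_sqrt_of_sq hG.norm hGi (c := 4 * (Q / τ ^ 2)) (by
    have : 2 * Q / τ ^ 2 = 2 * (Q / τ ^ 2) := by ring
    rw [this] at hle
    linarith)
  have hs2 : √(4 * (Q / τ ^ 2)) = 2 * √Q * τ⁻¹ := by
    rw [Real.sqrt_mul (by norm_num), hsqrt, show (4 : ℝ) = 2 ^ 2 by norm_num,
      Real.sqrt_sq (by norm_num)]
    ring
  rw [hs2] at hG2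
  -- The right-hand side is `8 (‖G‖² + ‖ε‖² / 4)`, the combination controlled by `exists_index`;
  -- this produces `16 Q / τ²` and, after the root, the constant 4.
  have hsum_sq : ∀ ω, (2 * ‖S.G Pb prm k ω‖ + ‖S.err Pb k ω‖) ^ 2 ≤
      8 * ‖S.G Pb prm k ω‖ ^ 2 + 2 * ‖S.err Pb k ω‖ ^ 2 := fun ω => by
    nlinarith [sq_nonneg (2 * ‖S.G Pb prm k ω‖ - ‖S.err Pb k ω‖)]
  have hbd := (hGi.const_mul 8).add (hEi.const_mul 2)
  have hXm : Measurable fun ω => 2 * ‖S.G Pb prm k ω‖ + ‖S.err Pb k ω‖ :=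
    (hG.norm.const_mul 2).add hE.norm
  have hX2 : Integrable (fun ω => (2 * ‖S.G Pb prm k ω‖ + ‖S.err Pb k ω‖) ^ 2) μ := by
    refine hbd.mono' (hXm.pow_const 2).aestronglyMeasurable (Eventually.of_forall fun ω => ?_)
    rw [Real.norm_of_nonneg (by positivity)]
    exact hsum_sq ω
  obtain ⟨hX1, hX3⟩ := integral_le_sqrt_of_sq hXm hX2 (c := 16 * (Q / τ ^ 2)) (by
    refine (integral_mono hX2 hbd hsum_sq).trans ?_
    rw [integral_add' (hGi.const_mul 8) (hEi.const_mul 2), integral_const_mul, integral_const_mul]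
    have : 2 * Q / τ ^ 2 = 2 * (Q / τ ^ 2) := by ring
    rw [this] at hle
    linarith)
  have hs4 : √(16 * (Q / τ ^ 2)) = 4 * √Q * τ⁻¹ := by
    rw [Real.sqrt_mul (by norm_num), hsqrt, show (16 : ℝ) = 4 ^ 2 by norm_num,
      Real.sqrt_sq (by norm_num)]
    ring
  rw [hs4] at hX3
  have hlb : Measurable (S.lamBar Pb prm (k + 1)) := by
    unfold Trajectory.lamBar
    rw [add_tsub_cancel_right]
    exact hlam.sub (((Pb.A.measurable.comp hx').sub hy').const_smul (prm.ρ k))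
  have hmem := h.x_mem hrun (k := k + 1) (by omega)
  rw [hτpow, hτpow']
  refine ⟨?_, ?_, ?_⟩
  · have hm : Measurable fun ω => statRes Pb (S.x (k + 1) ω) (S.lamBar Pb prm (k + 1) ω) :=
      ((h.measurable_proj hx' (Pb.At.measurable.comp hlb).neg hmem).add
        (h.measurable_gradF hx' hmem)).norm
    have hInt : Integrable (fun ω => statRes Pb (S.x (k + 1) ω) (S.lamBar Pb prm (k + 1) ω)) μ := by
      refine hX1.mono' hm.aestronglyMeasurable (Eventually.of_forall fun ω => ?_)
      rw [Real.norm_of_nonneg (show 0 ≤ statRes _ _ _ from norm_nonneg _)]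
      exact h.statRes_succ_le hrun hk ω
    exact ⟨hInt, (integral_mono hInt hX1 fun ω => h.statRes_succ_le hrun hk ω).trans hX3⟩
  · have hm : Measurable fun ω => dualRes Pb (S.y (k + 1) ω) (S.lamBar Pb prm (k + 1) ω) :=
      measurable_infDist_subdiff h.reg.g_lip hy' hlb.neg fun ω => ⟨_, h.subgradient_mem hrun hk ω⟩
    have hdom := hG1.const_mul (p * ‖Pb.A‖)
    have hInt : Integrable (fun ω => dualRes Pb (S.y (k + 1) ω) (S.lamBar Pb prm (k + 1) ω)) μ := by
      refine hdom.mono' hm.aestronglyMeasurable (Eventually.of_forall fun ω => ?_)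
      rw [Real.norm_of_nonneg (show 0 ≤ dualRes _ _ _ from infDist_nonneg)]
      exact h.dualRes_succ_le hrun hk ω
    refine ⟨hInt, (integral_mono hInt hdom fun ω => h.dualRes_succ_le hrun hk ω).trans ?_⟩
    rw [integral_const_mul]
    calc p * ‖Pb.A‖ * ∫ ω, ‖S.G Pb prm k ω‖ ∂μ ≤ p * ‖Pb.A‖ * (2 * √Q * τ⁻¹) := by gcongr
      _ = _ := by ring
  · have hm : Measurable fun ω => feasRes Pb (S.x (k + 1) ω) (S.y (k + 1) ω) :=
      ((Pb.A.measurable.comp hx').sub hy').norm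
    have hle' : ∀ ω, feasRes Pb (S.x (k + 1) ω) (S.y (k + 1) ω) ≤
        ‖Pb.A‖ * p * prm.η k * ‖S.G Pb prm k ω‖ + (Lg + lamMax Pb prm) / prm.ρ k := fun ω =>
      (h.feasRes_succ_le hrun hk ω).trans (le_of_eq (by ring))
    have hdom : Integrable (fun ω => ‖Pb.A‖ * p * prm.η k * ‖S.G Pb prm k ω‖
        + (Lg + lamMax Pb prm) / prm.ρ k) μ := (hG1.const_mul _).add (integrable_const _)
    have hInt : Integrable (fun ω => feasRes Pb (S.x (k + 1) ω) (S.y (k + 1) ω)) μ := by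
      refine hdom.mono' hm.aestronglyMeasurable (Eventually.of_forall fun ω => ?_)
      rw [Real.norm_of_nonneg (show 0 ≤ feasRes _ _ _ from norm_nonneg _)]
      exact hle' ω
    refine ⟨hInt, (integral_mono hInt hdom hle').trans ?_⟩
    rw [integral_add (hG1.const_mul _) (integrable_const _), integral_const_mul, integral_const]
    simp only [probReal_univ, one_smul]
    have ht1 := one_le_cbrt hk
    have ht0 := cbrt_pos hk
    -- Since `K ≤ 2 (k + 1)`, one has `K - 2 ≤ 2 k ≤ 8 k`: the shift by 2 compensates `k = κ - 1`,
    -- and the factor 8 becomes 2 under the cube root.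
    have htτ : τ' ≤ 2 * cbrt k := by
      refine le_of_pow_le_pow_left₀ (n := 3) (by norm_num) (by positivity) ?_
      rw [mul_pow, cbrt_pow_three, cbrt_pow_three]
      have hc1 : K ≤ 2 * (k + 1) := by
        have := (Nat.le_ceil ((K : ℝ) / 2)).trans (Nat.cast_le.2 hk1)
        push_cast at this
        have : (K : ℝ) ≤ 2 * (k + 1) := by linarith
        exact_mod_cast this
      have : K - 2 ≤ 8 * k := by omega
      have : ((K - 2 : ℕ) : ℝ) ≤ ((8 * k : ℕ) : ℝ) := by exact_mod_cast this
      push_cast at this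
      linarith
    have hηle : prm.η k ≤ prm.cη := by
      rw [prm.η_eq]
      exact div_le_self hη.le ht1
    have hττ : τ⁻¹ ≤ τ'⁻¹ := by
      gcongr
      exact cbrt_mono (by omega)
    have hw : 0 ≤ (Lg : ℝ) + lamMax Pb prm := add_nonneg Lg.2 h.lamMax_nonneg
    have hρle : ((Lg : ℝ) + lamMax Pb prm) / prm.ρ k ≤
        2 * ((Lg + lamMax Pb prm) / prm.cρ) * τ'⁻¹ := by
      rw [prm.ρ_eq]
      calc ((Lg : ℝ) + lamMax Pb prm) / (prm.cρ * cbrt k)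
          = 2 * ((Lg + lamMax Pb prm) / prm.cρ) * (2 * cbrt k)⁻¹ := by field_simp
        _ ≤ _ := by gcongr
    have hGle : ‖Pb.A‖ * p * prm.η k * ∫ ω, ‖S.G Pb prm k ω‖ ∂μ ≤
        2 * (2 * p * ‖Pb.A‖ * prm.cη * √Q) * τ'⁻¹ := by
      have hG00 : 0 ≤ ∫ ω, ‖S.G Pb prm k ω‖ ∂μ := integral_nonneg fun _ => norm_nonneg _
      calc _ ≤ ‖Pb.A‖ * p * prm.cη * (2 * √Q * τ'⁻¹) := by
            gcongr
            exact hG2.trans (by gcongr)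
        _ ≤ 2 * (‖Pb.A‖ * p * prm.cη * (2 * √Q * τ'⁻¹)) := by
            have : 0 ≤ ‖Pb.A‖ * p * prm.cη * (2 * √Q * τ'⁻¹) := by positivity
            linarith
        _ = _ := by ring
    rw [mul_add, add_mul]
    exact add_le_add hGle hρle

end Standing

end MarsAdmm

namespace MarsAdmm

open Set Metric Filter Topology

/-! ### Complexity -/

/-- A number of iterations of order `ε⁻³ (1 + ln (1/ε))^{3/2}` brings `D √(1 + ln K) K^{-1/3}`
below `ε`. -/
theorem exists_iteration_count (D : ℝ) :
    ∃ c : ℝ, 0 < c ∧ ∀ ε : ℝ, 0 < ε → ε < 1 → ∃ K : ℕ, 2 < K ∧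
      (K : ℝ) + 1 ≤ c * ε ^ (-3 : ℤ) * (1 + Real.log (1 / ε)) ^ (3 / 2 : ℝ) ∧
      D * √(1 + Real.log K) * ((K : ℝ) - 2) ^ (-(1 / 3) : ℝ) ≤ ε := by
  -- `ln K` grows only linearly in `s` times `1 + ln (1/ε)`, so it is enough that `D² (3 s + 27/2) ≤
  -- s²`, which this choice guarantees.
  set s : ℝ := 17 * D ^ 2 + 1 with hs
  have hs1 : 1 ≤ s := by
    have := sq_nonneg D
    linarith
  refine ⟨s ^ 3 + 5, by positivity, fun ε hε hε1 => ?_⟩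
  set t : ℝ := ε⁻¹ with ht
  have ht1 : 1 < t := (one_lt_inv₀ hε).2 hε1
  have ht0 : 0 < t := by linarith
  have hl0 : 0 < Real.log t := Real.log_pos ht1
  set l : ℝ := 1 + Real.log t with hl
  have hl1 : 1 ≤ l := by linarith
  have hlpos : 0 < l := by linarith
  set w : ℝ := √l with hw
  have hw1 : 1 ≤ w := Real.one_le_sqrt.2 hl1
  have hw2 : w ^ 2 = l := Real.sq_sqrt hlpos.le
  have hlw : l ^ (3 / 2 : ℝ) = w ^ 3 := by
    rw [hw, Real.sqrt_eq_rpow, ← Real.rpow_natCast, ← Real.rpow_mul hlpos.le]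
    norm_num
  have hε3 : ε ^ (-3 : ℤ) = t ^ 3 := by
    rw [zpow_neg, ht, inv_pow]
    rfl
  have h1ε : 1 / ε = t := one_div ε
  rw [h1ε, ← hl, hlw, hε3]
  have hu1 : 1 ≤ t ^ 3 * w ^ 3 := by
    have := one_le_pow₀ ht1.le (n := 3)
    have := one_le_pow₀ hw1 (n := 3)
    nlinarith
  set X : ℝ := (s * t * w) ^ 3 with hX
  have hX0 : 0 < X := by positivity
  have hceil := Nat.ceil_lt_add_one hX0.le
  have hceil' := Nat.le_ceil X
  -- Adding 3 gives `K > 2` and `K - 2 ≥ X`; the extra constant is absorbed in `s ^ 3 + 5` because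
  -- `t ^ 3 * w ^ 3 ≥ 1`.
  refine ⟨⌈X⌉₊ + 3, by omega, ?_, ?_⟩
  · push_cast
    have hXe : X = s ^ 3 * (t ^ 3 * w ^ 3) := by rw [hX]; ring
    nlinarith
  set K : ℕ := ⌈X⌉₊ + 3 with hK
  have hKc : (K : ℝ) = ⌈X⌉₊ + 3 := by rw [hK]; push_cast; ring
  have hK0 : (0 : ℝ) < K := by rw [hKc]; positivity
  have hlogK : 1 + Real.log K ≤ (3 * s + 27 / 2) * l := by
    have hKle : (K : ℝ) ≤ (s + 4) ^ 3 * (t ^ 3 * w ^ 3) := by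
      have hXe : X = s ^ 3 * (t ^ 3 * w ^ 3) := by rw [hX]; ring
      have : s ^ 3 + 4 ≤ (s + 4) ^ 3 := by nlinarith [sq_nonneg s]
      calc (K : ℝ) ≤ X + 4 := by rw [hKc]; linarith
        _ ≤ (s ^ 3 + 4) * (t ^ 3 * w ^ 3) := by rw [hXe]; nlinarith
        _ ≤ _ := by gcongr
    have h1 := Real.log_le_log hK0 hKle
    rw [Real.log_mul (by positivity) (by positivity), Real.log_mul (by positivity) (by positivity),
      Real.log_pow, Real.log_pow, Real.log_pow] at h1
    have h2 : Real.log (s + 4) ≤ s + 4 - 1 := Real.log_le_sub_one_of_pos (by linarith)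
    have h3 : Real.log w ≤ Real.log t / 2 := by
      rw [hw, Real.log_sqrt hlpos.le]
      have := Real.log_le_sub_one_of_pos hlpos
      linarith
    push_cast at h1
    nlinarith
  have hrpow : ((K : ℝ) - 2) ^ (-(1 / 3) : ℝ) ≤ (s * t * w)⁻¹ := by
    calc ((K : ℝ) - 2) ^ (-(1 / 3) : ℝ) ≤ X ^ (-(1 / 3) : ℝ) :=
          Real.rpow_le_rpow_of_nonpos hX0 (by rw [hKc]; linarith) (by norm_num)
      _ = (s * t * w)⁻¹ := by
          rw [hX, ← Real.rpow_natCast, ← Real.rpow_mul (by positivity)]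
          norm_num [Real.rpow_neg_one]
  have hDs : D * √(1 + Real.log K) ≤ s * w := by
    refine le_of_sq_le_sq ?_ (by positivity)
    rw [mul_pow, mul_pow, hw2, Real.sq_sqrt (by
      have := Real.log_natCast_nonneg K
      linarith)]
    calc D ^ 2 * (1 + Real.log K) ≤ D ^ 2 * ((3 * s + 27 / 2) * l) := by gcongr
      _ = D ^ 2 * (3 * s + 27 / 2) * l := by ring
      _ ≤ s ^ 2 * l := by
        gcongr
        nlinarith [sq_nonneg D]
  calc D * √(1 + Real.log K) * ((K : ℝ) - 2) ^ (-(1 / 3) : ℝ)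
      ≤ s * w * (s * t * w)⁻¹ := by
        refine mul_le_mul hDs hrpow (Real.rpow_nonneg ?_ _) (by positivity)
        rw [hKc]
        linarith
    _ = ε := by
        have : ε = t⁻¹ := (inv_inv ε).symm
        rw [this]
        field_simp

theorem Trajectory.oracleCalls_le {n m : ℕ} {Ω Ξ : Type*} (S : Trajectory n m Ω Ξ) {bmax : ℕ}
    (hb : ∀ k, 1 ≤ k → S.b k ≤ bmax) (K : ℕ) :
    S.oracleCalls K ≤ (K + 1) * (2 + 2 * bmax) := by
  have h1 := hb 1 le_rfl
  have h2 : ∑ k ∈ Finset.Icc 1 K, (1 + 1 + 2 * S.b (k + 1)) ≤ K * (2 + 2 * bmax) := by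
    refine (Finset.sum_le_card_nsmul _ _ (2 + 2 * bmax) fun k _ => ?_).trans (by simp)
    have := hb (k + 1) (by omega)
    omega
  unfold Trajectory.oracleCalls
  linarith

theorem ExpLe.mono {Ω : Type*} [MeasurableSpace Ω] {μ : Measure Ω} {Z : Ω → ℝ} {r r' : ℝ}
    (h : ExpLe μ Z r) (hr : r ≤ r') : ExpLe μ Z r' := ⟨h.1, h.2.trans hr⟩

namespace Standing

variable {n m : ℕ} {Ξ : Type*} [MeasurableSpace Ξ] {Pb : Problem n m Ξ} {prm : Params n m}
  {LF Lg : ℝ≥0} {σ Lt cν cγ p q Lp ζ : ℝ}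

/-- Because `γ_1 = 0` and the starting point is deterministic, `ψ_1` does not depend on the samples
or on the batches. This is why `K` and `C₀` can be fixed before the run. -/
theorem merit_one {Ω : Type*} [MeasurableSpace Ω] {μ : Measure Ω} [IsProbabilityMeasure μ]
    {S : Trajectory n m Ω Ξ} (hS : S.IsMarsAdmm Pb prm μ) :
    merit Pb prm μ S cγ 1 = Pb.augLag (prm.ρ 1) prm.x₁ prm.y₁ prm.lam₁ := by
  simp [merit, hS.x_one, hS.y_one, hS.lam_one]

/-- Separates the logarithm from the constants; the square form prepares for taking the root. The
absolute value covers the possibly negative `ψ_1 - ψ*`. -/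
theorem constQ_le (h : Standing Pb prm LF Lg σ Lt cν cγ p q Lp ζ) (ψ₁ : ℝ) :
    ∃ a : ℝ, ∀ K : ℕ, constQ Pb prm Lg σ cγ ψ₁ K ≤ a ^ 2 * (1 + Real.log K) := by
  have hm := h.min_pos
  have hγ := h.adm.cγ_pos
  set m₀ := min (4 * prm.cα * cγ) prm.cη with hm₀
  set c₀ := ψ₁ - psiStar Pb prm Lg
    + (constC₁ / (3 * prm.cρ) + 2 * prm.cβ * constC₂ / prm.cρ ^ 2) * (Lg + lamMax Pb prm) ^ 2
  set c₁ := 2 * cγ * prm.cα ^ 2 * σ ^ 2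
  have hc₁ : 0 ≤ c₁ := by positivity
  refine ⟨√(8 * (|c₀| + c₁) / m₀), fun K => ?_⟩
  rw [Real.sq_sqrt (by positivity), constQ, div_mul_eq_mul_div, ← hm₀,
    mul_assoc 8]
  have hlog := Real.log_natCast_nonneg K
  have hC : constC Pb prm Lg σ cγ ψ₁ K = c₀ + c₁ * (1 + Real.log K) := by
    simp only [constC, c₀, c₁]
    ring
  rw [hC]
  gcongr
  nlinarith [le_abs_self c₀, abs_nonneg c₀]

/-- The iteration and oracle complexity for batch sizes bounded by `bmax`. -/
theorem complexity (h : Standing Pb prm LF Lg σ Lt cν cγ p q Lp ζ) (bmax : ℕ) :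
    ∃ C₀ : ℝ, 0 < C₀ ∧ ∀ ε : ℝ, 0 < ε → ε < 1 → ∃ K : ℕ, 2 < K ∧
      (K : ℝ) ≤ C₀ * ε ^ (-3 : ℤ) * (1 + Real.log (1 / ε)) ^ (3 / 2 : ℝ) ∧
      ∀ (Ω : Type*) [MeasurableSpace Ω] (μ : Measure Ω) [IsProbabilityMeasure μ]
        (S : Trajectory n m Ω Ξ), S.IsMarsAdmm Pb prm μ → (∀ k, 1 ≤ k → S.b k ≤ bmax) →
        (S.oracleCalls K : ℝ) ≤ C₀ * ε ^ (-3 : ℤ) * (1 + Real.log (1 / ε)) ^ (3 / 2 : ℝ) ∧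
        ∃ κ : ℕ, ⌈(K : ℝ) / 2⌉₊ ≤ κ ∧ κ ≤ K ∧
          IsEpsStationary Pb μ ε (S.x κ) (S.y κ) (S.lamBar Pb prm κ) := by
  obtain ⟨a, ha⟩ := h.constQ_le (Pb.augLag (prm.ρ 1) prm.x₁ prm.y₁ prm.lam₁)
  have hp := h.geom.p_pos
  have hη := h.adm.cη_pos
  have hρ := h.cρ_pos
  have hlam := h.lamMax_nonneg
  set r := (Lg + lamMax Pb prm) / prm.cρ with hr
  have hr0 : 0 ≤ r := by positivity
  -- The sum of the three constants of the explicit bounds, so that a single `K` serves all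
  -- residuals at once.
  set D := 4 * |a| + 2 * p * ‖Pb.A‖ * |a| + 2 * (2 * p * ‖Pb.A‖ * prm.cη * |a| + r) with hD
  have hD1 : 4 * |a| ≤ D := by
    have h1 : 0 ≤ 2 * p * ‖Pb.A‖ * |a| := by positivity
    have h2 : 0 ≤ 2 * p * ‖Pb.A‖ * prm.cη * |a| := by positivity
    linarith
  have hD2 : 2 * p * ‖Pb.A‖ * |a| ≤ D := by
    have h1 := abs_nonneg a
    have h2 : 0 ≤ 2 * p * ‖Pb.A‖ * prm.cη * |a| := by positivity
    linarith
  have hD3 : 2 * (2 * p * ‖Pb.A‖ * prm.cη * |a| + r) ≤ D := by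
    have h1 := abs_nonneg a
    have h2 : 0 ≤ 2 * p * ‖Pb.A‖ * |a| := by positivity
    linarith
  obtain ⟨c, hc, hcount⟩ := exists_iteration_count D
  refine ⟨c * (2 + 2 * bmax), by positivity, fun ε hε hε1 => ?_⟩
  obtain ⟨K, hK, hKle, hDK⟩ := hcount ε hε hε1
  set U := ε ^ (-3 : ℤ) * (1 + Real.log (1 / ε)) ^ (3 / 2 : ℝ) with hU
  have hcU : c * ε ^ (-3 : ℤ) * (1 + Real.log (1 / ε)) ^ (3 / 2 : ℝ) = c * U := mul_assoc _ _ _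
  have hcU' : c * (2 + 2 * bmax) * ε ^ (-3 : ℤ) * (1 + Real.log (1 / ε)) ^ (3 / 2 : ℝ) =
      c * U * (2 + 2 * bmax) := by rw [hU]; ring
  rw [hcU] at hKle
  rw [hcU']
  have hK0 : (0 : ℝ) ≤ K := Nat.cast_nonneg K
  have hb0 : (0 : ℝ) ≤ bmax := Nat.cast_nonneg bmax
  refine ⟨K, hK, by nlinarith, fun Ω _ μ _ S hS hb => ⟨?_, ?_⟩⟩
  · calc (S.oracleCalls K : ℝ) ≤ (((K + 1) * (2 + 2 * bmax) : ℕ) : ℝ) := by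
          exact_mod_cast S.oracleCalls_le hb K
      _ = ((K : ℝ) + 1) * (2 + 2 * bmax) := by push_cast; ring
      _ ≤ _ := by gcongr
  obtain ⟨κ, h1, h2, h3, hres⟩ := h.exists_residual_bounds hS hK
  rw [merit_one hS] at hres
  dsimp only at hres
  obtain ⟨e1, e2, e3⟩ := hres
  have hlog := Real.log_natCast_nonneg K
  set z := √(1 + Real.log K) with hz
  have hz1 : 1 ≤ z := Real.one_le_sqrt.2 (by linarith)
  set Q := constQ Pb prm Lg σ cγ (Pb.augLag (prm.ρ 1) prm.x₁ prm.y₁ prm.lam₁) K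
  have hQ : √Q ≤ |a| * z := by
    rw [← Real.sqrt_sq_eq_abs, hz, ← Real.sqrt_mul (sq_nonneg a)]
    exact Real.sqrt_le_sqrt (ha K)
  have hK2 : (0 : ℝ) < K - 2 := by
    have : (2 : ℝ) < K := by exact_mod_cast hK
    linarith
  have hpow : ((K : ℝ) + 1) ^ (-(1 / 3) : ℝ) ≤ ((K : ℝ) - 2) ^ (-(1 / 3) : ℝ) :=
    Real.rpow_le_rpow_of_nonpos hK2 (by linarith) (by norm_num)
  have hpow0 : 0 ≤ ((K : ℝ) - 2) ^ (-(1 / 3) : ℝ) := Real.rpow_nonneg hK2.le _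
  refine ⟨κ, h1, h2, h.x_mem hS.isRun h3, e1.mono (le_trans ?_ hDK), e2.mono (le_trans ?_ hDK),
    e3.mono (le_trans ?_ hDK)⟩
  · calc _ ≤ 4 * (|a| * z) * ((K : ℝ) - 2) ^ (-(1 / 3) : ℝ) := by gcongr
      _ = 4 * |a| * z * ((K : ℝ) - 2) ^ (-(1 / 3) : ℝ) := by ring
      _ ≤ _ := by gcongr
  · calc _ ≤ 2 * p * ‖Pb.A‖ * (|a| * z) * ((K : ℝ) - 2) ^ (-(1 / 3) : ℝ) := by gcongr
      _ = 2 * p * ‖Pb.A‖ * |a| * z * ((K : ℝ) - 2) ^ (-(1 / 3) : ℝ) := by ring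
      _ ≤ _ := by gcongr
  · calc _ ≤ 2 * (2 * p * ‖Pb.A‖ * prm.cη * (|a| * z) + r * z)
          * ((K : ℝ) - 2) ^ (-(1 / 3) : ℝ) := by
          gcongr
          exact le_mul_of_one_le_right hr0 hz1
      _ = 2 * (2 * p * ‖Pb.A‖ * prm.cη * |a| + r) * z * ((K : ℝ) - 2) ^ (-(1 / 3) : ℝ) := by ring
      _ ≤ _ := by gcongr

end Standing

end MarsAdmm

theorem mainTheorem1 {n m : ℕ} {Ξ : Type*} [MeasurableSpace Ξ]
    (Pb : MarsAdmm.Problem n m Ξ) (LF Lg : ℝ≥0) (σ Lt : ℝ) (hσ : 0 ≤ σ) (hLt : 0 ≤ Lt)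
    (hset : Pb.Setting) (hreg : Pb.Regular LF Lg)
    (hvar : Pb.BoundedVariance σ) (hmsl : Pb.MeanSqLipschitz Lt)
    (prm : MarsAdmm.Params n m) (cν cγ : ℝ) (hprm : prm.Admissible Pb cν cγ) :
    -- the geometric constants exist
    (∃ p q Lp ζ : ℝ, MarsAdmm.IsGeomConst Pb.M Pb.R Pb.T p q Lp ζ) ∧
    -- and for any choice of them for which the stepsize condition holds:
    ∀ p q Lp ζ : ℝ, MarsAdmm.IsGeomConst Pb.M Pb.R Pb.T p q Lp ζ →
      prm.StepBound Pb LF Lg Lt p q Lp ζ →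
      -- the explicit bounds
      (∀ (Ω : Type*) [MeasurableSpace Ω] (μ : Measure Ω) [IsProbabilityMeasure μ]
        (S : MarsAdmm.Trajectory n m Ω Ξ), S.IsMarsAdmm Pb prm μ →
        ∀ K : ℕ, 2 < K → ∃ κ : ℕ, ⌈(K : ℝ) / 2⌉₊ ≤ κ ∧ κ ≤ K ∧
          let Q := MarsAdmm.constQ Pb prm Lg σ cγ (MarsAdmm.merit Pb prm μ S cγ 1) K
          MarsAdmm.ExpLe μ (fun ω => MarsAdmm.statRes Pb (S.x κ ω) (S.lamBar Pb prm κ ω))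
            (4 * √Q * ((K : ℝ) + 1) ^ (-(1 / 3) : ℝ)) ∧
          MarsAdmm.ExpLe μ (fun ω => MarsAdmm.dualRes Pb (S.y κ ω) (S.lamBar Pb prm κ ω))
            (2 * p * ‖Pb.A‖ * √Q * ((K : ℝ) + 1) ^ (-(1 / 3) : ℝ)) ∧
          MarsAdmm.ExpLe μ (fun ω => MarsAdmm.feasRes Pb (S.x κ ω) (S.y κ ω))
            (2 * (2 * p * ‖Pb.A‖ * prm.cη * √Q + (Lg + MarsAdmm.lamMax Pb prm) / prm.cρ)
              * ((K : ℝ) - 2) ^ (-(1 / 3) : ℝ))) ∧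
      -- the iteration and oracle complexity, with batch sizes bounded by `bmax`
      (∀ bmax : ℕ, ∃ C₀ : ℝ, 0 < C₀ ∧ ∀ ε : ℝ, 0 < ε → ε < 1 → ∃ K : ℕ, 2 < K ∧
        (K : ℝ) ≤ C₀ * ε ^ (-3 : ℤ) * (1 + Real.log (1 / ε)) ^ (3 / 2 : ℝ) ∧
        ∀ (Ω : Type*) [MeasurableSpace Ω] (μ : Measure Ω) [IsProbabilityMeasure μ]
          (S : MarsAdmm.Trajectory n m Ω Ξ), S.IsMarsAdmm Pb prm μ → (∀ k, 1 ≤ k → S.b k ≤ bmax) →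
          (S.oracleCalls K : ℝ) ≤ C₀ * ε ^ (-3 : ℤ) * (1 + Real.log (1 / ε)) ^ (3 / 2 : ℝ) ∧
          ∃ κ : ℕ, ⌈(K : ℝ) / 2⌉₊ ≤ κ ∧ κ ≤ K ∧
            MarsAdmm.IsEpsStationary Pb μ ε (S.x κ) (S.y κ) (S.lamBar Pb prm κ)) := by
  refine ⟨MarsAdmm.exists_isGeomConst hset.submanifold hreg.compact hset.retraction hset.transport,
    fun p q Lp ζ hgeom hstep => ?_⟩
  have h : MarsAdmm.Standing Pb prm LF Lg σ Lt cν cγ p q Lp ζ :=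
    ⟨hset, hreg, hvar, hmsl, hprm, hgeom, hstep⟩
  refine ⟨fun Ω _ μ _ S hS K hK => ?_, h.complexity⟩
  obtain ⟨κ, h1, h2, -, hres⟩ := h.exists_residual_bounds hS hK
  exact ⟨κ, h1, h2, hres⟩
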